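/- Let $Q=\{\pm1,\pm i,\pm j,\pm k\}$ be the quaternion group and let $d\geq 5$ be an integer with $d\equiv 3 \pmod 8$. Let $X^{(d)}$ be the staircase-shaped square-tiled surface with $d$ squares, whose horizontal and vertical permutations are $(2,1)(4,3)\cdots(d-1,d-2)(d)$ and $(1)(2,3)(4,5)\cdots(d-1,d)$. It is drawn as a polygon in which the square $2m$ lies to the left of the square $2m-1$ and the square $2m+1$ lies on top of the square $2m$. Let $\widetilde X=\widetilde X^{(d)}$ be the cover obtained from copies $X_g$ ($g\in Q$) of this polygon by gluing the right boundary side of each row of $X_g$ to the left boundary side of the same row of $X_{gi}$, and the top boundary side of each column of $X_g$ to the bottom boundary side of the same column of $X_{gj}$. For $g\in Q$ let $\varphi_g$ be the automorphism of $\widetilde X$ that maps $X_h$ to $X_{gh}$ for every $h\in Q$. Let $H_1^-(\widetilde X)\subseteq H_1(\widetilde X;\mathbb R)$ be the subspace on which $(\varphi_{-1})_*$ acts as $-\mathrm{Id}$. Let $\mathrm{Aff}(\widetilde X)$ be the group of orientation-preserving homeomorphisms of $\widetilde X$ that are affine in the charts of the translation atlas, let $\mathrm{Aut}(\widetilde X)$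 be its subgroup of elements with trivial linear part, and let $\mathrm{Aff}_*(\widetilde X)$ be the subgroup of the elements of $\mathrm{Aff}(\widetilde X)$ that commute with every element of $\mathrm{Aut}(\widetilde X)$. Assume that there are rational directions $(p_r,q_r)$, $0\leq r<d$, such that: 1. for each $r$, the surface $\widetilde X$ decomposes in the direction $(p_r,q_r)$ into exactly eight cylinders, with waist curves $c_g^r$, $g\in Q$, all oriented in the direction $(p_r,q_r)$ and of the same length; 2. $(\varphi_h)_*c_g^r=c_{hg}^r$ in $H_1(\widetilde X;\mathbb R)$ for all $0\le r<d$ and $g,h\in Q$. For each $r$ let $T_r$ be a Dehn multitwist in the direction $(p_r,q_r)$, that is, an affine homeomorphism of $\widetilde X$ whose linear part is a non-trivial shear fixing $(p_r,q_r)$ and which fixes every point outside the open cylinders in the direction $(p_r,q_r)$; write $T_r$ also for its action on $H_1(\widetilde X;\mathbb R)$. Put $Q^+=\{1,i,j,k\}$, $\tilde c_g^r=c_g^r-c_{-g}^r$ for $g\in Q^+$, and $C_r=\langle \tilde c_g^r\rangle_{g\in Q^+}$. Assume moreover that: 3. the elements $\tilde c_g^r$, for $g\in Q^+$ and $0\le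 r<d$, form a basis of $H_1^-(\widetilde X)$; 4. for all $0\leq r,s<d$ with $r\neq s$ and all $v\in C_r\setminus\{0\}$, $T_sv\neq v$; 5. for every $v\in C_0\setminus\{0\}$, $C_0=\big\langle \{v\}\cup\{(T_0-\mathrm{Id})(T_r-\mathrm{Id})(T_1-\mathrm{Id})v\}_{r=2}^4\big\rangle$. Then every finite-index subgroup of $\mathrm{Aff}_*(\widetilde X)$ acts irreducibly on $H_1^-(\widetilde X)$ (over $\mathbb R$). -/

import Mathlib

open Topology Filter CategoryTheory

noncomputable section

/-! ### First real homology and classes of closed curves -/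

/-- The first singular homology group `H₁(X; ℝ)`. -/
abbrev H1 (X : Type) [TopologicalSpace X] : ModuleCat.{0} ℝ :=
  ((AlgebraicTopology.singularHomologyFunctor (ModuleCat.{0} ℝ) 1).obj
    (ModuleCat.of ℝ ℝ)).obj (TopCat.of X)

/-- The map induced on `H₁(·; ℝ)` by a continuous map. -/
def H1.map {X Y : Type} [TopologicalSpace X] [TopologicalSpace Y] (f : C(X, Y)) :
    H1 X →ₗ[ℝ] H1 Y :=
  (((AlgebraicTopology.singularHomologyFunctor (ModuleCat.{0} ℝ) 1).obj
    (ModuleCat.of ℝ ℝ)).map (TopCat.ofHom f)).hom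

/-- The action of the homeomorphisms of `X` on `H₁(X; ℝ)`. -/
def homologyRep (X : Type) [TopologicalSpace X] : Representation ℝ (X ≃ₜ X) (H1 X) where
  toFun f := H1.map (f : C(X, X))
  map_one' := by
    have h : TopCat.ofHom ((1 : X ≃ₜ X) : C(X, X)) = 𝟙 (TopCat.of X) := rfl
    simp only [H1.map, h, CategoryTheory.Functor.map_id]
    rfl
  map_mul' f g := by
    have h : TopCat.ofHom ((f * g : X ≃ₜ X) : C(X, X)) =
        TopCat.ofHom (g : C(X, X)) ≫ TopCat.ofHom (f : C(X, X)) := rfl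
    simp only [H1.map, h, CategoryTheory.Functor.map_comp]
    rfl

/-- The singular simplicial set of the circle `ℝ / ℤ`. -/
abbrev circleSSet : SSet.{0} := TopCat.toSSet.obj (TopCat.of UnitAddCircle)

/-- The singular `1`-simplex of the circle `ℝ / ℤ` that runs once around it:
`(1 - t, t) ↦ t mod 1`. -/
def circleSimplex : circleSSet.obj (Opposite.op (SimplexCategory.mk 1)) :=
  (TopCat.toSSetObjEquiv (TopCat.of UnitAddCircle) (Opposite.op (SimplexCategory.mk 1))).symm
    ⟨fun f : stdSimplex ℝ (Fin 2) => ((f.1 1 : ℝ) : UnitAddCircle),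
      (AddCircle.continuous_mk' 1).comp ((continuous_apply 1).comp continuous_subtype_val)⟩

theorem circleSimplex_face :
    circleSSet.δ 0 circleSimplex = circleSSet.δ 1 circleSimplex := by
  apply (TopCat.toSSetObjEquiv (TopCat.of UnitAddCircle)
    (Opposite.op (SimplexCategory.mk 0))).injective
  ext f
  change (((stdSimplex.map (SimplexCategory.δ (n := 0) 0) f).1 1 : ℝ) : UnitAddCircle) =
    (((stdSimplex.map (SimplexCategory.δ (n := 0) 1) f).1 1 : ℝ) : UnitAddCircle)
  obtain rfl : f = stdSimplex.vertex (0 : Fin 1) :=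
    Subsingleton.elim (α := stdSimplex ℝ (Fin 1)) _ _
  have h0 : stdSimplex.map (S := ℝ) (SimplexCategory.δ (n := 0) 0)
      (stdSimplex.vertex (0 : Fin 1)) = stdSimplex.vertex (1 : Fin 2) :=
    stdSimplex.map_vertex _ _
  have h1 : stdSimplex.map (S := ℝ) (SimplexCategory.δ (n := 0) 1)
      (stdSimplex.vertex (0 : Fin 1)) = stdSimplex.vertex (0 : Fin 2) :=
    stdSimplex.map_vertex _ _
  change (((stdSimplex.map (S := ℝ) (SimplexCategory.δ (n := 0) 0)
      (stdSimplex.vertex (0 : Fin 1)) : stdSimplex ℝ (Fin 2)).1 1 : ℝ) : UnitAddCircle) =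
    (((stdSimplex.map (S := ℝ) (SimplexCategory.δ (n := 0) 1)
      (stdSimplex.vertex (0 : Fin 1)) : stdSimplex ℝ (Fin 2)).1 1 : ℝ) : UnitAddCircle)
  rw [h0, h1]
  simp

theorem circleSimplex_cycle :
    circleSSet.ιChainComplex (R := ModuleCat.of ℝ ℝ) circleSimplex ≫
      (circleSSet.chainComplex (ModuleCat.of ℝ ℝ)).d 1 0 = 0 := by
  rw [SSet.ιChainComplex_d, Fin.sum_univ_two, circleSimplex_face]
  simp

/-- The fundamental class of the circle `ℝ / ℤ`: the class of `circleSimplex`. -/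
def circleClass : H1 UnitAddCircle :=
  ((circleSSet.chainComplex (ModuleCat.of ℝ ℝ)).liftCycles
      (circleSSet.ιChainComplex circleSimplex) 0 (by simp) circleSimplex_cycle ≫
    (circleSSet.chainComplex (ModuleCat.of ℝ ℝ)).homologyπ 1).hom (1 : ℝ)

/-- The class in `H₁(X; ℝ)` of a closed curve `ℝ / ℤ → X`. -/
def loopClass {X : Type} [TopologicalSpace X] (γ : C(UnitAddCircle, X)) : H1 X :=
  H1.map γ circleClass

/-! ### Square-tiled surfaces -/

/-- The flat torus `ℝ² / ℤ²`. -/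
abbrev FlatTorus : Type := UnitAddCircle × UnitAddCircle

/-- The quotient map `ℝ² → ℝ² / ℤ²`. -/
def toTorus (u : ℝ × ℝ) : FlatTorus := ((u.1 : UnitAddCircle), (u.2 : UnitAddCircle))

/-- The side identifications between the unit squares labelled by `S`: the right side of `s` is
glued to the left side of `h s` and the top side of `s` to the bottom side of `v s`. -/
inductive SquareGluing {S : Type} (h v : Equiv.Perm S) :
    (Σ _ : S, unitInterval × unitInterval) → (Σ _ : S, unitInterval × unitInterval) → Prop
  | right (s : S) (y : unitInterval) : SquareGluing h v ⟨s, (1, y)⟩ ⟨h s, (0, y)⟩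
  | top (s : S) (x : unitInterval) : SquareGluing h v ⟨s, (x, 1)⟩ ⟨v s, (x, 0)⟩

/-- The square-tiled surface with horizontal permutation `h` and vertical permutation `v`: the
disjoint union of the squares modulo the side identifications, with the quotient topology. -/
def SquareTiled {S : Type} (h v : Equiv.Perm S) : Type := Quot (SquareGluing h v)

namespace SquareTiled

variable {S : Type} {h v : Equiv.Perm S}

instance : TopologicalSpace (SquareTiled h v) :=
  inferInstanceAs (TopologicalSpace (Quot (SquareGluing h v)))

/-- The covering `X → ℝ² / ℤ²`, branched over `0`, of a square-tiled surface. The Abelian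
differential of `X` is the pullback of `dz`; local inverses of `ℝ² → ℝ² / ℤ²` composed with
this map are the charts of the translation atlas of `X`. -/
def proj : SquareTiled h v → FlatTorus :=
  Quot.lift (fun p => toTorus ((p.2.1 : ℝ), (p.2.2 : ℝ))) (by
    rintro _ _ (⟨s, y⟩ | ⟨s, x⟩) <;> simp [toTorus])

theorem continuous_proj : Continuous (proj : SquareTiled h v → FlatTorus) := by
  refine continuous_quot_lift _ ?_
  refine continuous_sigma fun s => ?_
  exact ((AddCircle.continuous_mk' 1).comp (by fun_prop)).prodMk
    ((AddCircle.continuous_mk' 1).comp (by fun_prop))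

/-- The singularities of a square-tiled surface, that is, the zeroes of its Abelian differential:
the points at which the covering of the torus is ramified. -/
def IsSingular (x : SquareTiled h v) : Prop := ¬ ∃ U ∈ 𝓝 x, Set.InjOn proj U

/-- The homeomorphism `f` is affine with linear part `A`: for every `x`, every point `p` close
to `x` and every small vector `u` such that `p` is `x + u` in the translation structure, `f p` is
`f x + A u` in the translation structure. -/
def IsAffineWith (f : SquareTiled h v ≃ₜ SquareTiled h v) (A : (ℝ × ℝ) →ₗ[ℝ] (ℝ × ℝ)) : Prop :=
  ∀ x, ∀ᶠ q : SquareTiled h v × (ℝ × ℝ) in 𝓝 x ×ˢ 𝓝 0,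
    proj q.1 = proj x + toTorus q.2 → proj (f q.1) = proj (f x) + toTorus (A q.2)

theorem IsAffineWith.one : IsAffineWith (1 : SquareTiled h v ≃ₜ SquareTiled h v) 1 :=
  fun _ => Eventually.of_forall fun _ hq => hq

theorem IsAffineWith.mul {f g : SquareTiled h v ≃ₜ SquareTiled h v}
    {A B : (ℝ × ℝ) →ₗ[ℝ] (ℝ × ℝ)} (hf : IsAffineWith f A) (hg : IsAffineWith g B) :
    IsAffineWith (f * g) (A * B) := by
  intro x
  have hB : Tendsto B (𝓝 0) (𝓝 0) := by
    simpa using (LinearMap.continuous_of_finiteDimensional B).tendsto 0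
  have ht := (g.continuous.tendsto x).prodMap hB
  filter_upwards [hg x, ht.eventually (hf (g x))] with q h1 h2 hq
  exact h2 (h1 hq)

theorem toTorus_sub (u w : ℝ × ℝ) : toTorus (u - w) = toTorus u - toTorus w := rfl

theorem isOpenMap_toTorus : IsOpenMap toTorus :=
  QuotientAddGroup.isOpenMap_coe.prodMap QuotientAddGroup.isOpenMap_coe

theorem coe_small {t : ℝ} (ht : |t| < 1) (h0 : (t : UnitAddCircle) = 0) : t = 0 := by
  obtain ⟨n, hn⟩ := (AddCircle.coe_eq_zero_iff (1 : ℝ)).1 h0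
  rw [zsmul_one] at hn
  rw [← hn] at ht ⊢
  have : |n| < 1 := by exact_mod_cast ht
  rw [Int.abs_lt_one_iff.1 this, Int.cast_zero]

theorem toTorus_injOn_small : ∀ᶠ q : (ℝ × ℝ) × (ℝ × ℝ) in 𝓝 0 ×ˢ 𝓝 0,
    toTorus q.1 = toTorus q.2 → q.1 = q.2 := by
  have h : ∀ᶠ q : (ℝ × ℝ) × (ℝ × ℝ) in 𝓝 0 ×ˢ 𝓝 0, ‖q.1 - q.2‖ < 1 := by
    rw [← nhds_prod_eq]
    have hc : Continuous fun q : (ℝ × ℝ) × (ℝ × ℝ) => ‖q.1 - q.2‖ := by fun_prop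
    refine hc.continuousAt.eventually_lt continuousAt_const ?_
    simp
  filter_upwards [h] with q hq he
  have h0 : toTorus (q.1 - q.2) = 0 := by rw [toTorus_sub, he, sub_self]
  have h1 := (max_lt_iff.1 (Prod.norm_def (q.1 - q.2) ▸ hq))
  refine sub_eq_zero.1 (Prod.ext ?_ ?_)
  · exact coe_small h1.1 (congrArg Prod.fst h0)
  · exact coe_small h1.2 (congrArg Prod.snd h0)

theorem IsAffineWith.inv {f : SquareTiled h v ≃ₜ SquareTiled h v}
    {A : (ℝ × ℝ) ≃ₗ[ℝ] (ℝ × ℝ)} (hf : IsAffineWith f A) :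
    IsAffineWith f⁻¹ (A.symm : (ℝ × ℝ) →ₗ[ℝ] (ℝ × ℝ)) := by
  intro y
  have hA : Tendsto A (𝓝 0) (𝓝 0) := by
    simpa using (LinearMap.continuous_of_finiteDimensional (A : (ℝ × ℝ) →ₗ[ℝ] (ℝ × ℝ))).tendsto 0
  obtain ⟨P, hP, N, hN, hPN⟩ := eventually_prod_iff.1 (hf (f.symm y))
  obtain ⟨N₁, hN₁, N₂, hN₂, hNN⟩ := eventually_prod_iff.1 toTorus_injOn_small
  have hM : ∀ᶠ u in 𝓝 (0 : ℝ × ℝ), N u ∧ N₁ (A u) := hN.and (hA.eventually hN₁)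
  have hopen : toTorus '' {u | N u ∧ N₁ (A u)} ∈ 𝓝 (0 : FlatTorus) :=
    isOpenMap_toTorus.image_mem_nhds hM
  have hcont : Tendsto (fun q => proj (f.symm q) - proj (f.symm y)) (𝓝 y) (𝓝 0) := by
    have hc : Continuous fun q => proj (f.symm q) - proj (f.symm y) :=
      (continuous_proj.comp f.symm.continuous).sub continuous_const
    simpa using hc.tendsto y
  have hP' := (f.symm.continuous.tendsto y).eventually hP
  refine eventually_prod_iff.2 ⟨fun q => P (f.symm q) ∧
    proj (f.symm q) - proj (f.symm y) ∈ toTorus '' {u | N u ∧ N₁ (A u)},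
    hP'.and (hcont hopen), N₂, hN₂, ?_⟩
  rintro q ⟨hq1, u, ⟨hu1, hu2⟩, hu⟩ w hw hqw
  have h1 : proj (f.symm q) = proj (f.symm y) + toTorus u := by rw [hu]; abel
  have h2 := hPN hq1 hu1 h1
  simp only [Homeomorph.apply_symm_apply] at h2 hqw
  have h3 : toTorus (A u) = toTorus w := by
    rw [h2] at hqw
    exact add_left_cancel hqw
  have h4 : A u = w := hNN hu2 hw h3
  simpa [← h4] using h1

variable (h v) in
/-- The group of affine homeomorphisms: the orientation-preserving homeomorphisms which are
affine in the charts of the translation atlas. -/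
def Aff : Subgroup (SquareTiled h v ≃ₜ SquareTiled h v) where
  carrier := {f | ∃ A : (ℝ × ℝ) →ₗ[ℝ] (ℝ × ℝ), 0 < LinearMap.det A ∧ IsAffineWith f A}
  one_mem' := ⟨1, by simp, IsAffineWith.one⟩
  mul_mem' := by
    rintro f g ⟨A, hA, hf⟩ ⟨B, hB, hg⟩
    exact ⟨A * B, by rw [map_mul]; positivity, hf.mul hg⟩
  inv_mem' := by
    rintro f ⟨A, hA, hf⟩
    obtain ⟨A, rfl⟩ : ∃ A' : (ℝ × ℝ) ≃ₗ[ℝ] (ℝ × ℝ), (A' : (ℝ × ℝ) →ₗ[ℝ] (ℝ × ℝ)) = A :=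
      ⟨LinearEquiv.ofIsUnitDet (f := A) (v := Module.finBasis ℝ (ℝ × ℝ))
        (v' := Module.finBasis ℝ (ℝ × ℝ))
        (by rw [LinearMap.det_toMatrix]; exact hA.ne'.isUnit), by ext <;> rfl⟩
    refine ⟨_, ?_, hf.inv⟩
    have h1 := LinearEquiv.det_symm_mul_det A
    exact pos_of_mul_pos_left (h1 ▸ one_pos) hA.le

variable (h v) in
/-- The group of automorphisms: the affine homeomorphisms with trivial linear part. -/
def Aut : Subgroup (SquareTiled h v ≃ₜ SquareTiled h v) where
  carrier := {f | IsAffineWith f 1}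
  one_mem' := IsAffineWith.one
  mul_mem' := fun hf hg => by simpa using IsAffineWith.mul hf hg
  inv_mem' := fun hf => IsAffineWith.inv (A := LinearEquiv.refl ℝ (ℝ × ℝ)) hf

variable (h v) in
/-- The group of the affine homeomorphisms that commute with every automorphism. -/
def AffStar : Subgroup (SquareTiled h v ≃ₜ SquareTiled h v) :=
  Aff h v ⊓ Subgroup.centralizer (Aut h v : Set (SquareTiled h v ≃ₜ SquareTiled h v))

/-- A permutation of the squares that commutes with `h` and `v` maps the surface to itself. -/
def relabel (σ : Equiv.Perm S) (hh : Commute σ h) (hv : Commute σ v) :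
    C(SquareTiled h v, SquareTiled h v) where
  toFun := Quot.map (fun p => ⟨σ p.1, p.2⟩) (by
    rintro _ _ (⟨s, y⟩ | ⟨s, x⟩)
    · have e : σ (h s) = h (σ s) := congrArg (fun τ => τ s) hh.eq
      simpa only [e] using SquareGluing.right (σ s) y
    · have e : σ (v s) = v (σ s) := congrArg (fun τ => τ s) hv.eq
      simpa only [e] using SquareGluing.top (σ s) x)
  continuous_toFun := by
    refine continuous_quot_lift _ (continuous_quot_mk.comp ?_)
    exact continuous_sigma fun s =>
      continuous_sigmaMk (σ := fun _ : S => unitInterval × unitInterval) (i := σ s)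

/-- The automorphism of the surface defined by a permutation of the squares that commutes with
`h` and `v`. -/
def relabelHomeo (σ : Equiv.Perm S) (hh : Commute σ h) (hv : Commute σ v) :
    SquareTiled h v ≃ₜ SquareTiled h v where
  toFun := relabel σ hh hv
  invFun := relabel σ⁻¹ hh.inv_left hv.inv_left
  left_inv := by
    rintro ⟨s, p⟩
    exact congrArg (Quot.mk _) (by simp)
  right_inv := by
    rintro ⟨s, p⟩
    exact congrArg (Quot.mk _) (by simp)
  continuous_toFun := (relabel σ hh hv).continuous
  continuous_invFun := (relabel σ⁻¹ hh.inv_left hv.inv_left).continuous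

theorem proj_relabelHomeo (σ : Equiv.Perm S) (hh : Commute σ h) (hv : Commute σ v)
    (x : SquareTiled h v) : proj (relabelHomeo σ hh hv x) = proj x := by
  rcases x with ⟨s, p⟩
  rfl

theorem relabelHomeo_mem_aut (σ : Equiv.Perm S) (hh : Commute σ h) (hv : Commute σ v) :
    relabelHomeo σ hh hv ∈ Aut h v := fun x =>
  Eventually.of_forall fun q hq => by
    rw [proj_relabelHomeo, proj_relabelHomeo]; exact hq

/-! ### Cylinders and Dehn multitwists -/

/-- The vector `t • (p, q)` for an integer direction `(p, q)`. -/
def along (θ : ℤ × ℤ) (t : ℝ) : ℝ × ℝ := (t * θ.1, t * θ.2)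

/-- `γ : ℝ / ℤ → X` is a simple closed geodesic in the direction `θ`, free of singularities and of
length `L * ‖θ‖`, parametrized with constant velocity `L • θ`. -/
structure IsClosedGeodesic (θ : ℤ × ℤ) (L : ℝ) (γ : C(UnitAddCircle, SquareTiled h v)) :
    Prop where
  pos : 0 < L
  injective : Function.Injective γ
  regular : ∀ t, ¬ IsSingular (γ t)
  straight : ∀ t : ℝ, proj (γ (t : UnitAddCircle)) = proj (γ 0) + toTorus (along θ (L * t))

variable (h v) in
/-- The union of the open cylinders in the direction `θ`, that is, of all the closed geodesics in
this direction. The cylinders in the direction `θ` are its connected components. -/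
def cylinderSet (θ : ℤ × ℤ) : Set (SquareTiled h v) :=
  {x | ∃ (L : ℝ) (γ : C(UnitAddCircle, SquareTiled h v)), IsClosedGeodesic θ L γ ∧ γ 0 = x}

/-- The curves `c i` are waist curves, all of the same length `L * ‖θ‖`, of the cylinders in the
direction `θ`: every cylinder contains exactly one of them. -/
structure IsCylinderDecomposition {ι : Type} (θ : ℤ × ℤ) (L : ℝ)
    (c : ι → C(UnitAddCircle, SquareTiled h v)) : Prop where
  geodesic : ∀ i, IsClosedGeodesic θ L (c i)
  bijective : Function.Bijective fun i =>
    ((⟨c i 0, L, c i, geodesic i, rfl⟩ : cylinderSet h v θ) :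
      ConnectedComponents (cylinderSet h v θ))

/-- `T` is a Dehn multitwist in the direction `θ`: an affine homeomorphism whose linear part is a
non-trivial shear in the direction `θ` and which fixes every point outside the open cylinders in
this direction. -/
def IsDehnMultitwist (θ : ℤ × ℤ) (T : SquareTiled h v ≃ₜ SquareTiled h v) : Prop :=
  (∃ A : (ℝ × ℝ) →ₗ[ℝ] (ℝ × ℝ), LinearMap.det A = 1 ∧ A ≠ 1 ∧ A (along θ 1) = along θ 1 ∧
    IsAffineWith T A) ∧ ∀ x ∉ cylinderSet h v θ, T x = x

end SquareTiled

/-! ### The quaternionic covers of the staircases -/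

/-- The quaternion group `{±1, ±i, ±j, ±k}`. -/
abbrev Q8 : Type := QuaternionGroup 2

namespace Q8

/-- The element `-1`. -/
def neg : Q8 := QuaternionGroup.a 2
/-- The element `i`. -/
def i : Q8 := QuaternionGroup.a 1
/-- The element `j`. -/
def j : Q8 := QuaternionGroup.xa 0
/-- The element `k = i j`. -/
def k : Q8 := i * j

/-- The list `1, i, j, k`. -/
def plus : Fin 4 → Q8 := ![1, i, j, k]

end Q8

/-- The horizontal permutation of the staircase with `d` squares, `d` odd. The squares
`1, …, d` are labelled `0, …, d - 1`, so this is `(0 1)(2 3)⋯(d-3 d-2)(d-1)`. -/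
def stairH (d : ℕ) : Equiv.Perm (Fin d) :=
  Function.Involutive.toPerm
    (fun s => if hs : s.1 % 2 = 0 then (if hd : s.1 + 1 < d then ⟨s.1 + 1, hd⟩ else s)
      else ⟨s.1 - 1, by omega⟩)
    (by
      intro s
      ext
      by_cases h1 : s.1 % 2 = 0 <;> by_cases h2 : s.1 + 1 < d <;> by_cases h3 : s.1 = 0 <;>
        grind)

/-- The vertical permutation of the staircase with `d` squares, `d` odd, with the same labels:
`(0)(1 2)(3 4)⋯(d-2 d-1)`. -/
def stairV (d : ℕ) : Equiv.Perm (Fin d) :=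
  Function.Involutive.toPerm
    (fun s => if hs : s.1 % 2 = 1 then (if hd : s.1 + 1 < d then ⟨s.1 + 1, hd⟩ else s)
      else ⟨s.1 - 1, by omega⟩)
    (by
      intro s
      ext
      by_cases h1 : s.1 % 2 = 0 <;> by_cases h2 : s.1 + 1 < d <;> by_cases h3 : s.1 = 0 <;>
        grind)

/-- The permutation `(g, s) ↦ (g * a s, σ s)`. -/
def coverPerm {d : ℕ} (a : Fin d → Q8) (σ : Equiv.Perm (Fin d)) : Equiv.Perm (Q8 × Fin d) where
  toFun x := (x.1 * a x.2, σ x.2)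
  invFun x := (x.1 * (a (σ.symm x.2))⁻¹, σ.symm x.2)
  left_inv x := by simp
  right_inv x := by simp

/-- The squares of the cover are `(g, s)`, the square `s` of the copy `g` of the staircase. In the
staircase polygon, square `s + 1` (for even `s`) lies to the left of square `s`, and square `s + 1`
(for odd `s`) lies on top of square `s`. Hence the right side of the square `s` is interior to
the polygon when `s` is odd, and it lies on its boundary when `s` is even; only in the second case
the gluing passes from the copy `g` to the copy `g i`. -/
def coverH (d : ℕ) : Equiv.Perm (Q8 × Fin d) :=
  coverPerm (fun s => if s.1 % 2 = 0 then Q8.i else 1) (stairH d)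

/-- Likewise, the top side of the square `s` is interior to the staircase polygon when `s` is odd,
and it lies on its boundary when `s` is even; only in the second case the gluing passes from the
copy `g` to the copy `g j`. -/
def coverV (d : ℕ) : Equiv.Perm (Q8 × Fin d) :=
  coverPerm (fun s => if s.1 % 2 = 0 then Q8.j else 1) (stairV d)

/-- The quaternionic cover of the staircase with `d` squares. -/
abbrev QCover (d : ℕ) : Type := SquareTiled (coverH d) (coverV d)

/-- The permutation `(h, s) ↦ (g h, s)` of the squares of the cover. -/
def leftMul (d : ℕ) (g : Q8) : Equiv.Perm (Q8 × Fin d) :=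
  Equiv.prodCongr (Equiv.mulLeft g) (Equiv.refl _)

theorem leftMul_commute {d : ℕ} (g : Q8) (a : Fin d → Q8) (σ : Equiv.Perm (Fin d)) :
    Commute (leftMul d g) (coverPerm a σ) :=
  Equiv.ext fun x => Prod.ext (mul_assoc g x.1 (a x.2)).symm rfl

/-- The automorphism `φ_g` of the cover, which maps the copy `h` of the staircase to the copy
`g h`. -/
def deck (d : ℕ) (g : Q8) : QCover d ≃ₜ QCover d :=
  SquareTiled.relabelHomeo (leftMul d g) (leftMul_commute g _ _) (leftMul_commute g _ _)

/-- The group of the affine homeomorphisms of the cover that commute with its automorphisms. -/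
abbrev AffStar (d : ℕ) : Subgroup (QCover d ≃ₜ QCover d) :=
  SquareTiled.AffStar (coverH d) (coverV d)

/-- The subspace `H₁⁻` of `H₁(·; ℝ)` of the cover on which `φ_{-1}` acts as `-1`. -/
def H1minus (d : ℕ) : Submodule ℝ (H1 (QCover d)) :=
  Module.End.eigenspace (homologyRep (QCover d) (deck d Q8.neg)) (-1)

/-- The action on `H₁⁻` of the affine homeomorphisms that commute with the automorphisms. -/
def minusRep (d : ℕ) : Representation ℝ (AffStar d) (H1minus d) :=
  Representation.subrepresentation ((homologyRep (QCover d)).comp (AffStar d).subtype)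
    (H1minus d) (by
      intro f u hu
      have hc : deck d Q8.neg * f.1 = f.1 * deck d Q8.neg :=
        (Subgroup.mem_centralizer_iff.1 f.2.2) _ (SquareTiled.relabelHomeo_mem_aut _ _ _)
      have hu' := Module.End.mem_eigenspace_iff.1 hu
      refine Module.End.mem_eigenspace_iff.2 ?_
      change homologyRep _ (deck d Q8.neg) (homologyRep _ f.1 u) = -1 • homologyRep _ f.1 u
      rw [← Module.End.mul_apply, ← map_mul, hc, map_mul, Module.End.mul_apply, hu', map_smul])

/-- The class `c_g - c_{-g}` in `H₁`, for the `a`-th element `g` of the list `1, i, j, k`. -/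
def cTilde {d : ℕ} (c : Q8 → C(UnitAddCircle, QCover d)) (a : Fin 4) : H1 (QCover d) :=
  loopClass (c (Q8.plus a)) - loopClass (c (Q8.neg * Q8.plus a))

/-- The span of the classes `c_g - c_{-g}` for `g = 1, i, j, k`. -/
def cSpan {d : ℕ} (c : Q8 → C(UnitAddCircle, QCover d)) : Submodule ℝ (H1 (QCover d)) :=
  Submodule.span ℝ (Set.range (cTilde c))

end

/-! Write `N_r = T_r - 1` on `H₁⁻` and `C_r` for the span of the four classes `c̃_g^r`. A multitwist
acts by `N_r u = Σ_a φ_{r,a}(u) c̃_a^r`, where `φ_{r,a}(u)` is, up to a non-zero factor, the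
algebraic number of times that `u` crosses the cylinder of `c_a^r`. Waist curves of parallel
cylinders do not cross, so `N_r² = 0` and `T_r^k = 1 + k N_r`. Some positive power of `T_r` lies in
a given finite-index subgroup, so every subspace `W` invariant under this subgroup is invariant
under each `N_r`.

The rest is linear algebra (`eq_top_of_transvections`). If the functionals `φ_{r,a}` separate the
points of `H₁⁻`, a non-zero `W` contains some non-zero `N_r u ∈ C_r`. By condition 4 each `N_s` is
injective on `C_r` for `s ≠ r`, so `W` meets `C_0` non-trivially. Condition 5 then gives `C_0 ⊆ W`;
since all `C_s` have dimension four, `N_s` maps `C_0` onto `C_s`, hence `C_s ⊆ W` for every `s`, and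
condition 3 gives `W = H₁⁻`.

The separation of points is the non-degeneracy of the intersection form on `H₁⁻`, obtained here by a
direct duality. The class of a waist curve is a sum of paths between the middles of neighbouring
squares, with coefficients equal to the variation of the height of its cylinder along the sides of
the squares (`IsCylinderDecomposition.seg_eq_sum_deg`). For `d ≡ 3 mod 8` the automorphism `φ_{-1}`
fixes every vertex (`QCover.deck_neg_vertex`), so a side minus its image under `φ_{-1}` is a class
of `H₁⁻`. A linear relation between the `φ_{r,a}`, evaluated on these classes, is therefore a
relation between the `c̃_a^r`, which are independent (`QCover.eq_zero_of_sum_apply_eq_zero`).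

The fixed vertices matter a second time: they are all singular. Hence cylinders are bounded exactly
by the lines through lattice points, automorphisms preserve the projection to the torus, and the
multitwists commute with them. All computations with paths take place in `1`-chains modulo
boundaries, where `H₁` embeds and non-closed paths also have classes. -/

noncomputable section

/-! ### Chains modulo boundaries -/

/-- The singular chain complex of `X` with real coefficients. -/
abbrev singChains (X : Type) [TopologicalSpace X] : ChainComplex (ModuleCat.{0} ℝ) ℕ :=
  (TopCat.toSSet.obj (TopCat.of X)).chainComplex (ModuleCat.of ℝ ℝ)

/-- Singular `1`-chains modulo boundaries. -/
abbrev PathMod (X : Type) [TopologicalSpace X] : ModuleCat.{0} ℝ := (singChains X).opcycles 1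

namespace PathMod

variable {X Y : Type} [TopologicalSpace X] [TopologicalSpace Y]

/-- The singular simplex defined by a continuous map on the standard simplex. -/
def simplex (n : ℕ) (σ : C(stdSimplex ℝ (Fin (n + 1)), X)) :
    (TopCat.toSSet.obj (TopCat.of X)).obj (Opposite.op (SimplexCategory.mk n)) :=
  (TopCat.toSSetObjEquiv (TopCat.of X) (Opposite.op (SimplexCategory.mk n))).symm σ

/-- The class of a singular `1`-simplex. -/
def mk (σ : C(stdSimplex ℝ (Fin 2), X)) : PathMod X :=
  ((TopCat.toSSet.obj (TopCat.of X)).ιChainComplex (simplex 1 σ) ≫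
    (singChains X).pOpcycles 1).hom (1 : ℝ)

/-- The faces of a singular `2`-simplex. -/
def face (i : Fin 3) (σ : C(stdSimplex ℝ (Fin 3), X)) : C(stdSimplex ℝ (Fin 2), X) :=
  σ.comp ⟨stdSimplex.map (SimplexCategory.δ (n := 1) i), stdSimplex.continuous_map _⟩

theorem simplex_face (i : Fin 3) (σ : C(stdSimplex ℝ (Fin 3), X)) :
    (TopCat.toSSet.obj (TopCat.of X)).δ i (simplex 2 σ) = simplex 1 (face i σ) := by
  rfl

/-- The alternating sum of the three faces is a boundary, so it vanishes in the quotient. -/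
theorem mk_face (σ : C(stdSimplex ℝ (Fin 3), X)) :
    mk (face 1 σ) = mk (face 0 σ) + mk (face 2 σ) := by
  have h := SSet.ιChainComplex_d (TopCat.toSSet.obj (TopCat.of X)) (ModuleCat.of ℝ ℝ)
    (n := 1) (simplex 2 σ)
  rw [Fin.sum_univ_three] at h
  have h2 := congrArg (fun f => f ≫ (singChains X).pOpcycles 1) h
  simp only [Category.assoc, HomologicalComplex.d_pOpcycles, Limits.comp_zero,
    simplex_face] at h2
  have h3 := congrArg (fun f => f.hom (1 : ℝ)) h2
  have h4 : (0 : PathMod X) = mk (face 0 σ) - mk (face 1 σ) + mk (face 2 σ) := by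
    simpa [Preadditive.add_comp, sub_eq_add_neg, mk] using h3
  rw [eq_comm, ← sub_eq_zero, h4]
  abel

/-- The map induced on chains modulo boundaries by a continuous map. -/
def map (f : C(X, Y)) : PathMod X →ₗ[ℝ] PathMod Y :=
  (HomologicalComplex.opcyclesMap (SSet.chainComplexMap (TopCat.toSSet.map (TopCat.ofHom f))
    (ModuleCat.of ℝ ℝ)) 1).hom

theorem map_mk (f : C(X, Y)) (σ : C(stdSimplex ℝ (Fin 2), X)) : map f (mk σ) = mk (f.comp σ) := by
  unfold map mk
  rw [← ModuleCat.comp_apply, Category.assoc, HomologicalComplex.p_opcyclesMap,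
    SSet.ι_chainComplexMap_f_assoc]
  rfl

/-- The inclusion of `H₁` into chains modulo boundaries. -/
def ofH1 (X : Type) [TopologicalSpace X] : H1 X →ₗ[ℝ] PathMod X :=
  ((singChains X).homologyι 1).hom

theorem ofH1_injective : Function.Injective (ofH1 X) :=
  (ModuleCat.mono_iff_injective ((singChains X).homologyι 1)).1 inferInstance

theorem ofH1_map (f : C(X, Y)) (u : H1 X) : ofH1 Y (H1.map f u) = map f (ofH1 X u) := by
  have h := HomologicalComplex.homologyι_naturality (SSet.chainComplexMap (TopCat.toSSet.map
    (TopCat.ofHom f)) (ModuleCat.of ℝ ℝ)) 1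
  exact congrArg (fun k => k.hom u) h

theorem ofH1_circleClass : ofH1 UnitAddCircle circleClass =
    mk ⟨fun f : stdSimplex ℝ (Fin 2) => ((f.1 1 : ℝ) : UnitAddCircle),
      (AddCircle.continuous_mk' 1).comp ((continuous_apply 1).comp continuous_subtype_val)⟩ := by
  have h : (circleSSet.chainComplex (ModuleCat.of ℝ ℝ)).liftCycles
      (circleSSet.ιChainComplex circleSimplex) 0 (by simp) circleSimplex_cycle ≫
    (circleSSet.chainComplex (ModuleCat.of ℝ ℝ)).homologyπ 1 ≫
    (circleSSet.chainComplex (ModuleCat.of ℝ ℝ)).homologyι 1 =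
    circleSSet.ιChainComplex circleSimplex ≫
      (circleSSet.chainComplex (ModuleCat.of ℝ ℝ)).pOpcycles 1 := by
    rw [HomologicalComplex.homology_π_ι, HomologicalComplex.liftCycles_i_assoc]
  exact congrArg (fun k => k.hom (1 : ℝ)) h

/-- The difference of two simplices with the same end points is a cycle. Classes of `H₁⁻` are
produced in this way from sides of squares. -/
theorem exists_hom_of_closed (σ σ' : C(stdSimplex ℝ (Fin 2), X))
    (h0 : σ (stdSimplex.vertex 0) = σ' (stdSimplex.vertex 0))
    (h1 : σ (stdSimplex.vertex 1) = σ' (stdSimplex.vertex 1)) :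
    ∃ u, ofH1 X u = mk σ - mk σ' := by
  let S := TopCat.toSSet.obj (TopCat.of X)
  have key (i : Fin 2) (τ τ' : C(stdSimplex ℝ (Fin 2), X)) (j : Fin 2)
      (hij : (SimplexCategory.δ (n := 0) i) 0 = j)
      (h : τ (stdSimplex.vertex j) = τ' (stdSimplex.vertex j)) :
      S.δ i (simplex 1 τ) = S.δ i (simplex 1 τ') := by
    apply (TopCat.toSSetObjEquiv (TopCat.of X) (Opposite.op (SimplexCategory.mk 0))).injective
    ext f
    change τ (stdSimplex.map (SimplexCategory.δ (n := 0) i) f) =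
      τ' (stdSimplex.map (SimplexCategory.δ (n := 0) i) f)
    obtain rfl : f = stdSimplex.vertex (0 : Fin 1) :=
      Subsingleton.elim (α := stdSimplex ℝ (Fin 1)) _ _
    have hv : stdSimplex.map (S := ℝ) (SimplexCategory.δ (n := 0) i)
        (stdSimplex.vertex (0 : Fin 1)) = stdSimplex.vertex j := by
      rw [← hij]; exact stdSimplex.map_vertex _ _
    erw [hv]
    exact h
  have hd : (S.ιChainComplex (simplex 1 σ) - S.ιChainComplex (simplex 1 σ')) ≫
      (singChains X).d 1 0 = 0 := by
    rw [Preadditive.sub_comp, SSet.ιChainComplex_d, SSet.ιChainComplex_d, Fin.sum_univ_two,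
      Fin.sum_univ_two, key 0 σ σ' 1 rfl h1, key 1 σ σ' 0 rfl h0, sub_self]
  refine ⟨((singChains X).liftCycles (S.ιChainComplex (simplex 1 σ) -
    S.ιChainComplex (simplex 1 σ')) 0 (by simp) hd ≫ (singChains X).homologyπ 1).hom (1 : ℝ), ?_⟩
  have h : (singChains X).liftCycles (S.ιChainComplex (simplex 1 σ) -
      S.ιChainComplex (simplex 1 σ')) 0 (by simp) hd ≫ (singChains X).homologyπ 1 ≫
      (singChains X).homologyι 1 = S.ιChainComplex (simplex 1 σ) ≫ (singChains X).pOpcycles 1 -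
      S.ιChainComplex (simplex 1 σ') ≫ (singChains X).pOpcycles 1 := by
    rw [HomologicalComplex.homology_π_ι, HomologicalComplex.liftCycles_i_assoc,
      Preadditive.sub_comp]
  exact congrArg (fun k => k.hom (1 : ℝ)) h

/-- The hypothesis says that the cochain `φ` is a cocycle, so its linear extension kills boundaries
and descends to the quotient. -/
theorem exists_functional (φ : C(stdSimplex ℝ (Fin 2), X) → ℝ)
    (hφ : ∀ σ : C(stdSimplex ℝ (Fin 3), X), φ (face 1 σ) = φ (face 0 σ) + φ (face 2 σ)) :
    ∃ f : PathMod X →ₗ[ℝ] ℝ, ∀ σ, f (mk σ) = φ σ := by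
  let S := TopCat.toSSet.obj (TopCat.of X)
  let e (n : ℕ) := TopCat.toSSetObjEquiv (TopCat.of X) (Opposite.op (SimplexCategory.mk n))
  let k : (singChains X).X 1 ⟶ ModuleCat.of ℝ ℝ :=
    Limits.Cofan.IsColimit.desc (S.isColimitChainComplexXCofan (ModuleCat.of ℝ ℝ) 1)
      (fun x => ModuleCat.ofHom (φ (e 1 x) • LinearMap.id))
  have hk (x) : S.ιChainComplex x ≫ k = ModuleCat.ofHom (φ (e 1 x) • LinearMap.id) :=
    Limits.Cofan.IsColimit.fac (S.isColimitChainComplexXCofan (ModuleCat.of ℝ ℝ) 1) _ x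
  have hdk : (singChains X).d 2 1 ≫ k = 0 := by
    refine SSet.chainComplex_hom_ext fun x => ?_
    obtain ⟨σ, rfl⟩ : ∃ σ, simplex 2 σ = x := ⟨e 2 x, Equiv.symm_apply_apply _ _⟩
    rw [SSet.ιChainComplex_d_assoc, Fin.sum_univ_three]
    simp only [simplex_face, Preadditive.add_comp, Preadditive.zsmul_comp, S] at hk ⊢
    rw [hk, hk, hk, Limits.comp_zero]
    have h0 (τ : C(stdSimplex ℝ (Fin 2), X)) : e 1 (simplex 1 τ) = τ := Equiv.apply_symm_apply _ _
    ext
    simp [h0, hφ σ]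
  refine ⟨((singChains X).descOpcycles k 2 (by simp) hdk).hom, fun σ => ?_⟩
  have h : (S.ιChainComplex (simplex 1 σ) ≫ (singChains X).pOpcycles 1) ≫
      (singChains X).descOpcycles k 2 (by simp) hdk = ModuleCat.ofHom (φ σ • LinearMap.id) := by
    rw [Category.assoc, HomologicalComplex.p_descOpcycles, hk]
    exact congrArg (fun τ => ModuleCat.ofHom (φ τ • LinearMap.id)) (Equiv.apply_symm_apply _ _)
  refine (congrArg (fun k => k.hom (1 : ℝ)) h).trans ?_
  simp

end PathMod

namespace PathMod

variable {X Y : Type} [TopologicalSpace X] [TopologicalSpace Y]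
variable {E E' : Type} [AddCommGroup E] [Module ℝ E] [AddCommGroup E'] [Module ℝ E']

/-! ### Classes of paths -/

/-- The class of the path `t ↦ F ((1 - t) A + t B)`. -/
def seg (F : E → X) (A B : E) : PathMod X := by
  classical
  exact if h : Continuous fun f : stdSimplex ℝ (Fin 2) => F (f 0 • A + f 1 • B) then mk ⟨_, h⟩
    else 0

/-- No continuity is needed: if one path is discontinuous, so is the other, and `seg` gives both the
default value `0`. -/
theorem seg_congr {F : E → X} {G : E' → X} {A B : E} {A' B' : E'}
    (h : ∀ t ∈ Set.Icc (0 : ℝ) 1, F ((1 - t) • A + t • B) = G ((1 - t) • A' + t • B')) :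
    seg F A B = seg G A' B' := by
  have : (fun f : stdSimplex ℝ (Fin 2) => F (f 0 • A + f 1 • B)) =
      fun f : stdSimplex ℝ (Fin 2) => G (f 0 • A' + f 1 • B') := by
    funext f
    have h0 : f 0 = 1 - f 1 := by linarith [stdSimplex.add_eq_one f]
    rw [h0]
    exact h _ ⟨stdSimplex.zero_le f 1, stdSimplex.le_one f 1⟩
  unfold seg
  by_cases hc : Continuous fun f : stdSimplex ℝ (Fin 2) => F (f 0 • A + f 1 • B)
  · have hc' := this ▸ hc
    rw [dif_pos hc, dif_pos hc']
    congr 1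
    exact ContinuousMap.ext (congrFun this)
  · rw [dif_neg hc, dif_neg (this ▸ hc)]

theorem comb_mem {n : ℕ} {K : Set E} (hK : Convex ℝ K) {A : Fin n → E} (hA : ∀ i, A i ∈ K)
    (f : stdSimplex ℝ (Fin n)) : ∑ i, f i • A i ∈ K :=
  hK.sum_mem (fun i _ => stdSimplex.zero_le f i) (stdSimplex.sum_eq_one f) fun i _ => hA i

theorem seg_eq_mk {F : E → X} {A B : E}
    (h : Continuous fun f : stdSimplex ℝ (Fin 2) => F (f 0 • A + f 1 • B)) :
    seg F A B = mk ⟨_, h⟩ := by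
  unfold seg
  rw [dif_pos h]

variable [TopologicalSpace E] [ContinuousAdd E] [ContinuousSMul ℝ E] [TopologicalSpace E']
  [ContinuousAdd E'] [ContinuousSMul ℝ E']

theorem continuous_comb {n : ℕ} (A : Fin n → E) :
    Continuous fun f : stdSimplex ℝ (Fin n) => ∑ i, f i • A i := by
  refine continuous_finsetSum _ fun i _ => ?_
  exact ((continuous_apply i).comp continuous_subtype_val).smul continuous_const

theorem continuous_seg {F : E → X} {K : Set E} (hK : Convex ℝ K) (hF : ContinuousOn F K) {A B : E}
    (hA : A ∈ K) (hB : B ∈ K) :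
    Continuous fun f : stdSimplex ℝ (Fin 2) => F (f 0 • A + f 1 • B) := by
  have := hF.comp_continuous (continuous_comb ![A, B])
    (comb_mem hK (A := ![A, B]) (by simp [Fin.forall_fin_two, hA, hB]))
  simpa [Function.comp_def, Fin.sum_univ_two] using this

/-- `F` maps the triangle `A B C`, which lies in the convex set `K`, to a singular `2`-simplex whose
faces are the three paths. -/
theorem seg_add_seg {F : E → X} {K : Set E} (hK : Convex ℝ K) (hF : ContinuousOn F K) {A B C : E}
    (hA : A ∈ K) (hB : B ∈ K) (hC : C ∈ K) : seg F A B + seg F B C = seg F A C := by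
  rw [seg_eq_mk (continuous_seg hK hF hA hB), seg_eq_mk (continuous_seg hK hF hB hC),
    seg_eq_mk (continuous_seg hK hF hA hC), add_comm]
  let σ : C(stdSimplex ℝ (Fin 3), X) := ⟨fun f => F (∑ i, f i • ![A, B, C] i),
    hF.comp_continuous (continuous_comb ![A, B, C])
      (comb_mem hK (A := ![A, B, C]) (by simp [Fin.forall_fin_succ, hA, hB, hC]))⟩
  have key : ∀ i : Fin 3, ∀ f : stdSimplex ℝ (Fin 2), face i σ f =
      F (f 0 • ![A, B, C] (i.succAbove 0) + f 1 • ![A, B, C] (i.succAbove 1)) := by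
    intro i f
    change F (∑ j, (stdSimplex.map (SimplexCategory.δ (n := 1) i) f) j • ![A, B, C] j) = _
    congr 1
    have h : ∀ j, (stdSimplex.map (SimplexCategory.δ (n := 1) i) f) j =
        ∑ k with i.succAbove k = j, f k := by
      intro j
      have := congrFun (stdSimplex.map_coe (SimplexCategory.δ (n := 1) i) f) j
      refine this.trans ?_
      rw [FunOnFinite.linearMap_apply_apply]
      rfl
    simp only [h, Finset.sum_smul]
    rw [← Fin.sum_univ_two (f := fun k => f k • ![A, B, C] (i.succAbove k))]
    rw [← Finset.sum_fiberwise Finset.univ i.succAbove]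
    refine Finset.sum_congr rfl fun j _ => Finset.sum_congr rfl fun k hk => ?_
    rw [(Finset.mem_filter.1 hk).2]
  have e := mk_face σ
  convert e.symm using 2
  · congr 1; ext f; exact (key 0 f).symm
  · congr 1; ext f; exact (key 2 f).symm
  · congr 1; ext f; exact (key 1 f).symm

theorem seg_self {F : E → X} {K : Set E} (hK : Convex ℝ K) (hF : ContinuousOn F K) {A : E}
    (hA : A ∈ K) : seg F A A = 0 := by
  simpa using seg_add_seg hK hF hA hA hA

theorem seg_symm {F : E → X} {K : Set E} (hK : Convex ℝ K) (hF : ContinuousOn F K) {A B : E}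
    (hA : A ∈ K) (hB : B ∈ K) : seg F B A = - seg F A B := by
  rw [eq_neg_iff_add_eq_zero, seg_add_seg hK hF hB hA hB, seg_self hK hF hB]

theorem map_seg (f : C(X, Y)) {F : E → X} {K : Set E} (hK : Convex ℝ K) (hF : ContinuousOn F K)
    {A B : E} (hA : A ∈ K) (hB : B ∈ K) : map f (seg F A B) = seg (fun e => f (F e)) A B := by
  rw [seg_eq_mk (continuous_seg hK hF hA hB), map_mk, seg_eq_mk (F := fun e => f (F e))
    (f.continuous.comp (continuous_seg hK hF hA hB))]
  rfl

theorem ofH1_loopClass (γ : C(UnitAddCircle, X)) :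
    ofH1 X (loopClass γ) = seg (fun t : ℝ => γ (t : UnitAddCircle)) 0 1 := by
  have hc : Continuous fun t : ℝ => γ (t : UnitAddCircle) :=
    γ.continuous.comp (AddCircle.continuous_mk' 1)
  rw [loopClass, ofH1_map, ofH1_circleClass, map_mk,
    seg_eq_mk (continuous_seg convex_univ hc.continuousOn (Set.mem_univ _) (Set.mem_univ _))]
  congr 1
  ext f
  simp
  rfl

/-- By periodicity, the piece from `1` to `a + 1` repeats the piece from `0` to `a`. -/
theorem seg_add_one {c : ℝ → X} (hc : Continuous c) (hp : ∀ t, c (t + 1) = c t) (a : ℝ) :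
    seg c a (a + 1) = seg c 0 1 := by
  have h {x y z : ℝ} : seg c x y + seg c y z = seg c x z :=
    seg_add_seg convex_univ hc.continuousOn (Set.mem_univ _) (Set.mem_univ _) (Set.mem_univ _)
  have h1 : seg c 1 (a + 1) = seg c 0 a := by
    refine seg_congr fun t _ => ?_
    rw [← hp ((1 - t) • 0 + t • a)]
    congr 1
    simp only [smul_eq_mul]; ring
  have e1 := h (x := 0) (y := a) (z := a + 1)
  have e2 := h (x := 0) (y := 1) (z := a + 1)
  rw [h1, add_comm] at e2
  exact add_left_cancel (e1.trans e2.symm)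

theorem exists_ofH1_eq_seg_sub {F : E → X} {K : Set E} (hK : Convex ℝ K) (hF : ContinuousOn F K)
    {A B : E} (hA : A ∈ K) (hB : B ∈ K) {G : E' → X} {K' : Set E'} (hK' : Convex ℝ K')
    (hG : ContinuousOn G K') {A' B' : E'} (hA' : A' ∈ K') (hB' : B' ∈ K')
    (h0 : F A = G A') (h1 : F B = G B') : ∃ u, ofH1 X u = seg F A B - seg G A' B' := by
  rw [seg_eq_mk (continuous_seg hK hF hA hB), seg_eq_mk (continuous_seg hK' hG hA' hB')]
  apply exists_hom_of_closed
  · simpa using h0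
  · simpa using h1

/-! ### The degree of a map to the circle -/

/-- Contracting the simplex to a vertex makes `σ` the end of a homotopy that starts at a constant
map; this homotopy lifts to `ℝ`. -/
theorem exists_simplex_lift {n : ℕ} (σ : C(stdSimplex ℝ (Fin (n + 1)), UnitAddCircle)) :
    ∃ ψ : C(stdSimplex ℝ (Fin (n + 1)), ℝ), ∀ f, (ψ f : UnitAddCircle) = σ f := by
  let v : stdSimplex ℝ (Fin (n + 1)) := stdSimplex.vertex 0
  have hcv (t : unitInterval) (x : stdSimplex ℝ (Fin (n + 1))) :
      (1 - (t : ℝ)) • v.1 + (t : ℝ) • x.1 ∈ stdSimplex ℝ (Fin (n + 1)) :=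
    convex_stdSimplex ℝ _ v.2 x.2 (by linarith [t.2.2]) t.2.1 (by ring)
  let H : C(unitInterval × stdSimplex ℝ (Fin (n + 1)), UnitAddCircle) :=
    ⟨fun q => σ ⟨(1 - (q.1 : ℝ)) • v.1 + (q.1 : ℝ) • q.2.1, hcv q.1 q.2⟩, by fun_prop⟩
  obtain ⟨e, he⟩ := QuotientAddGroup.mk_surjective (σ v)
  have hcov : IsCoveringMap ((↑) : ℝ → UnitAddCircle) := AddCircle.isCoveringMap_coe 1
  have h0 : ∀ a, H (0, a) = ((ContinuousMap.const _ e : C(stdSimplex ℝ (Fin (n + 1)), ℝ)) a :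
      UnitAddCircle) := by
    intro a
    refine Eq.trans ?_ he.symm
    change σ _ = σ v
    congr 1
    ext1
    simp
  refine ⟨(hcov.liftHomotopy H (ContinuousMap.const _ e) h0).comp ⟨fun x => (1, x), by fun_prop⟩,
    fun f => ?_⟩
  refine (congrFun (hcov.liftHomotopy_lifts H (ContinuousMap.const _ e) h0) (1, f)).trans ?_
  change σ _ = σ f
  congr 1
  ext1
  simp

/-- Two lifts of a simplex to `ℝ` differ by a constant, so the variation of a lift depends only on
the simplex. It is a cocycle because a lift of a `2`-simplex restricts to lifts of its faces. -/
theorem exists_deg (F : C(X, UnitAddCircle)) : ∃ f : PathMod X →ₗ[ℝ] ℝ,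
    ∀ (σ : C(stdSimplex ℝ (Fin 2), X)) (ψ : C(stdSimplex ℝ (Fin 2), ℝ)),
      (∀ x, (ψ x : UnitAddCircle) = F (σ x)) →
      f (mk σ) = ψ (stdSimplex.vertex 1) - ψ (stdSimplex.vertex 0) := by
  choose L hL using fun σ : C(stdSimplex ℝ (Fin 2), X) => exists_simplex_lift (F.comp σ)
  have huniq (σ : C(stdSimplex ℝ (Fin 2), X)) (ψ : C(stdSimplex ℝ (Fin 2), ℝ))
      (h : ∀ x, (ψ x : UnitAddCircle) = F (σ x)) :
      L σ (stdSimplex.vertex 1) - L σ (stdSimplex.vertex 0) =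
        ψ (stdSimplex.vertex 1) - ψ (stdSimplex.vertex 0) := by
    have hcov : IsCoveringMap ((↑) : ℝ → UnitAddCircle) := AddCircle.isCoveringMap_coe 1
    have h0 : ((ψ (stdSimplex.vertex 0) - L σ (stdSimplex.vertex 0) : ℝ) : UnitAddCircle) = 0 := by
      rw [AddCircle.coe_sub, h, hL]; simp
    have := hcov.eq_of_comp_eq (g₁ := ψ)
      (g₂ := fun x => L σ x + (ψ (stdSimplex.vertex 0) - L σ (stdSimplex.vertex 0)))
      ψ.continuous (by fun_prop)
      (by funext x; simp only [Function.comp_apply, AddCircle.coe_add, h0, h, hL]; simp)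
      (stdSimplex.vertex 0) (by simp)
    have h1 := congrFun this (stdSimplex.vertex 1)
    linarith
  obtain ⟨f, hf⟩ := exists_functional
    (fun σ => L σ (stdSimplex.vertex 1) - L σ (stdSimplex.vertex 0)) (fun σ => by
      obtain ⟨ψ, hψ⟩ := exists_simplex_lift (F.comp σ)
      have hv (i : Fin 3) (j : Fin 2) : face i ψ (stdSimplex.vertex j) =
          ψ (stdSimplex.vertex (i.succAbove j)) :=
        congrArg ψ (stdSimplex.map_vertex _ _)
      rw [huniq (face 0 σ) (face 0 ψ) (fun x => hψ _), huniq (face 1 σ) (face 1 ψ) (fun x => hψ _),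
        huniq (face 2 σ) (face 2 ψ) (fun x => hψ _), hv, hv, hv, hv, hv, hv]
      simp [Fin.succAbove])
  exact ⟨f, fun σ ψ h => (hf σ).trans (huniq σ ψ h)⟩

/-- The functional on chains modulo boundaries which maps a path to the variation along it of the
multivalued real function defined by `F`. -/
def deg (F : C(X, UnitAddCircle)) : PathMod X →ₗ[ℝ] ℝ := (exists_deg F).choose

theorem deg_seg (F : C(X, UnitAddCircle)) {G : E → X} {A B : E} {K : Set E} (hK : Convex ℝ K)
    (hG : ContinuousOn G K) (hA : A ∈ K) (hB : B ∈ K) {φ : E → ℝ} (hφ : ContinuousOn φ K)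
    (h : ∀ e ∈ K, (φ e : UnitAddCircle) = F (G e)) : deg F (seg G A B) = φ B - φ A := by
  have hm (x : stdSimplex ℝ (Fin 2)) : x 0 • A + x 1 • B ∈ K := by
    simpa [Fin.sum_univ_two] using
      comb_mem hK (A := ![A, B]) (by simp [Fin.forall_fin_two, hA, hB]) x
  rw [seg_eq_mk (continuous_seg hK hG hA hB), deg, (exists_deg F).choose_spec _
    ⟨_, continuous_seg hK hφ hA hB⟩ (fun x => h _ (hm x))]
  simp

theorem functional_ext {f g : PathMod X →ₗ[ℝ] ℝ} (h : ∀ σ, f (mk σ) = g (mk σ)) : f = g := by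
  have : ModuleCat.ofHom f = ModuleCat.ofHom g := by
    rw [← cancel_epi ((singChains X).pOpcycles 1)]
    refine SSet.chainComplex_hom_ext fun x => ?_
    ext
    obtain ⟨σ, rfl⟩ : ∃ σ, simplex 1 σ = x :=
      ⟨TopCat.toSSetObjEquiv (TopCat.of X) (Opposite.op (SimplexCategory.mk 1)) x,
        Equiv.symm_apply_apply _ _⟩
    exact h σ
  exact congrArg ModuleCat.Hom.hom this

theorem deg_map (F : C(Y, UnitAddCircle)) (f : C(X, Y)) (u : PathMod X) :
    deg F (map f u) = deg (F.comp f) u := by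
  have : deg F ∘ₗ map f = deg (F.comp f) := by
    refine functional_ext fun σ => ?_
    obtain ⟨ψ, hψ⟩ := exists_simplex_lift ((F.comp f).comp σ)
    rw [LinearMap.comp_apply, map_mk]
    exact ((exists_deg F).choose_spec (f.comp σ) ψ hψ).trans
      ((exists_deg (F.comp f)).choose_spec σ ψ hψ).symm
  exact congrArg (fun k => k u) this

end PathMod

/-! ### The covering of the torus -/

/-- The pair of the projection and the index of the sheet is a continuous bijection onto `U × S`. It
is proper because `X` is compact, hence it is a homeomorphism; no local inverse has to be written
down. -/
theorem IsEvenlyCovered.of_sheets {X B S : Type} [TopologicalSpace X] [TopologicalSpace B]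
    [CompactSpace X] [T2Space B] [TopologicalSpace S] [DiscreteTopology S] {p : X → B}
    (hp : Continuous p) {U : Set B} (hU : IsOpen U) {Λ : S → Set X} (hΛ : ∀ s, IsOpen (Λ s))
    (hsub : ∀ x, p x ∈ U → ∃ s, x ∈ Λ s)
    (hdisj : ∀ x s s', x ∈ Λ s → x ∈ Λ s' → s = s') (hinj : ∀ s, Set.InjOn p (Λ s))
    (hsurj : ∀ b ∈ U, ∀ s, ∃ x ∈ Λ s, p x = b) {b : B} (hb : b ∈ U) :
    IsEvenlyCovered p b S := by
  choose l hl using hsub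
  have hl' : ∀ x (hx : p x ∈ U) s, x ∈ Λ s ↔ l x hx = s := fun x hx s =>
    ⟨fun h => hdisj x _ _ (hl x hx) h, fun h => h ▸ hl x hx⟩
  let H : p ⁻¹' U → U × S := fun x => (⟨p x, x.2⟩, l x x.2)
  have hHc : Continuous H := by
    refine Continuous.prodMk (by fun_prop) ?_
    refine continuous_discrete_rng.2 fun s => ?_
    have : (fun x : p ⁻¹' U => l x x.2) ⁻¹' {s} = Subtype.val ⁻¹' Λ s := by
      ext x
      exact (hl' x x.2 s).symm
    rw [this]
    exact (hΛ s).preimage continuous_subtype_val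
  have hHb : Function.Bijective H := by
    constructor
    · intro x y hxy
      have h1 : p x = p y := congrArg (fun q => (q.1 : B)) hxy
      have h2 : l x x.2 = l y y.2 := congrArg Prod.snd hxy
      exact Subtype.ext (hinj (l x x.2) (hl x x.2) (h2 ▸ hl y y.2) h1)
    · rintro ⟨⟨b, hb⟩, s⟩
      obtain ⟨x, hx, rfl⟩ := hsurj b hb s
      exact ⟨⟨x, hb⟩, Prod.ext rfl ((hl' x hb s).1 hx)⟩
  have hprop : IsProperMap (Prod.fst ∘ H) := hp.isProperMap.restrictPreimage U
  have hHp : IsProperMap H := isProperMap_of_comp_of_t2 hHc continuous_fst hprop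
  have hHh : IsHomeomorph H :=
    isHomeomorph_iff_continuous_isClosedMap_bijective.2 ⟨hHc, hHp.isClosedMap, hHb⟩
  exact ⟨inferInstance, U, hb, hU, hU.preimage hp, hHh.homeomorph, fun x => rfl⟩

namespace SquareTiled

variable {S : Type} {h v : Equiv.Perm S}

/-- The point with coordinates `q` of the square `s`. -/
def pt (s : S) (q : unitInterval × unitInterval) : SquareTiled h v := Quot.mk _ ⟨s, q⟩

theorem exists_pt (x : SquareTiled h v) : ∃ s q, pt s q = x := by
  rcases x with ⟨s, q⟩
  exact ⟨s, q, rfl⟩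

theorem pt_right (s : S) (y : unitInterval) :
    (pt s (1, y) : SquareTiled h v) = pt (h s) (0, y) := Quot.sound (SquareGluing.right s y)

theorem pt_top (s : S) (x : unitInterval) :
    (pt s (x, 1) : SquareTiled h v) = pt (v s) (x, 0) := Quot.sound (SquareGluing.top s x)

theorem proj_pt (s : S) (q : unitInterval × unitInterval) :
    proj (pt s q : SquareTiled h v) = (((q.1 : ℝ) : UnitAddCircle), ((q.2 : ℝ) : UnitAddCircle)) :=
  rfl

theorem continuous_pt (s : S) : Continuous (pt s : _ → SquareTiled h v) :=
  continuous_quot_mk.comp (continuous_sigmaMk (σ := fun _ : S => unitInterval × unitInterval))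

theorem isOpen_iff {U : Set (SquareTiled h v)} : IsOpen U ↔ ∀ s, IsOpen (pt s ⁻¹' U) := by
  refine Iff.trans (isQuotientMap_quot_mk (r := SquareGluing h v)).isOpen_preimage.symm ?_
  exact isOpen_sigma_iff

instance [Finite S] : CompactSpace (SquareTiled h v) :=
  inferInstanceAs (CompactSpace (Quot (SquareGluing h v)))

theorem coe_eq_coe {x y : unitInterval} :
    ((x : ℝ) : UnitAddCircle) = ((y : ℝ) : UnitAddCircle) ↔
      x = y ∨ (x = 0 ∧ y = 1) ∨ (x = 1 ∧ y = 0) := by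
  constructor
  · intro hxy
    have hx := x.2
    have hy := y.2
    by_cases h1 : (x : ℝ) - y = 1
    · refine Or.inr (Or.inr ⟨Subtype.ext ?_, Subtype.ext ?_⟩) <;> push_cast <;> linarith [hx.2, hy.1]
    by_cases h2 : (x : ℝ) - y = -1
    · refine Or.inr (Or.inl ⟨Subtype.ext ?_, Subtype.ext ?_⟩) <;> push_cast <;> linarith [hx.1, hy.2]
    refine Or.inl (Subtype.ext (sub_eq_zero.1 (coe_small ?_ ?_)))
    · rw [abs_lt]
      constructor
      · exact lt_of_le_of_ne (by linarith [hx.1, hy.2]) (Ne.symm h2)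
      · exact lt_of_le_of_ne (by linarith [hx.2, hy.1]) h1
    · rw [AddCircle.coe_sub, hxy, sub_self]
  · have h1 : ((1 : ℝ) : UnitAddCircle) = 0 := AddCircle.coe_period 1
    rintro (rfl | ⟨rfl, rfl⟩ | ⟨rfl, rfl⟩) <;> simp [h1]

theorem coe_eq_zero {x : unitInterval} :
    ((x : ℝ) : UnitAddCircle) = 0 ↔ x = 0 ∨ x = 1 := by
  have := coe_eq_coe (x := x) (y := 0)
  simpa using this

theorem exists_coe (a : UnitAddCircle) : ∃ x : unitInterval, ((x : ℝ) : UnitAddCircle) = a := by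
  obtain ⟨t, rfl⟩ := QuotientAddGroup.mk_surjective a
  refine ⟨⟨Int.fract t, Int.fract_nonneg t, (Int.fract_lt_one t).le⟩, ?_⟩
  change ((Int.fract t : ℝ) : UnitAddCircle) = (t : UnitAddCircle)
  rw [← sub_eq_zero, ← AddCircle.coe_sub, AddCircle.coe_eq_zero_iff]
  exact ⟨-⌊t⌋, by rw [Int.fract]; simp⟩

/-- A sheet over the points whose coordinates do not vanish. -/
def sheet (h v : Equiv.Perm S) (s : S) : Set (SquareTiled h v) :=
  {x | Quot.lift (fun p : Σ _ : S, unitInterval × unitInterval =>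
    (p.2.1 ≠ 0 ∧ p.2.1 ≠ 1) ∧ (p.2.2 ≠ 0 ∧ p.2.2 ≠ 1) ∧ p.1 = s)
    (by rintro _ _ (⟨s, y⟩ | ⟨s, x⟩) <;> simp) x}

/-- The middle of the unit interval. -/
def half : unitInterval := ⟨1 / 2, by norm_num, by norm_num⟩

theorem half_pos : (0 : unitInterval) < half := Subtype.coe_lt_coe.1 (by norm_num [half])
theorem half_lt_one : half < (1 : unitInterval) := Subtype.coe_lt_coe.1 (by norm_num [half])

/-- A sheet around the left side of `s`. -/
def sheetH (h v : Equiv.Perm S) (s : S) : Set (SquareTiled h v) :=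
  {x | Quot.lift (fun p : Σ _ : S, unitInterval × unitInterval =>
    (p.2.2 ≠ 0 ∧ p.2.2 ≠ 1) ∧ ((p.2.1 < half ∧ p.1 = s) ∨ (half < p.2.1 ∧ h p.1 = s)))
    (by rintro _ _ (⟨s, y⟩ | ⟨s, x⟩) <;> simp [half_pos, half_lt_one, not_lt_of_gt]) x}

/-- A sheet around the bottom side of `s`. -/
def sheetV (h v : Equiv.Perm S) (s : S) : Set (SquareTiled h v) :=
  {x | Quot.lift (fun p : Σ _ : S, unitInterval × unitInterval =>
    (p.2.1 ≠ 0 ∧ p.2.1 ≠ 1) ∧ ((p.2.2 < half ∧ p.1 = s) ∨ (half < p.2.2 ∧ v p.1 = s)))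
    (by rintro _ _ (⟨s, y⟩ | ⟨s, x⟩) <;> simp [half_pos, half_lt_one, not_lt_of_gt]) x}

theorem pt_mem_sheet {s s' : S} {q : unitInterval × unitInterval} : pt s' q ∈ sheet h v s ↔
    (q.1 ≠ 0 ∧ q.1 ≠ 1) ∧ (q.2 ≠ 0 ∧ q.2 ≠ 1) ∧ s' = s := Iff.rfl

theorem pt_mem_sheetH {s s' : S} {q : unitInterval × unitInterval} : pt s' q ∈ sheetH h v s ↔
    (q.2 ≠ 0 ∧ q.2 ≠ 1) ∧ ((q.1 < half ∧ s' = s) ∨ (half < q.1 ∧ h s' = s)) := Iff.rfl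

theorem pt_mem_sheetV {s s' : S} {q : unitInterval × unitInterval} : pt s' q ∈ sheetV h v s ↔
    (q.1 ≠ 0 ∧ q.1 ≠ 1) ∧ ((q.2 < half ∧ s' = s) ∨ (half < q.2 ∧ v s' = s)) := Iff.rfl

theorem isOpen_sheet (s : S) : IsOpen (sheet h v s) := by
  refine isOpen_iff.2 fun s' => ?_
  have : pt s' ⁻¹' sheet h v s = {q | q.1 ≠ 0 ∧ q.1 ≠ 1} ∩ {q | q.2 ≠ 0 ∧ q.2 ≠ 1} ∩ {_q | s' = s} := by
    ext q; simp [pt_mem_sheet, and_assoc]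
  rw [this]
  refine ((IsOpen.inter ?_ ?_).inter (IsOpen.inter ?_ ?_)).inter isOpen_const
  all_goals exact isOpen_ne_fun (by fun_prop) (by fun_prop)

theorem isOpen_sheetH (s : S) : IsOpen (sheetH h v s) := by
  refine isOpen_iff.2 fun s' => ?_
  have : pt s' ⁻¹' sheetH h v s = {q | q.2 ≠ 0 ∧ q.2 ≠ 1} ∩
      (({q | q.1 < half} ∩ {_q | s' = s}) ∪ ({q | half < q.1} ∩ {_q | h s' = s})) := by
    ext q; simp [pt_mem_sheetH, and_assoc]
  rw [this]
  refine IsOpen.inter (IsOpen.inter ?_ ?_) (((isOpen_lt ?_ ?_).inter isOpen_const).union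
    ((isOpen_lt ?_ ?_).inter isOpen_const))
  any_goals exact isOpen_ne_fun (by fun_prop) (by fun_prop)
  all_goals fun_prop

theorem isOpen_sheetV (s : S) : IsOpen (sheetV h v s) := by
  refine isOpen_iff.2 fun s' => ?_
  have : pt s' ⁻¹' sheetV h v s = {q | q.1 ≠ 0 ∧ q.1 ≠ 1} ∩
      (({q | q.2 < half} ∩ {_q | s' = s}) ∪ ({q | half < q.2} ∩ {_q | v s' = s})) := by
    ext q; simp [pt_mem_sheetV, and_assoc]
  rw [this]
  refine IsOpen.inter (IsOpen.inter ?_ ?_) (((isOpen_lt ?_ ?_).inter isOpen_const).union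
    ((isOpen_lt ?_ ?_).inter isOpen_const))
  any_goals exact isOpen_ne_fun (by fun_prop) (by fun_prop)
  all_goals fun_prop

theorem isEvenlyCovered_interior [Finite S] [TopologicalSpace S] [DiscreteTopology S]
    {b : FlatTorus} (h1 : b.1 ≠ 0) (h2 : b.2 ≠ 0) :
    IsEvenlyCovered (proj : SquareTiled h v → FlatTorus) b S := by
  have hU : IsOpen {b : FlatTorus | b.1 ≠ 0 ∧ b.2 ≠ 0} :=
    (isOpen_ne_fun continuous_fst continuous_const).inter
      (isOpen_ne_fun continuous_snd continuous_const)
  refine IsEvenlyCovered.of_sheets continuous_proj hU isOpen_sheet ?_ ?_ ?_ ?_ ⟨h1, h2⟩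
  · intro x hx
    obtain ⟨s, q, rfl⟩ := exists_pt x
    refine ⟨s, ?_⟩
    simp only [proj_pt, Set.mem_ofPred_eq, ne_eq, coe_eq_zero, not_or] at hx
    exact pt_mem_sheet.2 ⟨hx.1, hx.2, rfl⟩
  · intro x s s' hx hx'
    obtain ⟨t, q, rfl⟩ := exists_pt x
    exact (pt_mem_sheet.1 hx).2.2.symm.trans (pt_mem_sheet.1 hx').2.2
  · intro s x hx x' hx' he
    obtain ⟨t, q, rfl⟩ := exists_pt x
    obtain ⟨t', q', rfl⟩ := exists_pt x'
    rw [pt_mem_sheet] at hx hx'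
    rw [proj_pt, proj_pt, Prod.mk.injEq, coe_eq_coe, coe_eq_coe] at he
    grind
  · rintro ⟨a, b⟩ ⟨ha, hb⟩ s
    obtain ⟨x, rfl⟩ := exists_coe a
    obtain ⟨y, rfl⟩ := exists_coe b
    simp only [ne_eq, coe_eq_zero, not_or] at ha hb
    exact ⟨pt s (x, y), pt_mem_sheet.2 ⟨ha, hb, rfl⟩, rfl⟩

theorem isEvenlyCovered_left [Finite S] [TopologicalSpace S] [DiscreteTopology S]
    {b : FlatTorus} (h1 : b.1 = 0) (h2 : b.2 ≠ 0) :
    IsEvenlyCovered (proj : SquareTiled h v → FlatTorus) b S := by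
  -- A sheet consists of the left half of a square and the right half of its left neighbour.
  -- Removing the abscissa `1/2` separates these sheets.
  have hU : IsOpen {b : FlatTorus | b.1 ≠ ((half : ℝ) : UnitAddCircle) ∧ b.2 ≠ 0} :=
    (isOpen_ne_fun continuous_fst continuous_const).inter
      (isOpen_ne_fun continuous_snd continuous_const)
  have hh0 := half_pos.ne
  have hh1 := half_lt_one.ne
  refine IsEvenlyCovered.of_sheets continuous_proj hU isOpen_sheetH ?_ ?_ ?_ ?_ ⟨?_, h2⟩
  · intro x hx
    obtain ⟨s, q, rfl⟩ := exists_pt x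
    simp only [proj_pt, Set.mem_ofPred_eq, ne_eq, coe_eq_zero, coe_eq_coe, not_or] at hx
    rcases lt_or_gt_of_ne hx.1.1 with h | h
    · exact ⟨s, pt_mem_sheetH.2 ⟨hx.2, Or.inl ⟨h, rfl⟩⟩⟩
    · exact ⟨_, pt_mem_sheetH.2 ⟨hx.2, Or.inr ⟨h, rfl⟩⟩⟩
  · intro x s s' hx hx'
    obtain ⟨t, q, rfl⟩ := exists_pt x
    rw [pt_mem_sheetH] at hx hx'
    grind
  · intro s x hx x' hx' he
    obtain ⟨t, q, rfl⟩ := exists_pt x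
    obtain ⟨t', q', rfl⟩ := exists_pt x'
    rw [pt_mem_sheetH] at hx hx'
    rw [proj_pt, proj_pt, Prod.mk.injEq, coe_eq_coe, coe_eq_coe] at he
    obtain ⟨a, y⟩ := q
    obtain ⟨a', y'⟩ := q'
    have hy : y = y' := by grind
    subst hy
    simp only at he hx hx'
    rcases he.1 with rfl | ⟨rfl, rfl⟩ | ⟨rfl, rfl⟩
    · have : t = t' := by
        rcases hx.2 with hx | hx <;> rcases hx'.2 with hx' | hx'
        · exact hx.2.trans hx'.2.symm
        · exact absurd hx.1 (not_lt_of_gt hx'.1)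
        · exact absurd hx.1 (not_lt_of_gt hx'.1)
        · exact h.injective (hx.2.trans hx'.2.symm)
      rw [this]
    · have e1 : t = s := by simpa [half_pos, not_lt_of_gt half_pos] using hx.2
      have e2 : h t' = s := by simpa [half_lt_one, not_lt_of_gt half_lt_one] using hx'.2
      rw [pt_right, e1, e2]
    · have e1 : t' = s := by simpa [half_pos, not_lt_of_gt half_pos] using hx'.2
      have e2 : h t = s := by simpa [half_lt_one, not_lt_of_gt half_lt_one] using hx.2
      rw [pt_right, e1, e2]
  · rintro ⟨a, b⟩ ⟨ha, hb⟩ s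
    obtain ⟨x, rfl⟩ := exists_coe a
    obtain ⟨y, rfl⟩ := exists_coe b
    simp only [ne_eq, coe_eq_zero, coe_eq_coe, not_or] at ha hb
    rcases lt_or_gt_of_ne ha.1 with hx | hx
    · exact ⟨pt s (x, y), pt_mem_sheetH.2 ⟨hb, Or.inl ⟨hx, rfl⟩⟩, rfl⟩
    · exact ⟨pt (h.symm s) (x, y), pt_mem_sheetH.2 ⟨hb, Or.inr ⟨hx, by simp⟩⟩, rfl⟩
  · rw [h1, ne_comm, ne_eq, coe_eq_zero]
    tauto

theorem isEvenlyCovered_bottom [Finite S] [TopologicalSpace S] [DiscreteTopology S]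
    {b : FlatTorus} (h1 : b.1 ≠ 0) (h2 : b.2 = 0) :
    IsEvenlyCovered (proj : SquareTiled h v → FlatTorus) b S := by
  have hU : IsOpen {b : FlatTorus | b.1 ≠ 0 ∧ b.2 ≠ ((half : ℝ) : UnitAddCircle)} :=
    (isOpen_ne_fun continuous_fst continuous_const).inter
      (isOpen_ne_fun continuous_snd continuous_const)
  have hh0 := half_pos.ne
  have hh1 := half_lt_one.ne
  refine IsEvenlyCovered.of_sheets continuous_proj hU isOpen_sheetV ?_ ?_ ?_ ?_ ⟨h1, ?_⟩
  · intro x hx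
    obtain ⟨s, q, rfl⟩ := exists_pt x
    simp only [proj_pt, Set.mem_ofPred_eq, ne_eq, coe_eq_zero, coe_eq_coe, not_or] at hx
    rcases lt_or_gt_of_ne hx.2.1 with h | h
    · exact ⟨s, pt_mem_sheetV.2 ⟨hx.1, Or.inl ⟨h, rfl⟩⟩⟩
    · exact ⟨_, pt_mem_sheetV.2 ⟨hx.1, Or.inr ⟨h, rfl⟩⟩⟩
  · intro x s s' hx hx'
    obtain ⟨t, q, rfl⟩ := exists_pt x
    rw [pt_mem_sheetV] at hx hx'
    grind
  · intro s x hx x' hx' he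
    obtain ⟨t, q, rfl⟩ := exists_pt x
    obtain ⟨t', q', rfl⟩ := exists_pt x'
    rw [pt_mem_sheetV] at hx hx'
    rw [proj_pt, proj_pt, Prod.mk.injEq, coe_eq_coe, coe_eq_coe] at he
    obtain ⟨y, a⟩ := q
    obtain ⟨y', a'⟩ := q'
    have hy : y = y' := by grind
    subst hy
    simp only at he hx hx'
    rcases he.2 with rfl | ⟨rfl, rfl⟩ | ⟨rfl, rfl⟩
    · have : t = t' := by
        rcases hx.2 with hx | hx <;> rcases hx'.2 with hx' | hx'
        · exact hx.2.trans hx'.2.symm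
        · exact absurd hx.1 (not_lt_of_gt hx'.1)
        · exact absurd hx.1 (not_lt_of_gt hx'.1)
        · exact v.injective (hx.2.trans hx'.2.symm)
      rw [this]
    · have e1 : t = s := by simpa [half_pos, not_lt_of_gt half_pos] using hx.2
      have e2 : v t' = s := by simpa [half_lt_one, not_lt_of_gt half_lt_one] using hx'.2
      rw [pt_top, e1, e2]
    · have e1 : t' = s := by simpa [half_pos, not_lt_of_gt half_pos] using hx'.2
      have e2 : v t = s := by simpa [half_lt_one, not_lt_of_gt half_lt_one] using hx.2
      rw [pt_top, e1, e2]
  · rintro ⟨a, b⟩ ⟨ha, hb⟩ s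
    obtain ⟨x, rfl⟩ := exists_coe a
    obtain ⟨y, rfl⟩ := exists_coe b
    simp only [ne_eq, coe_eq_zero, coe_eq_coe, not_or] at ha hb
    rcases lt_or_gt_of_ne hb.1 with hx | hx
    · exact ⟨pt s (x, y), pt_mem_sheetV.2 ⟨ha, Or.inl ⟨hx, rfl⟩⟩, rfl⟩
    · exact ⟨pt (v.symm s) (x, y), pt_mem_sheetV.2 ⟨ha, Or.inr ⟨hx, by simp⟩⟩, rfl⟩
  · rw [h2, ne_comm, ne_eq, coe_eq_zero]
    tauto

theorem isCoveringMapOn_proj [Finite S] :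
    IsCoveringMapOn (proj : SquareTiled h v → FlatTorus) {0}ᶜ := by
  let _ : TopologicalSpace S := ⊥
  have : DiscreteTopology S := ⟨rfl⟩
  intro b hb
  have hb' : b ≠ 0 := hb
  apply IsEvenlyCovered.to_isEvenlyCovered_preimage (I := S)
  by_cases h1 : b.1 = 0
  · exact isEvenlyCovered_left h1 fun h2 => hb' (Prod.ext h1 h2)
  · by_cases h2 : b.2 = 0
    · exact isEvenlyCovered_bottom h1 h2
    · exact isEvenlyCovered_interior h1 h2

end SquareTiled

/-! ### Lifting to coverings of the torus branched over the origin -/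

theorem continuous_toTorus : Continuous toTorus :=
  ((AddCircle.continuous_mk' 1).comp continuous_fst).prodMk
    ((AddCircle.continuous_mk' 1).comp continuous_snd)

theorem toTorus_add (u w : ℝ × ℝ) : toTorus (u + w) = toTorus u + toTorus w := rfl

theorem toTorus_surjective (b : FlatTorus) : ∃ u, toTorus u = b := by
  obtain ⟨x, hx⟩ := QuotientAddGroup.mk_surjective b.1
  obtain ⟨y, hy⟩ := QuotientAddGroup.mk_surjective b.2
  exact ⟨(x, y), Prod.ext hx hy⟩

theorem coe_eq_zero_iff_int {t : ℝ} : (t : UnitAddCircle) = 0 ↔ ∃ m : ℤ, t = m := by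
  rw [AddCircle.coe_eq_zero_iff]
  exact exists_congr fun m => by rw [zsmul_one, eq_comm]

theorem coe_eq_coe_iff_int {t t' : ℝ} :
    (t : UnitAddCircle) = (t' : UnitAddCircle) ↔ ∃ m : ℤ, t - t' = m := by
  rw [← sub_eq_zero, ← AddCircle.coe_sub, coe_eq_zero_iff_int]

theorem coe_ne_zero_of_mem_Ioo {t : ℝ} (ht : t ∈ Set.Ioo (0 : ℝ) 1) : (t : UnitAddCircle) ≠ 0 := by
  intro h
  have := SquareTiled.coe_small (abs_lt.2 ⟨by linarith [ht.1], ht.2⟩) h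
  exact ht.1.ne' this

theorem coe_eq_coe_of_mem_Ioo {t t' : ℝ} (ht : t ∈ Set.Ioo (0 : ℝ) 1) (ht' : t' ∈ Set.Ioo (0 : ℝ) 1)
    (h : (t : UnitAddCircle) = (t' : UnitAddCircle)) : t = t' := by
  refine sub_eq_zero.1 (SquareTiled.coe_small ?_ ?_)
  · rw [abs_lt]; constructor <;> linarith [ht.1, ht.2, ht'.1, ht'.2]
  · rw [AddCircle.coe_sub, h, sub_self]

theorem exists_coe_mem_Ioo {a : UnitAddCircle} (ha : a ≠ 0) :
    ∃ t ∈ Set.Ioo (0 : ℝ) 1, (t : UnitAddCircle) = a := by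
  obtain ⟨t, rfl⟩ := SquareTiled.exists_coe a
  rw [ne_eq, SquareTiled.coe_eq_zero, not_or] at ha
  exact ⟨t, ⟨unitInterval.pos_iff_ne_zero.2 ha.1, unitInterval.lt_one_iff_ne_one.2 ha.2⟩, rfl⟩

theorem isLocalHomeomorph_toTorus : IsLocalHomeomorph toTorus := by
  have h := AddCircle.isLocalHomeomorph_coe (1 : ℝ)
  refine IsLocalHomeomorph.mk _ fun u => ?_
  obtain ⟨e, he, he'⟩ := h u.1
  obtain ⟨e', h2, h2'⟩ := h u.2
  refine ⟨e.prod e', ⟨he, h2⟩, fun w _ => ?_⟩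
  change ((w.1 : UnitAddCircle), (w.2 : UnitAddCircle)) = (e w.1, e' w.2)
  rw [← he', ← h2']

namespace TorusCover

variable {X : Type} [TopologicalSpace X] {p : X → FlatTorus}
variable {E : Type} [NormedAddCommGroup E] [NormedSpace ℝ E]

/-- A convex open set is contractible and locally path connected, so the lifting criterion applies
to it. Outside `K` the lift is given the arbitrary value `x`. -/
theorem exists_lift (hp : IsCoveringMapOn p {0}ᶜ) {K : Set E} (hK : Convex ℝ K) (hKo : IsOpen K)
    {f : E → FlatTorus} (hf : ContinuousOn f K) (hf0 : ∀ e ∈ K, f e ≠ 0) {a : E} (ha : a ∈ K)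
    {x : X} (hx : p x = f a) :
    ∃ F : E → X, ContinuousOn F K ∧ F a = x ∧ ∀ e ∈ K, p (F e) = f e := by
  classical
  have := hK.contractibleSpace ⟨a, ha⟩
  have := hKo.locallyPathConnectedSpace
  obtain ⟨F, ⟨hFa, hF⟩, -⟩ := hp.existsUnique_continuousMap_lifts (A := K)
    ⟨K.domRestrict f, hf.domRestrict⟩ (a₀ := ⟨a, ha⟩) (e₀ := x) hx (fun e => hf0 e e.2)
  refine ⟨fun e => if he : e ∈ K then F ⟨e, he⟩ else x, ?_, ?_, ?_⟩
  · rw [continuousOn_iff_continuous_domRestrict]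
    convert F.continuous using 1
    funext e
    simp
  · simpa [ha] using hFa
  · intro e he
    simp only [dif_pos he]
    exact congrFun hF ⟨e, he⟩

theorem eqOn_of_lift (hp : IsCoveringMapOn p {0}ᶜ) {A : Type} [TopologicalSpace A] {K : Set A}
    (hK : IsPreconnected K)
    {F G : A → X} (hF : ContinuousOn F K) (hG : ContinuousOn G K)
    (hFG : ∀ e ∈ K, p (F e) = p (G e)) (h0 : ∀ e ∈ K, p (F e) ≠ 0) {a : A} (ha : a ∈ K)
    (haF : F a = G a) : Set.EqOn F G K := by
  have hcov := hp.isCoveringMap_restrictPreimage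
  have := isPreconnected_iff_preconnectedSpace.1 hK
  let F' : K → p ⁻¹' {0}ᶜ := fun e => ⟨F e, h0 e e.2⟩
  let G' : K → p ⁻¹' {0}ᶜ := fun e => ⟨G e, fun h => h0 e e.2 ((hFG e e.2).trans h)⟩
  have h := hcov.eq_of_comp_eq (g₁ := F') (g₂ := G') (hF.domRestrict.subtype_mk _)
    (hG.domRestrict.subtype_mk _) (by funext e; exact Subtype.ext (hFG e e.2)) ⟨a, ha⟩
    (Subtype.ext haF)
  intro e he
  exact congrArg Subtype.val (congrFun h ⟨e, he⟩)

theorem exists_injOn (hp : IsCoveringMapOn p {0}ᶜ) {x : X} (hx : p x ≠ 0) :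
    ∃ U ∈ 𝓝 x, Set.InjOn p U := by
  obtain ⟨e, he, hpe⟩ := hp.isLocalHomeomorphOn x hx
  exact ⟨e.source, e.open_source.mem_nhds he, hpe ▸ e.injOn⟩

/-- `p ∘ F` and `p` are local homeomorphisms, so `F` is one too, and it is open. -/
theorem isOpen_image (hp : IsCoveringMapOn p {0}ᶜ) {K : Set (ℝ × ℝ)} (hKo : IsOpen K)
    {F : ℝ × ℝ → X} (hF : ContinuousOn F K) (hpF : ∀ e ∈ K, p (F e) = toTorus e)
    (h0 : ∀ e ∈ K, toTorus e ≠ 0) : IsOpen (F '' K) := by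
  have h1 : IsLocalHomeomorphOn (p ∘ F) K := by
    refine IsLocalHomeomorphOn.mk _ _ fun a ha => ?_
    obtain ⟨e, he, hpe⟩ := isLocalHomeomorph_toTorus a
    refine ⟨e.restrOpen K hKo, ⟨he, ha⟩, fun w hw => ?_⟩
    change p (F w) = e w
    rw [hpF w hw.2, hpe]
  have h2 : IsLocalHomeomorphOn F K := h1.of_comp_left
    (hp.isLocalHomeomorphOn.mono (by rintro _ ⟨e, he, rfl⟩; simpa [hpF e he] using h0 e he))
    (fun e he => hF.continuousAt (hKo.mem_nhds he))
  rw [isOpen_iff_mem_nhds]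
  rintro _ ⟨a, ha, rfl⟩
  rw [← h2.map_nhds_eq ha]
  exact image_mem_map (hKo.mem_nhds ha)

/-- The strip `ℝ × (0, 1)`. -/
def strip : Set (ℝ × ℝ) := {e | e.2 ∈ Set.Ioo (0 : ℝ) 1}

theorem isOpen_strip : IsOpen strip := isOpen_Ioo.preimage continuous_snd

theorem convex_strip : Convex ℝ strip :=
  (convex_Ioo (0 : ℝ) 1).linear_preimage (LinearMap.snd ℝ ℝ ℝ)

theorem toTorus_ne_zero_of_mem_strip {e : ℝ × ℝ} (he : e ∈ strip) : toTorus e ≠ 0 := fun h =>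
  coe_ne_zero_of_mem_Ioo he (congrArg Prod.snd h)

/-- `D` parametrizes the infinite cyclic cover of a horizontal cylinder. -/
structure IsStripLift (p : X → FlatTorus) (D : ℝ × ℝ → X) : Prop where
  continuousOn : ContinuousOn D strip
  proj_eq : ∀ e ∈ strip, p (D e) = toTorus e

theorem exists_stripLift (hp : IsCoveringMapOn p {0}ᶜ) {x : X} (hx : (p x).2 ≠ 0) :
    ∃ D, IsStripLift p D ∧ ∃ e ∈ strip, D e = x := by
  obtain ⟨u, hu, hux⟩ := exists_coe_mem_Ioo hx
  obtain ⟨t, ht⟩ := QuotientAddGroup.mk_surjective (p x).1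
  obtain ⟨D, hD, hDa, hDp⟩ := exists_lift hp convex_strip isOpen_strip
    continuous_toTorus.continuousOn (fun e he => toTorus_ne_zero_of_mem_strip he) (a := (t, u)) hu
    (x := x) (Prod.ext ht.symm hux.symm)
  exact ⟨D, ⟨hD, hDp⟩, (t, u), hu, hDa⟩

/-! ### Strips that develop the horizontal cylinders. -/

namespace IsStripLift

variable {D D' : ℝ × ℝ → X}

theorem proj_ne_zero (hD : IsStripLift p D) {e : ℝ × ℝ} (he : e ∈ strip) : p (D e) ≠ 0 := by
  rw [hD.proj_eq e he]; exact toTorus_ne_zero_of_mem_strip he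

theorem snd_ne_zero (hD : IsStripLift p D) {e : ℝ × ℝ} (he : e ∈ strip) : (p (D e)).2 ≠ 0 := by
  rw [hD.proj_eq e he]; exact coe_ne_zero_of_mem_Ioo he

/-- The two points lie over the same point of the torus and have ordinates in `(0, 1)`, so they
differ by a horizontal integer translation. Uniqueness of lifts on the connected strip propagates
the equality. Thus two strips have the same image or disjoint images. -/
theorem eq_of_meet (hp : IsCoveringMapOn p {0}ᶜ) (hD : IsStripLift p D) (hD' : IsStripLift p D')
    {e e' : ℝ × ℝ} (he : e ∈ strip) (he' : e' ∈ strip) (h : D e = D' e') :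
    e.2 = e'.2 ∧ ∃ m : ℤ, e.1 - e'.1 = m ∧ ∀ w ∈ strip, D (w.1 + m, w.2) = D' w := by
  have h1 : toTorus e = toTorus e' := by rw [← hD.proj_eq e he, h, hD'.proj_eq e' he']
  obtain ⟨m, hm⟩ := coe_eq_coe_iff_int.1 (congrArg Prod.fst h1)
  have h2 : e.2 = e'.2 := coe_eq_coe_of_mem_Ioo he he' (congrArg Prod.snd h1)
  refine ⟨h2, m, hm, ?_⟩
  have hmap : Set.MapsTo (fun w : ℝ × ℝ => (w.1 + m, w.2)) strip strip := fun w hw => hw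
  have ht : ∀ w : ℝ × ℝ, toTorus (w.1 + m, w.2) = toTorus w := fun w =>
    Prod.ext (coe_eq_coe_iff_int.2 ⟨m, by simp⟩) rfl
  refine eqOn_of_lift hp convex_strip.isPreconnected
    (hD.continuousOn.comp (by fun_prop) hmap) hD'.continuousOn ?_ ?_ he' ?_
  · intro w hw
    rw [hD.proj_eq _ (hmap hw), ht, hD'.proj_eq w hw]
  · intro w hw
    exact hD.proj_ne_zero (hmap hw)
  · rw [← h]
    refine congrArg D (Prod.ext ?_ h2.symm)
    simp only
    linarith

theorem isOpen_image (hp : IsCoveringMapOn p {0}ᶜ) (hD : IsStripLift p D) : IsOpen (D '' strip) :=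
  TorusCover.isOpen_image hp isOpen_strip hD.continuousOn hD.proj_eq
    fun _ he => toTorus_ne_zero_of_mem_strip he

theorem image_subset (hp : IsCoveringMapOn p {0}ᶜ) (hD : IsStripLift p D) (hD' : IsStripLift p D')
    {e e' : ℝ × ℝ} (he : e ∈ strip) (he' : e' ∈ strip) (h : D e = D' e') :
    D' '' strip ⊆ D '' strip := by
  obtain ⟨-, m, -, hm⟩ := hD.eq_of_meet hp hD' he he' h
  rintro _ ⟨w, hw, rfl⟩
  exact ⟨(w.1 + m, w.2), hw, hm w hw⟩

end IsStripLift

end TorusCover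

/-! ### Coordinates adapted to a rational direction -/

/-- A positively oriented basis `(a, b), (c, e)` of `ℤ²` with `θ = k • (a, b)`, `k > 0`. -/
structure Frame (θ : ℤ × ℤ) where
  (a b c e k : ℤ)
  k_pos : 0 < k
  fst_eq : θ.1 = k * a
  snd_eq : θ.2 = k * b
  det_eq : a * e - b * c = 1

namespace Frame

variable {θ : ℤ × ℤ}

theorem exists_frame (hθ : θ ≠ 0) : Nonempty (Frame θ) := by
  have hg : Int.gcd θ.1 θ.2 ≠ 0 := by
    rw [ne_eq, Int.gcd_eq_zero_iff]
    exact fun h => hθ (Prod.ext h.1 h.2)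
  have hg' : (0 : ℤ) < Int.gcd θ.1 θ.2 := by exact_mod_cast Nat.pos_of_ne_zero hg
  obtain ⟨a, ha⟩ := Int.gcd_dvd_left θ.1 θ.2
  obtain ⟨b, hb⟩ := Int.gcd_dvd_right θ.1 θ.2
  -- The second basis vector comes from the Bézout coefficients of `θ.1` and `θ.2`.
  refine ⟨⟨a, b, -Int.gcdB θ.1 θ.2, Int.gcdA θ.1 θ.2, Int.gcd θ.1 θ.2, hg', ha, hb, ?_⟩⟩
  have h := Int.gcd_eq_gcd_ab θ.1 θ.2
  apply mul_left_cancel₀ hg'.ne'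
  linear_combination -h - (Int.gcdA θ.1 θ.2) * ha - (Int.gcdB θ.1 θ.2) * hb

variable (f : Frame θ)

/-- The coordinates of a vector in the basis. -/
def lin (u : ℝ × ℝ) : ℝ × ℝ := (f.e * u.1 - f.c * u.2, f.a * u.2 - f.b * u.1)

/-- The vector with given coordinates in the basis. -/
def unlin (u : ℝ × ℝ) : ℝ × ℝ := (f.a * u.1 + f.c * u.2, f.b * u.1 + f.e * u.2)

theorem det_eq_real : (f.a * f.e - f.b * f.c : ℝ) = 1 := by exact_mod_cast f.det_eq

theorem lin_unlin (u : ℝ × ℝ) : f.lin (f.unlin u) = u := by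
  have h := f.det_eq_real
  refine Prod.ext ?_ ?_ <;> simp only [lin, unlin]
  · linear_combination u.1 * h
  · linear_combination u.2 * h

theorem unlin_lin (u : ℝ × ℝ) : f.unlin (f.lin u) = u := by
  have h := f.det_eq_real
  refine Prod.ext ?_ ?_ <;> simp only [lin, unlin]
  · linear_combination u.1 * h
  · linear_combination u.2 * h

theorem lin_add (u w : ℝ × ℝ) : f.lin (u + w) = f.lin u + f.lin w := by
  refine Prod.ext ?_ ?_ <;> simp only [lin, Prod.fst_add, Prod.snd_add] <;> ring

theorem lin_smul (t : ℝ) (u : ℝ × ℝ) : f.lin (t • u) = t • f.lin u := by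
  refine Prod.ext ?_ ?_ <;> simp only [lin, Prod.smul_fst, Prod.smul_snd, smul_eq_mul] <;> ring

theorem lin_along (t : ℝ) : f.lin (SquareTiled.along θ t) = (f.k * t, 0) := by
  have h := f.det_eq_real
  have h1 : (θ.1 : ℝ) = f.k * f.a := by exact_mod_cast f.fst_eq
  have h2 : (θ.2 : ℝ) = f.k * f.b := by exact_mod_cast f.snd_eq
  refine Prod.ext ?_ ?_ <;> simp only [lin, SquareTiled.along, h1, h2]
  · linear_combination f.k * t * h
  · ring

/-- The automorphism of the torus that expresses points in the coordinates of the basis. -/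
def torusMap : FlatTorus ≃ₜ FlatTorus where
  toFun b := (f.e • b.1 - f.c • b.2, f.a • b.2 - f.b • b.1)
  invFun b := (f.a • b.1 + f.c • b.2, f.b • b.1 + f.e • b.2)
  left_inv b := by
    have h := f.det_eq
    refine Prod.ext ?_ ?_ <;> simp only [smul_sub, smul_smul]
    · have : (f.a * f.e) • b.1 = b.1 + (f.c * f.b) • b.1 := by
        rw [show f.a * f.e = 1 + f.c * f.b by linarith, add_smul, one_smul]
      rw [this, mul_comm f.a f.c]; abel
    · have : (f.e * f.a) • b.2 = b.2 + (f.b * f.c) • b.2 := by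
        rw [show f.e * f.a = 1 + f.b * f.c by linarith, add_smul, one_smul]
      rw [this, mul_comm f.b f.e]; abel
  right_inv b := by
    have h := f.det_eq
    refine Prod.ext ?_ ?_ <;> simp only [smul_add, smul_smul]
    · have : (f.e * f.a) • b.1 = b.1 + (f.c * f.b) • b.1 := by
        rw [show f.e * f.a = 1 + f.c * f.b by linarith, add_smul, one_smul]
      rw [this, mul_comm f.c f.e]; abel
    · have : (f.a * f.e) • b.2 = b.2 + (f.b * f.c) • b.2 := by
        rw [show f.a * f.e = 1 + f.b * f.c by linarith, add_smul, one_smul]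
      rw [this, mul_comm f.b f.a]; abel
  continuous_toFun := by fun_prop
  continuous_invFun := by fun_prop

theorem torusMap_toTorus (u : ℝ × ℝ) : f.torusMap (toTorus u) = toTorus (f.lin u) := by
  have hm (m : ℤ) (t : ℝ) : ((m * t : ℝ) : UnitAddCircle) = m • (t : UnitAddCircle) := by
    rw [← zsmul_eq_mul]; rfl
  refine Prod.ext ?_ ?_ <;> simp only [torusMap, toTorus, lin, AddCircle.coe_sub, hm] <;> rfl

theorem torusMap_add (b b' : FlatTorus) : f.torusMap (b + b') = f.torusMap b + f.torusMap b' := by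
  refine Prod.ext ?_ ?_ <;> simp [torusMap, smul_add] <;> abel

theorem torusMap_zero : f.torusMap 0 = 0 := by
  refine Prod.ext ?_ ?_ <;> simp [torusMap]

theorem torusMap_eq_zero {b : FlatTorus} : f.torusMap b = 0 ↔ b = 0 := by
  rw [← f.torusMap_zero, f.torusMap.injective.eq_iff, f.torusMap_zero]

variable {S : Type} {h v : Equiv.Perm S}

/-- The covering of the torus, in the coordinates of the basis. -/
def proj (x : SquareTiled h v) : FlatTorus := f.torusMap (SquareTiled.proj x)

theorem continuous_proj : Continuous (f.proj : SquareTiled h v → FlatTorus) :=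
  f.torusMap.continuous.comp SquareTiled.continuous_proj

theorem proj_eq_zero {x : SquareTiled h v} : f.proj x = 0 ↔ SquareTiled.proj x = 0 :=
  f.torusMap_eq_zero

theorem isCoveringMapOn_proj [Finite S] :
    IsCoveringMapOn (f.proj : SquareTiled h v → FlatTorus) {0}ᶜ := by
  have h1 := (SquareTiled.isCoveringMapOn_proj (h := h) (v := v)).homeomorph_comp f.torusMap
  refine h1.mono fun b hb => ?_
  simp only [Set.mem_preimage, Set.mem_compl_iff, Set.mem_singleton_iff] at hb ⊢
  intro h2
  apply hb
  rw [← f.torusMap.apply_symm_apply b, h2, f.torusMap_zero]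

end Frame

namespace SquareTiled

variable {S : Type} {h v : Equiv.Perm S}

/-- A fibre of a covering is discrete, and here it is also compact. -/
theorem finite_fiber [Finite S] {b : FlatTorus} (hb : b ≠ 0) :
    (proj ⁻¹' {b} : Set (SquareTiled h v)).Finite := by
  have h1 : IsCompact (proj ⁻¹' {b} : Set (SquareTiled h v)) :=
    (isClosed_singleton.preimage continuous_proj).isCompact
  have h2 : IsDiscrete (proj ⁻¹' {b} : Set (SquareTiled h v)) :=
    ⟨(isCoveringMapOn_proj b hb).discreteTopology_fiber⟩
  exact h1.finite h2

theorem not_isSingular_of_proj_ne_zero [Finite S] {x : SquareTiled h v} (hx : proj x ≠ 0) :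
    ¬ IsSingular x := fun hs => hs (TorusCover.exists_injOn isCoveringMapOn_proj hx)

end SquareTiled

/-! ### The structure of the cylinders -/

/-- The maps `D g`, for `g : ι`, parametrize the infinite cyclic covers of the horizontal cylinders
of `p : X → ℝ² / ℤ²`, all of which have circumference `n`. -/
structure IsCylinderChart {X ι : Type} [TopologicalSpace X] (p : X → FlatTorus) (n : ℤ)
    (D : ι → ℝ × ℝ → X) : Prop where
  pos : 0 < n
  lift : ∀ g, TorusCover.IsStripLift p (D g)
  cover : ∀ x, (p x).2 ≠ 0 → ∃ g, ∃ e ∈ TorusCover.strip, D g e = x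
  periodic : ∀ g, ∀ e ∈ TorusCover.strip, ∀ m : ℤ, D g (e.1 + m * n, e.2) = D g e
  inj : ∀ g g', ∀ e ∈ TorusCover.strip, ∀ e' ∈ TorusCover.strip, D g e = D g' e' →
    g = g' ∧ e.2 = e'.2 ∧ ∃ m : ℤ, e.1 - e'.1 = m * n

namespace SquareTiled

open TorusCover

variable {S : Type} {h v : Equiv.Perm S} {θ : ℤ × ℤ}

theorem IsClosedGeodesic.proj_frame {L : ℝ} {γ : C(UnitAddCircle, SquareTiled h v)}
    (hγ : IsClosedGeodesic θ L γ) {η : ℤ × ℤ} (f : Frame η) (t : ℝ) :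
    f.proj (γ (t : UnitAddCircle)) = f.proj (γ 0) + toTorus (t • f.lin (along θ L)) := by
  rw [Frame.proj, hγ.straight, f.torusMap_add, f.torusMap_toTorus, Frame.proj, ← f.lin_smul]
  congr 3
  refine Prod.ext ?_ ?_ <;> simp [along] <;> ring

theorem IsClosedGeodesic.exists_int {L : ℝ} {γ : C(UnitAddCircle, SquareTiled h v)}
    (hγ : IsClosedGeodesic θ L γ) {η : ℤ × ℤ} (f : Frame η) :
    ∃ m n : ℤ, f.lin (along θ L) = ((m : ℝ), (n : ℝ)) := by
  have h1 := hγ.proj_frame f 1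
  have h2 : ((1 : ℝ) : UnitAddCircle) = 0 := AddCircle.coe_period 1
  rw [h2, one_smul, left_eq_add] at h1
  obtain ⟨m, hm⟩ := coe_eq_zero_iff_int.1 (congrArg Prod.fst h1)
  obtain ⟨n, hn⟩ := coe_eq_zero_iff_int.1 (congrArg Prod.snd h1)
  exact ⟨m, n, Prod.ext hm hn⟩

theorem IsClosedGeodesic.proj_ne_zero (hs : ∀ x : SquareTiled h v, proj x = 0 → IsSingular x)
    {L : ℝ} {γ : C(UnitAddCircle, SquareTiled h v)} (hγ : IsClosedGeodesic θ L γ)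
    (t : UnitAddCircle) : proj (γ t) ≠ 0 := fun h0 => hγ.regular t (hs _ h0)

/-- In the coordinates of the frame a geodesic in the direction `θ` is horizontal. At height `0` it
would pass over the origin of the torus, that is, through a singularity. -/
theorem IsClosedGeodesic.snd_ne_zero (hs : ∀ x : SquareTiled h v, proj x = 0 → IsSingular x)
    {L : ℝ} {γ : C(UnitAddCircle, SquareTiled h v)} (hγ : IsClosedGeodesic θ L γ) (f : Frame θ)
    (t : UnitAddCircle) : (f.proj (γ t)).2 ≠ 0 := by
  obtain ⟨t, rfl⟩ := QuotientAddGroup.mk_surjective t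
  have hk : (0 : ℝ) < f.k * L := mul_pos (by exact_mod_cast f.k_pos) hγ.pos
  have h1 := fun t => hγ.proj_frame f t
  simp only [f.lin_along] at h1
  intro h0
  rw [h1] at h0
  obtain ⟨w, hw⟩ := QuotientAddGroup.mk_surjective (f.proj (γ 0)).1
  -- The time at which the abscissa, which moves from `w` with velocity `f.k * L`, becomes `0`.
  refine hγ.proj_ne_zero hs ((-w / (f.k * L) : ℝ) : UnitAddCircle) (f.proj_eq_zero.1 ?_)
  rw [h1]
  refine Prod.ext ?_ ?_
  · rw [Prod.fst_add, ← hw]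
    change ((w : ℝ) : UnitAddCircle) + (((-w / (f.k * L)) * (f.k * L) : ℝ) : UnitAddCircle) = 0
    rw [← AddCircle.coe_add, div_mul_cancel₀ _ hk.ne', add_neg_cancel]
    rfl
  · simpa [toTorus] using h0

/-- The horizontal line through `x` avoids the branch points and returns to each finite fibre, so it
closes up. Its least positive integral period gives an injective parametrization. -/
theorem exists_closedGeodesic [Finite S] (f : Frame θ) {x : SquareTiled h v}
    (hx : (f.proj x).2 ≠ 0) : x ∈ cylinderSet h v θ := by
  classical
  have hp := f.isCoveringMapOn_proj (h := h) (v := v)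
  obtain ⟨D, hD, e, he, rfl⟩ := exists_stripLift hp hx
  have hper : ∃ N : ℕ, 0 < N ∧ D (e.1 + N, e.2) = D e := by
    have hfin := finite_fiber (h := h) (v := v) (b := proj (D e))
      (fun h0 => hD.proj_ne_zero he (f.proj_eq_zero.2 h0))
    have hmem : ∀ m : ℕ, D (e.1 + m, e.2) ∈ (proj ⁻¹' {proj (D e)} : Set (SquareTiled h v)) := by
      intro m
      apply f.torusMap.injective
      change f.proj _ = f.proj _
      rw [hD.proj_eq _ he, hD.proj_eq _ (show (e.1 + m, e.2) ∈ strip from he)]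
      exact Prod.ext (coe_eq_coe_iff_int.2 ⟨m, by simp⟩) rfl
    -- Pigeonhole principle: infinitely many integral translates lie in one finite fibre.
    obtain ⟨m, -, m', -, hmm, heq⟩ := Set.infinite_univ.exists_ne_map_eq_of_mapsTo
      (f := fun m : ℕ => D (e.1 + m, e.2)) (fun m _ => hmem m) hfin
    wlog hlt : m < m' generalizing m m'
    · exact this m' m hmm.symm heq.symm (lt_of_le_of_ne (not_lt.1 hlt) hmm.symm)
    refine ⟨m' - m, by omega, ?_⟩
    obtain ⟨-, j, hj, hj'⟩ := hD.eq_of_meet hp hD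
      (show (e.1 + m, e.2) ∈ strip from he) (show (e.1 + m', e.2) ∈ strip from he) heq
    have h1 := hj' (e.1 + (m' - m : ℕ), e.2) he
    rw [← h1]
    congr 2
    push_cast [hlt.le]
    rw [← hj]
    simp only
    ring
  obtain ⟨hN0, hN⟩ := Nat.find_spec hper
  have hmin := fun m => Nat.find_min hper (m := m)
  set N := Nat.find hper with hNdef
  have hNr : (0 : ℝ) < N := by exact_mod_cast hN0
  have hshift : ∀ w ∈ strip, D (w.1 + N, w.2) = D w := by
    obtain ⟨-, j, hj, hj'⟩ := hD.eq_of_meet hp hD (show (e.1 + N, e.2) ∈ strip from he) he hN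
    intro w hw
    rw [← hj' w hw, ← hj]
    simp
  have hmem : ∀ t : ℝ, (e.1 + N * t, e.2) ∈ strip := fun _ => he
  have hcont : Continuous fun t : ℝ => D (e.1 + N * t, e.2) :=
    hD.continuousOn.comp_continuous (by fun_prop) hmem
  have hperiod : Function.Periodic (fun t : ℝ => D (e.1 + N * t, e.2)) 1 := by
    intro t
    have := hshift (e.1 + N * t, e.2) he
    simp only at this ⊢
    rw [← this]
    ring_nf
  let γ : C(UnitAddCircle, SquareTiled h v) := ⟨hperiod.lift, continuous_coinduced_dom.2 hcont⟩
  have hγ (t : ℝ) : γ (t : UnitAddCircle) = D (e.1 + N * t, e.2) := rfl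
  have hk : (0 : ℝ) < f.k := by exact_mod_cast f.k_pos
  refine ⟨N / f.k, γ, ⟨by positivity, ?_, ?_, ?_⟩, ?_⟩
  · intro s t hst
    obtain ⟨s, rfl⟩ := QuotientAddGroup.mk_surjective s
    obtain ⟨t, rfl⟩ := QuotientAddGroup.mk_surjective t
    change γ (s : UnitAddCircle) = γ (t : UnitAddCircle) at hst
    rw [hγ, hγ] at hst
    obtain ⟨-, j, hj, hj'⟩ := hD.eq_of_meet hp hD (hmem s) (hmem t) hst
    have hj2 : (N : ℝ) * (s - t) = j := by rw [← hj]; simp only; ring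
    have hmul : ∀ q : ℤ, ∀ w ∈ strip, D (w.1 + q * N, w.2) = D w := by
      intro q
      induction q using Int.induction_on with
      | zero => intro w _; simp
      | succ i ih =>
        intro w hw
        have h1 := hshift (w.1 + (i : ℤ) * N, w.2) hw
        rw [ih w hw] at h1
        rw [← h1]
        congr 2
        push_cast
        ring
      | pred i ih =>
        intro w hw
        have h1 := hshift (w.1 + ((-i - 1 : ℤ) : ℝ) * N, w.2) hw
        rw [← h1, ← ih w hw]
        congr 2
        push_cast
        ring
    -- A non-zero remainder would be a period smaller than the minimal one.
    have hrem : j % N = 0 := by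
      by_contra hne
      have hnn : 0 ≤ j % N := Int.emod_nonneg j (by omega)
      have hlt : j % N < N := Int.emod_lt_of_pos j (by omega)
      refine hmin (j % N).toNat (by omega) ⟨by omega, ?_⟩
      have h2 := hmul (j / N) (e.1 + ((j % N).toNat : ℝ), e.2) he
      have h3 := hj' e he
      rw [← h3, ← h2]
      congr 2
      have h4 : ((j % N).toNat : ℝ) = ((j % N : ℤ) : ℝ) := by
        rw [← Int.cast_natCast, Int.toNat_of_nonneg hnn]
      have h5 : (j : ℝ) = ((j % N + N * (j / N) : ℤ) : ℝ) := by rw [Int.emod_add_mul_ediv]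
      rw [h4, h5]
      push_cast
      ring
    obtain ⟨q, hq⟩ := Int.dvd_of_emod_eq_zero hrem
    refine coe_eq_coe_iff_int.2 ⟨q, ?_⟩
    apply mul_left_cancel₀ hNr.ne'
    rw [hj2, hq]
    push_cast
    ring
  · intro t
    obtain ⟨t, rfl⟩ := QuotientAddGroup.mk_surjective t
    refine not_isSingular_of_proj_ne_zero fun h0 => ?_
    exact hD.proj_ne_zero (hmem t) (f.proj_eq_zero.2 h0)
  · intro t
    apply f.torusMap.injective
    rw [f.torusMap_add, f.torusMap_toTorus, f.lin_along]
    have h0 := hγ 0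
    rw [AddCircle.coe_zero] at h0
    change f.proj (γ t) = f.proj (γ 0) + _
    rw [hγ, h0, hD.proj_eq _ (hmem t), hD.proj_eq _ (hmem 0), ← toTorus_add]
    congr 1
    refine Prod.ext ?_ ?_
    · simp; field_simp
    · simp
  · have h0 := hγ 0
    rw [AddCircle.coe_zero] at h0
    rw [h0]
    simp

theorem mem_cylinderSet_iff [Finite S] (hs : ∀ x : SquareTiled h v, proj x = 0 → IsSingular x)
    (f : Frame θ) {x : SquareTiled h v} : x ∈ cylinderSet h v θ ↔ (f.proj x).2 ≠ 0 := by
  refine ⟨?_, exists_closedGeodesic f⟩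
  rintro ⟨L, γ, hγ, rfl⟩
  exact hγ.snd_ne_zero hs f 0

/-- Each cylinder is developed by the strip through the starting point of its waist curve. Since the
curves have the same length `L`, all circumferences are the same integer `n = f.k * L`. -/
theorem IsCylinderDecomposition.exists_chart [Finite S]
    (hs : ∀ x : SquareTiled h v, proj x = 0 → IsSingular x) (f : Frame θ) {ι : Type} [Nonempty ι]
    {L : ℝ} {c : ι → C(UnitAddCircle, SquareTiled h v)} (hc : IsCylinderDecomposition θ L c) :
    ∃ (n : ℤ) (D : ι → ℝ × ℝ → SquareTiled h v) (w : ι → ℝ × ℝ),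
      IsCylinderChart f.proj n D ∧ (n : ℝ) = f.k * L ∧ (∀ g, w g ∈ strip) ∧
      ∀ g (t : ℝ), c g (t : UnitAddCircle) = D g ((w g).1 + n * t, (w g).2) := by
  have hp := f.isCoveringMapOn_proj (h := h) (v := v)
  obtain ⟨g₀⟩ := ‹Nonempty ι›
  obtain ⟨n, n₂, hn⟩ := (hc.geodesic g₀).exists_int f
  rw [f.lin_along, Prod.mk.injEq] at hn
  have hn' := hn.1
  have hnpos : 0 < n := by
    have : (0 : ℝ) < f.k * L := mul_pos (by exact_mod_cast f.k_pos) (hc.geodesic g₀).pos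
    rw [hn'] at this
    exact_mod_cast this
  choose D hD w hw hDw using fun g => exists_stripLift hp ((hc.geodesic g).snd_ne_zero hs f 0)
  have hmem : ∀ g (t : ℝ), ((w g).1 + n * t, (w g).2) ∈ strip := fun g _ => hw g
  have hcD : ∀ g (t : ℝ), c g (t : UnitAddCircle) = D g ((w g).1 + n * t, (w g).2) := by
    intro g
    have := eqOn_of_lift hp (K := Set.univ) isPreconnected_univ
      (F := fun t : ℝ => c g (t : UnitAddCircle))
      (G := fun t : ℝ => D g ((w g).1 + n * t, (w g).2))
      ((c g).continuous.comp (AddCircle.continuous_mk' 1)).continuousOn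
      ((hD g).continuousOn.comp_continuous (by fun_prop) (hmem g)).continuousOn
      (fun t _ => ?_) (fun t _ h0 => ?_) (a := 0) (Set.mem_univ _) (by simp [hDw])
    · exact fun t => this (Set.mem_univ t)
    · rw [(hc.geodesic g).proj_frame f, f.lin_along, (hD g).proj_eq _ (hmem g t), ← hDw,
        (hD g).proj_eq _ (hw g), ← toTorus_add]
      congr 1
      refine Prod.ext ?_ ?_
      · simp only [Prod.smul_mk, smul_eq_mul, Prod.fst_add]
        rw [hn']; ring
      · simp
    · exact (hc.geodesic g).proj_ne_zero hs _ (f.proj_eq_zero.1 h0)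
  have hcyl : ∀ g, ∀ e ∈ strip, D g e ∈ cylinderSet h v θ := fun g e he =>
    (mem_cylinderSet_iff hs f).2 ((hD g).snd_ne_zero he)
  -- Strip images that meet coincide, so the complement of an image is a union of open images.
  have hclopen : ∀ g, IsClopen (Subtype.val ⁻¹' (D g '' strip) : Set (cylinderSet h v θ)) := by
    intro g
    refine ⟨⟨?_⟩, ((hD g).isOpen_image hp).preimage continuous_subtype_val⟩
    rw [isOpen_iff_mem_nhds]
    rintro ⟨x, hx⟩ hxg
    obtain ⟨D', hD', e, he, rfl⟩ := exists_stripLift hp ((mem_cylinderSet_iff hs f).1 hx)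
    refine mem_of_superset (((hD'.isOpen_image hp).preimage continuous_subtype_val).mem_nhds
      (Set.mem_image_of_mem _ he)) ?_
    rintro ⟨y, hy⟩ ⟨e', he', hy'⟩ ⟨e'', he'', hy''⟩
    refine hxg ((hD g).image_subset hp hD' he'' he' ?_ (Set.mem_image_of_mem _ he))
    exact hy''.trans hy'.symm
  -- A strip image is connected. If two of them meet, their waist curves lie in one component, which
  -- contains only one of the chosen curves.
  have hcomp : ∀ g g', (∃ e ∈ strip, ∃ e' ∈ strip, D g e = D g' e') → g = g' := by
    rintro g g' ⟨e, he, e', he', hee⟩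
    apply hc.bijective.1
    refine ConnectedComponents.coe_eq_coe.2 ?_
    apply connectedComponent_eq
    have hcg : ∀ g, c g 0 = D g (w g) := fun g => (hDw g).symm
    let F : strip → cylinderSet h v θ := fun e => ⟨D g e, hcyl g e e.2⟩
    have hFc : Continuous F := (hD g).continuousOn.domRestrict.subtype_mk _
    have := isPreconnected_iff_preconnectedSpace.1 convex_strip.isPreconnected
    have hpre : IsPreconnected (Set.range F) := isPreconnected_range hFc
    obtain ⟨e₁, he₁, h1⟩ := (hD g).image_subset hp (hD g') he he' hee
      (Set.mem_image_of_mem _ (hw g'))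
    refine hpre.subset_connectedComponent ⟨⟨w g, hw g⟩, Subtype.ext (hcg g).symm⟩ ⟨⟨e₁, he₁⟩, ?_⟩
    exact Subtype.ext (h1.trans (hcg g').symm)
  refine ⟨n, D, w, ⟨hnpos, hD, ?_, ?_, ?_⟩, hn'.symm, hw, hcD⟩
  · intro x hx
    have hx' := (mem_cylinderSet_iff hs f).2 hx
    obtain ⟨g, hg⟩ := hc.bijective.2 ((⟨x, hx'⟩ : cylinderSet h v θ) :
      _root_.ConnectedComponents _)
    have hg' := ConnectedComponents.coe_eq_coe.1 hg
    have hsub := (hclopen g).connectedComponent_subset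
      (x := ⟨c g 0, L, c g, hc.geodesic g, rfl⟩) ⟨w g, hw g, hDw g⟩
    rw [hg'] at hsub
    exact ⟨g, hsub mem_connectedComponent⟩
  · intro g e he m
    have h1 : D g ((w g).1 + n * m, (w g).2) = D g (w g) := by
      rw [← hcD, hDw]
      congr 1
      exact coe_eq_zero_iff_int.2 ⟨m, rfl⟩
    obtain ⟨-, j, hj, hj'⟩ := (hD g).eq_of_meet hp (hD g) (hmem g m) (hw g) h1
    rw [← hj' e he, ← hj]
    congr 2
    simp only
    ring
  · intro g g' e he e' he' hee
    obtain rfl := hcomp g g' ⟨e, he, e', he', hee⟩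
    obtain ⟨h2, j, hj, hj'⟩ := (hD g).eq_of_meet hp (hD g) he he' hee
    refine ⟨rfl, h2, ?_⟩
    have hnr : (n : ℝ) ≠ 0 := by exact_mod_cast hnpos.ne'
    -- A translation by `j` that fixes the cylinder pointwise closes the waist curve up at time `j /
    -- n`. Injectivity of the curve makes this time an integer.
    have h3 : c g ((j / n : ℝ) : UnitAddCircle) = c g 0 := by
      rw [hcD, mul_div_cancel₀ _ hnr, hj' _ (hw g), hDw]
    obtain ⟨m, hm⟩ := coe_eq_zero_iff_int.1 ((hc.geodesic g).injective h3)
    refine ⟨m, ?_⟩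
    rw [hj, ← hm]
    field_simp

end SquareTiled

/-! ### The vertices of the quaternionic covers -/

namespace SquareTiled

variable {S : Type} {h v : Equiv.Perm S}

/-- The upper right corner of `s` is reached from its right side and from its top side. -/
theorem pt_corner_comm (s : S) :
    (pt (v (h s)) (0, 0) : SquareTiled h v) = pt (h (v s)) (0, 0) := by
  rw [← pt_top, ← pt_right, ← pt_right, ← pt_top]

theorem exists_corner {x : SquareTiled h v} (hx : proj x = 0) : ∃ s, x = pt s (0, 0) := by
  obtain ⟨s, ⟨a, b⟩, rfl⟩ := exists_pt x
  rw [proj_pt, Prod.mk_eq_zero, coe_eq_zero, coe_eq_zero] at hx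
  rcases hx with ⟨rfl | rfl, rfl | rfl⟩
  · exact ⟨_, rfl⟩
  · exact ⟨_, pt_top _ _⟩
  · exact ⟨_, pt_right _ _⟩
  · exact ⟨_, (pt_right _ _).trans (pt_top _ _)⟩

/-- The points `(t, t)` of the two squares are distinct for small `t > 0`, tend to the common corner
and have the same projection. -/
theorem isSingular_corner {s s' : S} (hne : s ≠ s')
    (he : (pt s (0, 0) : SquareTiled h v) = pt s' (0, 0)) :
    IsSingular (pt s (0, 0) : SquareTiled h v) := by
  rintro ⟨U, hU, hinj⟩
  have h1 : ∀ᶠ q in 𝓝 ((0, 0) : unitInterval × unitInterval),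
      (pt s q : SquareTiled h v) ∈ U ∧ (pt s' q : SquareTiled h v) ∈ U :=
    ((continuous_pt s).continuousAt.eventually_mem hU).and
      ((continuous_pt s').continuousAt.eventually_mem (he ▸ hU))
  have h2 : Tendsto (fun t : unitInterval => (t, t)) (𝓝[>] 0) (𝓝 ((0, 0) : _ × _)) :=
    ((continuous_id.prodMk continuous_id).tendsto 0).mono_left nhdsWithin_le_nhds
  have h3 : ∀ᶠ t : unitInterval in 𝓝[>] 0, t < 1 ∧ 0 < t :=
    ((eventually_lt_nhds (by simp)).filter_mono nhdsWithin_le_nhds).and self_mem_nhdsWithin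
  have : (𝓝[>] (0 : unitInterval)).NeBot := nhdsGT_neBot_of_exists_gt ⟨1, by simp⟩
  obtain ⟨t, ⟨ht1, ht2⟩, ht3, ht4⟩ := ((h2.eventually h1).and h3).exists
  have h4 := hinj ht1 ht2 rfl
  have h5 : (pt s (t, t) : SquareTiled h v) ∈ sheet h v s :=
    pt_mem_sheet.2 ⟨⟨ht4.ne', ht3.ne⟩, ⟨ht4.ne', ht3.ne⟩, rfl⟩
  rw [h4] at h5
  exact hne (pt_mem_sheet.1 h5).2.2.symm

end SquareTiled

namespace QCover

open SquareTiled Q8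

variable {d : ℕ}

theorem stairH_val (s : Fin d) : (stairH d s : ℕ) =
    if s.1 % 2 = 0 then (if s.1 + 1 < d then s.1 + 1 else s.1) else s.1 - 1 := by
  change Fin.val (dite _ _ _) = _
  split_ifs <;> rfl

theorem stairV_val (s : Fin d) : (stairV d s : ℕ) =
    if s.1 % 2 = 1 then (if s.1 + 1 < d then s.1 + 1 else s.1) else s.1 - 1 := by
  change Fin.val (dite _ _ _) = _
  split_ifs <;> rfl

/-- The corner of the square `(g, s)`, for `s < d`. -/
def corner (hd : 0 < d) (g : Q8) (s : ℕ) : QCover d :=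
  pt (g, (⟨s % d, Nat.mod_lt s hd⟩ : Fin d)) (0, 0)

theorem corner_eq (hd : 0 < d) (g : Q8) (s : Fin d) : corner hd g s = pt (g, s) (0, 0) := by
  rw [corner]
  congr 2
  exact Fin.ext (Nat.mod_eq_of_lt s.2)

theorem corner_comm (hd : 0 < d) (g : Q8) {s a b : ℕ} (hs : s < d)
    (ha : (stairV d (stairH d ⟨s, hs⟩) : ℕ) = a) (hb : (stairH d (stairV d ⟨s, hs⟩) : ℕ) = b) :
    corner hd (g * (if s % 2 = 0 then i else 1) *
      (if (stairH d ⟨s, hs⟩ : ℕ) % 2 = 0 then j else 1)) a =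
    corner hd (g * (if s % 2 = 0 then j else 1) *
      (if (stairV d ⟨s, hs⟩ : ℕ) % 2 = 0 then i else 1)) b := by
  have h := pt_corner_comm (h := coverH d) (v := coverV d) (g, (⟨s, hs⟩ : Fin d))
  rw [← ha, ← hb, corner_eq, corner_eq]
  exact h

/-- The corner relation of the square `t + 2`, whose neighbours in the staircase are `t + 1` and `t
+ 3`. -/
theorem corner_add_four (hd : 0 < d) (hodd : d % 2 = 1) (g : Q8) {t : ℕ} (ht : t + 4 < d) :
    corner hd (g * i) (t + 4) = corner hd (g * j) t := by
  have hs : t + 2 < d := by omega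
  rcases Nat.mod_two_eq_zero_or_one t with h0 | h1
  · have hH : (stairH d ⟨t + 2, hs⟩ : ℕ) = t + 3 := by rw [stairH_val]; grind
    have hV : (stairV d ⟨t + 2, hs⟩ : ℕ) = t + 1 := by rw [stairV_val]; grind
    have := corner_comm hd g hs (a := t + 4) (b := t) (by rw [stairV_val, hH]; grind)
      (by rw [stairH_val, hV]; grind)
    rw [hH, hV, if_pos (by omega), if_neg (by omega), if_pos (by omega), if_neg (by omega)] at this
    simpa using this
  · have hH : (stairH d ⟨t + 2, hs⟩ : ℕ) = t + 1 := by rw [stairH_val]; grind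
    have hV : (stairV d ⟨t + 2, hs⟩ : ℕ) = t + 3 := by rw [stairV_val]; grind
    have := corner_comm hd g hs (a := t) (b := t + 4) (by rw [stairV_val, hH]; grind)
      (by rw [stairH_val, hV]; grind)
    rw [hH, hV, if_neg (by omega), if_pos (by omega), if_neg (by omega), if_pos (by omega)] at this
    simpa using this.symm

theorem corner_add_four' (hd : 0 < d) (hodd : d % 2 = 1) (g : Q8) {t : ℕ} (ht : t + 4 < d) :
    corner hd g (t + 4) = corner hd (g * (i⁻¹ * j)) t := by
  have := corner_add_four hd hodd (g * i⁻¹) ht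
  simpa [mul_assoc] using this

theorem neg_pow (m : ℕ) : neg ^ m = (1 : Q8) ∨ neg ^ m = neg := by
  induction m with
  | zero => simp
  | succ m ih =>
    rw [pow_succ]
    rcases ih with h | h <;> rw [h] <;> decide

/-- A shift by four multiplies the label by `i⁻¹ j`, and `(i⁻¹ j)² = -1`. -/
theorem corner_add_eight_mul (hd : 0 < d) (hodd : d % 2 = 1) (m : ℕ) : ∀ (g : Q8) {t : ℕ},
    t + 8 * m < d → corner hd g (t + 8 * m) = corner hd (g * neg ^ m) t := by
  induction m with
  | zero => intro g t _; simp
  | succ m ih =>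
    intro g t ht
    have h1 : t + 8 * (m + 1) = (t + 4 + 8 * m) + 4 := by ring
    rw [h1, corner_add_four' hd hodd _ (by omega), ih _ (by omega),
      corner_add_four' hd hodd _ (by omega)]
    congr 1
    have h2 : ∀ ε : Q8, ε = 1 ∨ ε = neg →
      g * (i⁻¹ * j) * ε * (i⁻¹ * j) = g * (ε * neg) := by revert g; decide
    rw [pow_succ]
    exact h2 _ (neg_pow m)

/-- The squares `0`, `1`, `d - 2` and `d - 1` at the ends of the staircase give relations beyond
those of `corner_add_four`. With the shifts by eight, they carry the corners `1`, `2`, `3` to the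
corner `0` and yield one further relation, which identifies the labels `g` and `-g`. -/
theorem corner_relations (hd : d % 8 = 3) (hd5 : 5 ≤ d) (hd0 : 0 < d) :
    (∀ g, corner hd0 (neg * g) 0 = corner hd0 g 0) ∧
      ∀ s < 4, ∃ w, ∀ g, corner hd0 g s = corner hd0 (g * w) 0 := by
  -- The two assumptions on `d` force `d ≥ 11`; the residue `3` locates the last squares relative to
  -- multiples of eight.
  obtain ⟨m, hm⟩ : ∃ m, d = 8 * (m + 1) + 3 := ⟨d / 8 - 1, by omega⟩
  have hodd : d % 2 = 1 := by omega
  have r2 (g : Q8) : corner hd0 (g * i) 2 = corner hd0 (g * j * i) 1 := by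
    have hs : 0 < d := hd0
    have hH : (stairH d ⟨0, hs⟩ : ℕ) = 1 := by rw [stairH_val]; grind
    have hV : (stairV d ⟨0, hs⟩ : ℕ) = 0 := by rw [stairV_val]; grind
    have := corner_comm hd0 g hs (a := 2) (b := 1) (by rw [stairV_val, hH]; grind)
      (by rw [stairH_val, hV]; grind)
    rw [hH, hV] at this
    simpa using this
  have r3 (g : Q8) : corner hd0 (g * i * j) (8 * (m + 1) + 1) = corner hd0 (g * j) (8 * (m + 1)) := by
    have hs : 8 * (m + 1) + 2 < d := by omega
    have hH : (stairH d ⟨_, hs⟩ : ℕ) = 8 * (m + 1) + 2 := by rw [stairH_val]; grind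
    have hV : (stairV d ⟨_, hs⟩ : ℕ) = 8 * (m + 1) + 1 := by rw [stairV_val]; grind
    have := corner_comm hd0 g hs (a := 8 * (m + 1) + 1) (b := 8 * (m + 1))
      (by rw [stairV_val, hH]; grind) (by rw [stairH_val, hV]; grind)
    rw [hH, hV, if_pos (by omega), if_pos (by omega), if_neg (by omega)] at this
    simpa using this
  have r4 (g : Q8) : corner hd0 (g * j) 0 = corner hd0 (g * i) 3 := by
    have hs : 1 < d := by omega
    have hH : (stairH d ⟨1, hs⟩ : ℕ) = 0 := by rw [stairH_val]; grind
    have hV : (stairV d ⟨1, hs⟩ : ℕ) = 2 := by rw [stairV_val]; grind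
    have := corner_comm hd0 g hs (a := 0) (b := 3) (by rw [stairV_val, hH]; grind)
      (by rw [stairH_val, hV]; grind)
    rw [hH, hV] at this
    simpa using this
  have r5 (g : Q8) : corner hd0 (g * j) (8 * m + 7) = corner hd0 (g * i) (8 * (m + 1) + 2) := by
    have hs : 8 * (m + 1) + 1 < d := by omega
    have hH : (stairH d ⟨_, hs⟩ : ℕ) = 8 * (m + 1) := by rw [stairH_val]; grind
    have hV : (stairV d ⟨_, hs⟩ : ℕ) = 8 * (m + 1) + 2 := by rw [stairV_val]; grind
    have := corner_comm hd0 g hs (a := 8 * m + 7) (b := 8 * (m + 1) + 2)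
      (by rw [stairV_val, hH]; grind) (by rw [stairH_val, hV]; grind)
    rw [hH, hV, if_neg (by omega), if_pos (by omega), if_neg (by omega), if_pos (by omega)] at this
    simpa using this
  have e1 (x : Q8) : corner hd0 x 1 = corner hd0 (x * (i * j)⁻¹ * j) 0 := by
    have h1 := r3 (x * (i * j)⁻¹ * neg ^ (m + 1))
    have h0 (y : Q8) := corner_add_eight_mul hd0 hodd (m + 1) y (t := 0) (by omega)
    rw [zero_add] at h0
    rw [add_comm (8 * (m + 1)) 1, corner_add_eight_mul hd0 hodd _ _ (by omega), h0] at h1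
    have h2 : ∀ ε : Q8, ε = 1 ∨ ε = neg → x * (i * j)⁻¹ * ε * i * j * ε = x ∧
      x * (i * j)⁻¹ * ε * j * ε = x * (i * j)⁻¹ * j := by clear h1; revert x; decide
    rwa [(h2 _ (neg_pow _)).1, (h2 _ (neg_pow _)).2] at h1
  have e2 (x : Q8) : corner hd0 x 2 = corner hd0 (x * i⁻¹ * j * i) 1 := by
    have h1 := r2 (x * i⁻¹)
    rwa [inv_mul_cancel_right] at h1
  have e3 (x : Q8) : corner hd0 x 3 = corner hd0 (x * i⁻¹ * j) 0 := by
    have h1 := r4 (x * i⁻¹)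
    rw [inv_mul_cancel_right] at h1
    exact h1.symm
  have e5 (x : Q8) : corner hd0 x 2 = corner hd0 (x * i⁻¹ * j * neg * i⁻¹ * j) 3 := by
    have h2 : ∀ ε : Q8, ε = 1 ∨ ε = neg → x * i⁻¹ * (ε * neg) * i * (ε * neg) = x ∧
      x * i⁻¹ * (ε * neg) * j * ε * (i⁻¹ * j) = x * i⁻¹ * j * neg * i⁻¹ * j := by revert x; decide
    have h1 := r5 (x * i⁻¹ * neg ^ (m + 1))
    rw [add_comm (8 * (m + 1)) 2, corner_add_eight_mul hd0 hodd _ _ (by omega), add_comm (8 * m) 7,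
      corner_add_eight_mul hd0 hodd _ _ (by omega), show 7 = 3 + 4 by rfl,
      corner_add_four' hd0 hodd _ (by omega)] at h1
    rw [pow_succ, (h2 _ (neg_pow _)).1, (h2 _ (neg_pow _)).2] at h1
    exact h1.symm
  -- The corner `2` is carried to the corner `0` through the corner `1` and through the corner `3`.
  -- The two resulting labels are `x k` and `-x k`.
  have e6 (x : Q8) : corner hd0 (x * i⁻¹ * j * i * (i * j)⁻¹ * j) 0 =
      corner hd0 (x * i⁻¹ * j * neg * i⁻¹ * j * i⁻¹ * j) 0 := by
    rw [← e3, ← e5, e2, e1]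
  refine ⟨fun g => ?_, fun s hs => ?_⟩
  · have h7 : ∃ x, x * i⁻¹ * j * i * (i * j)⁻¹ * j = neg * g ∧
        x * i⁻¹ * j * neg * i⁻¹ * j * i⁻¹ * j = g := by revert g; decide
    obtain ⟨x, hx1, hx2⟩ := h7
    rw [← hx1, e6, hx2]
  · interval_cases s
    · exact ⟨1, fun g => by rw [mul_one]⟩
    · exact ⟨(i * j)⁻¹ * j, fun g => by rw [e1, mul_assoc]⟩
    · exact ⟨i⁻¹ * j * i * ((i * j)⁻¹ * j), fun g => by rw [e2, e1]; simp only [mul_assoc]⟩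
    · exact ⟨i⁻¹ * j, fun g => by rw [e3, mul_assoc]⟩

theorem exists_corner_eq (hd : d % 8 = 3) (hd5 : 5 ≤ d) (hd0 : 0 < d) (s : ℕ) (hs : s < d) :
    ∃ w, ∀ g, corner hd0 g s = corner hd0 (g * w) 0 := by
  induction s using Nat.strong_induction_on with
  | _ s ih =>
    by_cases h4 : s < 4
    · exact (corner_relations hd hd5 hd0).2 s h4
    · obtain ⟨t, rfl⟩ : ∃ t, s = t + 4 := ⟨s - 4, by omega⟩
      obtain ⟨w, hw⟩ := ih t (by omega) (by omega)
      refine ⟨i⁻¹ * j * w, fun g => ?_⟩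
      rw [corner_add_four' hd0 (by omega) g hs, hw, mul_assoc]

/-- Corners are carried to the corner `0` by right multiplication of the label, which commutes with
left multiplication by `-1`. -/
theorem pt_neg_corner (hd : d % 8 = 3) (hd5 : 5 ≤ d) (g : Q8) (s : Fin d) :
    (pt (neg * g, s) (0, 0) : QCover d) = pt (g, s) (0, 0) := by
  have hd0 : 0 < d := by omega
  obtain ⟨w, hw⟩ := exists_corner_eq hd hd5 hd0 s s.2
  rw [← corner_eq hd0, ← corner_eq hd0, hw, hw, mul_assoc, (corner_relations hd hd5 hd0).1]

theorem deck_pt (g : Q8) (s : Q8 × Fin d) (q : unitInterval × unitInterval) :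
    deck d g (pt s q) = pt (g * s.1, s.2) q := rfl

theorem deck_neg_vertex (hd : d % 8 = 3) (hd5 : 5 ≤ d) {x : QCover d} (hx : proj x = 0) :
    deck d neg x = x := by
  obtain ⟨⟨g, s⟩, rfl⟩ := exists_corner hx
  rw [deck_pt]
  exact pt_neg_corner hd hd5 g s

theorem isSingular_vertex (hd : d % 8 = 3) (hd5 : 5 ≤ d) (x : QCover d) (hx : proj x = 0) :
    IsSingular x := by
  obtain ⟨⟨g, s⟩, rfl⟩ := exists_corner hx
  refine isSingular_corner (s' := (neg * g, s)) ?_ (pt_neg_corner hd hd5 g s).symm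
  have : ∀ g, g ≠ neg * g := by decide
  exact fun h => this g (congrArg Prod.fst h)

end QCover

/-! ### Affine homeomorphisms -/

namespace SquareTiled

open TorusCover

variable {S : Type} {h v : Equiv.Perm S}

theorem IsAffineWith.exists_nhds {f : SquareTiled h v ≃ₜ SquareTiled h v}
    {A : (ℝ × ℝ) →ₗ[ℝ] (ℝ × ℝ)} (hf : IsAffineWith f A) (x : SquareTiled h v) :
    ∃ V ∈ 𝓝 x, ∃ N ∈ 𝓝 (0 : ℝ × ℝ), ∀ q ∈ V, ∀ u ∈ N, proj q = proj x + toTorus u →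
      proj (f q) = proj (f x) + toTorus (A u) := by
  obtain ⟨V, hV, N, hN, hVN⟩ := eventually_prod_iff.1 (hf x)
  exact ⟨_, hV, _, hN, fun q hq u hu => hVN hq hu⟩

theorem eventually_exists_toTorus (x : SquareTiled h v) {N : Set (ℝ × ℝ)} (hN : N ∈ 𝓝 0) :
    ∀ᶠ q in 𝓝 x, ∃ u ∈ N, proj q = proj x + toTorus u := by
  have h1 : toTorus '' N ∈ 𝓝 (0 : FlatTorus) := isOpenMap_toTorus.image_mem_nhds hN
  have h2 : Tendsto (fun q : SquareTiled h v => proj q - proj x) (𝓝 x) (𝓝 0) := by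
    have hc : Continuous fun q : SquareTiled h v => proj q - proj x :=
      continuous_proj.sub continuous_const
    simpa using hc.tendsto x
  filter_upwards [h2 h1] with q hq
  obtain ⟨u, hu, hq⟩ := hq
  change toTorus u = proj q - proj x at hq
  exact ⟨u, hu, by rw [hq]; abel⟩

/-- Near `x` the map `f` is a translation, so injectivity of `proj` near `f x` would imply
injectivity near `x`. -/
theorem isSingular_of_aut {f : SquareTiled h v ≃ₜ SquareTiled h v} (hf : IsAffineWith f 1)
    {x : SquareTiled h v} (hx : IsSingular x) : IsSingular (f x) := by
  rintro ⟨U, hU, hinj⟩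
  obtain ⟨V, hV, N, hN, hVN⟩ := hf.exists_nhds x
  refine hx ⟨{q | q ∈ V ∧ f q ∈ U ∧ ∃ u ∈ N, proj q = proj x + toTorus u},
    (eventually_mem_set.2 hV).and ((f.continuous.continuousAt.eventually_mem hU).and
      (eventually_exists_toTorus x hN)), ?_⟩
  rintro q ⟨hq, hqU, u, hu, hqu⟩ q' ⟨hq', hqU', -⟩ hqq
  apply f.injective
  refine hinj hqU hqU' ?_
  rw [hVN q hq u hu hqu, hVN q' hq' u hu (hqq ▸ hqu)]

/-- The displacement `proj (f x) - proj x` is locally constant. It vanishes at the vertices, since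
these are singular and all singularities lie over the origin. -/
theorem proj_aut [Finite S] (hs : ∀ x : SquareTiled h v, proj x = 0 → IsSingular x)
    {f : SquareTiled h v ≃ₜ SquareTiled h v} (hf : f ∈ Aut h v) (x : SquareTiled h v) :
    proj (f x) = proj x := by
  have hf' : IsAffineWith f 1 := hf
  have hlc : IsLocallyConstant fun x => proj (f x) - proj x := by
    rw [IsLocallyConstant.iff_eventually_eq]
    intro x
    obtain ⟨V, hV, N, hN, hVN⟩ := hf'.exists_nhds x
    filter_upwards [hV, eventually_exists_toTorus x hN] with q hq ⟨u, hu, hqu⟩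
    rw [hVN q hq u hu hqu, hqu, Module.End.one_apply]
    abel
  -- Each square is connected and contains a vertex, so connectedness of the surface plays no role.
  obtain ⟨s, q, rfl⟩ := exists_pt x
  have h1 := (hlc.comp_continuous (continuous_pt s)).apply_eq_of_isPreconnected
    (isPreconnected_univ) (Set.mem_univ q) (Set.mem_univ (0, 0))
  have h2 : proj (pt s (0, 0) : SquareTiled h v) = 0 := by simp [proj_pt]
  have h3 : proj (f (pt s (0, 0) : SquareTiled h v)) = 0 := by
    by_contra h0
    exact not_isSingular_of_proj_ne_zero h0 (isSingular_of_aut hf' (hs _ h2))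
  simp only [Function.comp_apply, h2, h3, sub_self] at h1
  exact sub_eq_zero.1 h1

/-- An affine homeomorphism along a family of points that is developed in the plane. -/
theorem IsAffineWith.proj_along {f : SquareTiled h v ≃ₜ SquareTiled h v}
    {A : (ℝ × ℝ) →ₗ[ℝ] (ℝ × ℝ)} (hf : IsAffineWith f A) {B : Type} [TopologicalSpace B]
    {K : Set B} (hK : IsPreconnected K) {γ : B → SquareTiled h v} (hγ : ContinuousOn γ K)
    {u : B → ℝ × ℝ} (hu : ContinuousOn u K) (hγu : ∀ e ∈ K, proj (γ e) = toTorus (u e))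
    {a e : B} (ha : a ∈ K) (he : e ∈ K) :
    proj (f (γ e)) - toTorus (A (u e)) = proj (f (γ a)) - toTorus (A (u a)) := by
  have := isPreconnected_iff_preconnectedSpace.1 hK
  have hlc : IsLocallyConstant fun e : K => proj (f (γ e)) - toTorus (A (u e)) := by
    rw [IsLocallyConstant.iff_eventually_eq]
    intro e
    obtain ⟨V, hV, N, hN, hVN⟩ := hf.exists_nhds (γ e)
    have h1 : Tendsto (fun e' : K => u e' - u e) (𝓝 e) (𝓝 0) := by
      have hc : Continuous fun e' : K => u e' - u e := hu.domRestrict.sub continuous_const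
      simpa using hc.tendsto e
    filter_upwards [hγ.domRestrict.continuousAt.eventually_mem hV, h1 hN] with e' h2 h3
    have h4 := hVN _ h2 _ h3 (by
      change proj (γ e') = _
      rw [hγu e' e'.2, hγu e e.2, ← toTorus_add, add_sub_cancel])
    change proj (f (γ e')) = _ at h4
    rw [h4, map_sub, toTorus_sub]
    abel
  exact hlc.apply_eq_of_isPreconnected isPreconnected_univ (Set.mem_univ ⟨e, he⟩)
    (Set.mem_univ ⟨a, ha⟩)

variable {θ : ℤ × ℤ}

/-- The coordinates in a frame as a linear equivalence. -/
def _root_.Frame.linEquiv (f : Frame θ) : (ℝ × ℝ) ≃ₗ[ℝ] (ℝ × ℝ) where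
  toFun := f.lin
  invFun := f.unlin
  map_add' := f.lin_add
  map_smul' := f.lin_smul
  left_inv := f.unlin_lin
  right_inv := f.lin_unlin

theorem exists_shear (f : Frame θ) {A : (ℝ × ℝ) →ₗ[ℝ] (ℝ × ℝ)} (hdet : LinearMap.det A = 1)
    (hA1 : A ≠ 1) (hAθ : A (along θ 1) = along θ 1) :
    ∃ κ : ℝ, κ ≠ 0 ∧ ∀ u, f.lin (A (f.unlin u)) = (u.1 + κ * u.2, u.2) := by
  let B : (ℝ × ℝ) →ₗ[ℝ] (ℝ × ℝ) := f.linEquiv ∘ₗ A ∘ₗ (f.linEquiv.symm : (ℝ × ℝ) →ₗ[ℝ] (ℝ × ℝ))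
  have hB : ∀ u, B u = f.lin (A (f.unlin u)) := fun _ => rfl
  have hk : (0 : ℝ) < f.k := by exact_mod_cast f.k_pos
  have h10 : B (1, 0) = (1, 0) := by
    have h1 : f.unlin ((f.k : ℝ), 0) = along θ 1 := by
      rw [← f.unlin_lin (along θ 1), f.lin_along, mul_one]
    have h2 : B ((f.k : ℝ), 0) = ((f.k : ℝ), 0) := by
      rw [hB, h1, hAθ, f.lin_along, mul_one]
    have h3 : ((f.k : ℝ), (0 : ℝ)) = (f.k : ℝ) • ((1 : ℝ), (0 : ℝ)) := by simp
    rw [h3, map_smul] at h2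
    exact smul_right_injective _ hk.ne' h2
  have hBdet : LinearMap.det B = 1 := by rw [LinearMap.det_conj, hdet]
  have hexp : ∀ u : ℝ × ℝ, B u = u.1 • B (1, 0) + u.2 • B (0, 1) := by
    intro u
    rw [← map_smul, ← map_smul, ← map_add]
    simp
  have h01 : (B (0, 1)).2 = 1 := by
    rw [← LinearMap.det_toMatrix (Module.Basis.finTwoProd ℝ), Matrix.det_fin_two] at hBdet
    simpa [LinearMap.toMatrix_apply, h10] using hBdet
  refine ⟨(B (0, 1)).1, fun h0 => hA1 ?_, fun u => ?_⟩
  · have hB1 : ∀ u, B u = u := by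
      intro u
      rw [hexp, h10]
      refine Prod.ext ?_ ?_ <;> simp [h0, h01]
    refine LinearMap.ext fun u => ?_
    have h1 := hB1 (f.lin u)
    rw [hB, f.unlin_lin] at h1
    exact f.linEquiv.injective h1
  · rw [← hB, hexp, h10]
    refine Prod.ext ?_ ?_ <;> simp [h01]
    ring

end SquareTiled

/-! ### Dehn multitwists on the cylinders -/

namespace TorusCover

variable {X : Type} [TopologicalSpace X] {p : X → FlatTorus}

/-- The open rectangle around the segment of height `j` in the boundary of the strip. -/
def window (j : ℝ) : Set (ℝ × ℝ) := Set.Ioo (0 : ℝ) 1 ×ˢ Set.Ioo (j - 1) (j + 1)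

theorem isOpen_window (j : ℝ) : IsOpen (window j) := isOpen_Ioo.prod isOpen_Ioo

theorem convex_window (j : ℝ) : Convex ℝ (window j) := (convex_Ioo _ _).prod (convex_Ioo _ _)

theorem toTorus_ne_zero_of_mem_window {j : ℝ} {e : ℝ × ℝ} (he : e ∈ window j) :
    toTorus e ≠ 0 := fun h => coe_ne_zero_of_mem_Ioo he.1 (congrArg Prod.fst h)

theorem IsStripLift.exists_window (hp : IsCoveringMapOn p {0}ᶜ) {D : ℝ × ℝ → X}
    (hD : IsStripLift p D) {j : ℝ} (hj : j = 0 ∨ j = 1) :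
    ∃ F, ContinuousOn F (window j) ∧ (∀ e ∈ window j, p (F e) = toTorus e) ∧
      ∀ e ∈ window j, e ∈ strip → F e = D e := by
  have hm : ((1 / 2, 1 / 2) : ℝ × ℝ) ∈ window j := by
    refine ⟨by norm_num, ?_⟩
    rcases hj with rfl | rfl <;> constructor <;> norm_num
  have hs : ((1 / 2, 1 / 2) : ℝ × ℝ) ∈ strip := by constructor <;> norm_num
  obtain ⟨F, hF, hFa, hFp⟩ := exists_lift hp (convex_window j) (isOpen_window j)
    continuous_toTorus.continuousOn (fun e he => toTorus_ne_zero_of_mem_window he) hm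
    (hD.proj_eq _ hs)
  refine ⟨F, hF, hFp, fun e he hes => ?_⟩
  refine eqOn_of_lift hp ((convex_window j).inter convex_strip).isPreconnected
    (hF.mono Set.inter_subset_left) (hD.continuousOn.mono Set.inter_subset_right) ?_ ?_
    ⟨hm, hs⟩ hFa ⟨he, hes⟩
  · intro e he
    rw [hFp e he.1, hD.proj_eq e he.2]
  · intro e he
    rw [hFp e he.1]
    exact toTorus_ne_zero_of_mem_window he.1

end TorusCover

namespace SquareTiled

open TorusCover

variable {S : Type} [Finite S] {h v : Equiv.Perm S} {θ : ℤ × ℤ}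

/-- In the strip `T` is a lift of the shear `(x, y) ↦ (x + κ y, y)` up to translation. The
translation is determined by the fixed boundary line of height `j`, which is reached by continuing
the strip through the interior of a boundary segment. -/
theorem IsAffineWith.twist_strip (f : Frame θ) {T : SquareTiled h v ≃ₜ SquareTiled h v}
    {A : (ℝ × ℝ) →ₗ[ℝ] (ℝ × ℝ)} (hT : IsAffineWith T A) {κ : ℝ}
    (hκ : ∀ u, f.lin (A (f.unlin u)) = (u.1 + κ * u.2, u.2))
    (hfix : ∀ x, (f.proj x).2 = 0 → T x = x) {D : ℝ × ℝ → SquareTiled h v}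
    (hD : IsStripLift f.proj D) {j : ℝ} (hj : j = 0 ∨ j = 1) {e : ℝ × ℝ} (he : e ∈ strip) :
    T (D e) = D (e.1 + κ * (e.2 - j), e.2) := by
  have hp := f.isCoveringMapOn_proj (h := h) (v := v)
  have hj0 : (j : UnitAddCircle) = 0 := by
    rcases hj with rfl | rfl
    · rfl
    · exact AddCircle.coe_period 1
  obtain ⟨F, hF, hFp, hFD⟩ := hD.exists_window hp hj
  have hb : ((1 / 2, j) : ℝ × ℝ) ∈ window j := by
    refine ⟨by norm_num, ?_⟩
    constructor <;> simp
  have hTb : T (F (1 / 2, j)) = F (1 / 2, j) := hfix _ (by rw [hFp _ hb]; exact hj0)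
  -- the developed image of `T`
  have hdev : ∀ {K : Set (ℝ × ℝ)}, Convex ℝ K → ∀ {G : ℝ × ℝ → SquareTiled h v},
      ContinuousOn G K → (∀ e ∈ K, f.proj (G e) = toTorus e) → ∀ a ∈ K, ∀ e ∈ K,
      f.proj (T (G e)) - toTorus (e.1 + κ * e.2, e.2) =
        f.proj (T (G a)) - toTorus (a.1 + κ * a.2, a.2) := by
    intro K hK G hG hGp a ha e he
    have h1 := hT.proj_along hK.isPreconnected hG (u := f.unlin)
      (f.linEquiv.symm : (ℝ × ℝ) →ₗ[ℝ] (ℝ × ℝ)).continuous_of_finiteDimensional.continuousOn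
      (fun e he => f.torusMap.injective (by
        rw [f.torusMap_toTorus, f.lin_unlin]; exact hGp e he)) ha he
    have h2 : ∀ b b', f.torusMap (b - b') = f.torusMap b - f.torusMap b' := fun b b' => by
      rw [eq_sub_iff_add_eq, ← f.torusMap_add, sub_add_cancel]
    have h3 := congrArg f.torusMap h1
    rw [h2, h2, f.torusMap_toTorus, f.torusMap_toTorus, hκ, hκ] at h3
    exact h3
  have hjI : j ∈ closure (Set.Ioo (0 : ℝ) 1) := by
    rw [closure_Ioo zero_ne_one]
    rcases hj with rfl | rfl <;> simp
  have hne := mem_closure_iff_nhdsWithin_neBot.1 hjI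
  have hwin : ∀ u ∈ Set.Ioo (0 : ℝ) 1, ((1 / 2, u) : ℝ × ℝ) ∈ window j := by
    intro u hu
    refine ⟨by norm_num, ?_⟩
    rcases hj with rfl | rfl <;> constructor <;> simp <;> linarith [hu.1, hu.2]
  have hproj : ∀ e ∈ strip, f.proj (T (D e)) = toTorus (e.1 + κ * (e.2 - j), e.2) := by
    intro e he
    have hs : ((1 / 2, 1 / 2) : ℝ × ℝ) ∈ strip := by constructor <;> norm_num
    have h1 := hdev convex_strip hD.continuousOn hD.proj_eq _ hs e he
    have h2 := hdev (convex_window j) hF hFp _ hb _ (hwin _ hs)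
    rw [hFD _ (hwin _ hs) hs, hTb, hFp _ hb] at h2
    rw [h2, ← toTorus_sub, sub_eq_iff_eq_add, ← toTorus_add] at h1
    rw [h1]
    refine congrArg toTorus (Prod.ext ?_ ?_)
    · simp
      ring
    · simp
  have hmap : Set.MapsTo (fun e : ℝ × ℝ => (e.1 + κ * (e.2 - j), e.2)) strip strip :=
    fun e he => he
  -- The two maps have equal projections and both tend to `F (1/2, j)`. This is not a branch point,
  -- so local injectivity of the projection makes them agree at one point of the strip, hence
  -- everywhere by unique lifting.
  have hclose : ∃ u ∈ Set.Ioo (0 : ℝ) 1, T (D (1 / 2, u)) = D (1 / 2 + κ * (u - j), u) := by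
    obtain ⟨U, hU, hinj⟩ := exists_injOn hp (x := F (1 / 2, j))
      (by rw [hFp _ hb]; exact toTorus_ne_zero_of_mem_window hb)
    have hFc : ContinuousAt F (1 / 2, j) := hF.continuousAt ((isOpen_window j).mem_nhds hb)
    have ht1 : Tendsto (fun u : ℝ => T (F (1 / 2, u))) (𝓝 j) (𝓝 (F (1 / 2, j))) := by
      have h1 : Tendsto (fun u : ℝ => ((1 / 2, u) : ℝ × ℝ)) (𝓝 j) (𝓝 (1 / 2, j)) :=
        Continuous.tendsto (by fun_prop) j
      have h2 := (T.continuous.tendsto _).comp (hFc.tendsto.comp h1)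
      rw [hTb] at h2
      exact h2
    have hc2 : Continuous fun u : ℝ => ((1 / 2 + κ * (u - j), u) : ℝ × ℝ) := by fun_prop
    have ht0 : Tendsto (fun u : ℝ => ((1 / 2 + κ * (u - j), u) : ℝ × ℝ)) (𝓝 j)
        (𝓝 (1 / 2, j)) := by simpa using hc2.tendsto j
    have ht2 := hFc.tendsto.comp ht0
    have hev : ∀ᶠ u in 𝓝[Set.Ioo (0 : ℝ) 1] j, u ∈ Set.Ioo (0 : ℝ) 1 ∧ T (F (1 / 2, u)) ∈ U ∧
        F (1 / 2 + κ * (u - j), u) ∈ U ∧ ((1 / 2 + κ * (u - j), u) : ℝ × ℝ) ∈ window j :=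
      eventually_mem_nhdsWithin.and (nhdsWithin_le_nhds ((ht1.eventually_mem hU).and
        ((ht2.eventually_mem hU).and (ht0.eventually_mem ((isOpen_window j).mem_nhds hb)))))
    obtain ⟨u, hu, hu1, hu2, hu3⟩ := hev.exists
    refine ⟨u, hu, ?_⟩
    rw [← hFD _ (hwin u hu) hu, ← hFD _ hu3 hu]
    refine hinj hu1 hu2 ?_
    rw [hFD _ (hwin u hu) hu, hproj _ hu, hFp _ hu3]
  obtain ⟨u, hu, hu'⟩ := hclose
  refine eqOn_of_lift hp convex_strip.isPreconnected (T.continuous.comp_continuousOn hD.continuousOn)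
    (hD.continuousOn.comp (by fun_prop) hmap) ?_ ?_ (a := (1 / 2, u)) hu hu' he
  · intro e he
    rw [Function.comp_apply, hproj e he]
    exact (hD.proj_eq _ (hmap he)).symm
  · intro e he
    rw [Function.comp_apply, hproj e he]
    exact toTorus_ne_zero_of_mem_strip (hmap he)

/-- A multitwist in coordinates on the cylinders. -/
structure IsTwist {ι : Type} (f : Frame θ) (n : ℤ) (D : ι → ℝ × ℝ → SquareTiled h v) (m : ℤ)
    (T : SquareTiled h v ≃ₜ SquareTiled h v) : Prop where
  chart : IsCylinderChart f.proj n D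
  ne_zero : m ≠ 0
  fixed : ∀ x, (f.proj x).2 = 0 → T x = x
  apply : ∀ {D'}, IsStripLift f.proj D' → ∀ {e}, e ∈ strip →
    T (D' e) = D' (e.1 + m * n * e.2, e.2)

/-- The boundary lines `0` and `1` are both fixed. The resulting expressions for `T` differ by a
translation by `κ`, which must be a multiple of the circumference `n`. As `κ` and `n` are common to
all cylinders, so is the number of turns. -/
theorem IsDehnMultitwist.isTwist (hs : ∀ x : SquareTiled h v, proj x = 0 → IsSingular x)
    (f : Frame θ) {ι : Type} [Nonempty ι] {n : ℤ} {D : ι → ℝ × ℝ → SquareTiled h v}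
    (hD : IsCylinderChart f.proj n D) {T : SquareTiled h v ≃ₜ SquareTiled h v}
    (hT : IsDehnMultitwist θ T) : ∃ m : ℤ, IsTwist f n D m T := by
  obtain ⟨⟨A, hdet, hA1, hAθ, hTA⟩, hfix⟩ := hT
  obtain ⟨κ, hκ0, hκ⟩ := exists_shear f hdet hA1 hAθ
  have hfix' : ∀ x, (f.proj x).2 = 0 → T x = x := fun x hx =>
    hfix x fun h0 => (mem_cylinderSet_iff hs f).1 h0 hx
  obtain ⟨g⟩ := ‹Nonempty ι›
  have he : ((1 / 2, 1 / 2) : ℝ × ℝ) ∈ strip := by constructor <;> norm_num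
  have h0 := hTA.twist_strip f hκ hfix' (hD.lift g) (Or.inl rfl) he
  rw [hTA.twist_strip f hκ hfix' (hD.lift g) (Or.inr rfl) he] at h0
  obtain ⟨-, -, m, hm⟩ := hD.inj g g (1 / 2 + κ * (1 / 2 - 1), 1 / 2) he (1 / 2 + κ * (1 / 2 - 0), 1 / 2) he h0
  have hm' : κ = (-m : ℤ) * n := by push_cast; simp only at hm; linarith
  refine ⟨-m, hD, ?_, hfix', fun {D'} hD' {e} he => ?_⟩
  · rintro hm0
    rw [hm0] at hm'
    exact hκ0 (by simpa using hm')
  · rw [hTA.twist_strip f hκ hfix' hD' (Or.inl rfl) he, sub_zero, hm']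

/-- An automorphism maps strip lifts to strip lifts, and the formula for `T` is the same for every
strip lift; this is why `IsTwist.apply` is stated for an arbitrary `D'`. -/
theorem IsDehnMultitwist.mem_affStar (hs : ∀ x : SquareTiled h v, proj x = 0 → IsSingular x)
    {f : Frame θ} {ι : Type} {n m : ℤ} {D : ι → ℝ × ℝ → SquareTiled h v}
    {T : SquareTiled h v ≃ₜ SquareTiled h v} (hT : IsDehnMultitwist θ T)
    (hT' : IsTwist f n D m T) : T ∈ SquareTiled.AffStar h v := by
  obtain ⟨⟨A, hdet, -, -, hTA⟩, -⟩ := hT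
  refine ⟨⟨A, hdet ▸ one_pos, hTA⟩, Subgroup.mem_centralizer_iff.2 fun φ hφ => ?_⟩
  have hφp : ∀ x, f.proj (φ x) = f.proj x := fun x => congrArg f.torusMap (proj_aut hs hφ x)
  refine Homeomorph.ext fun x => ?_
  change φ (T x) = T (φ x)
  by_cases hx : (f.proj x).2 = 0
  · rw [hT'.fixed x hx, hT'.fixed _ (by rw [hφp, hx])]
  · obtain ⟨g, e, he, rfl⟩ := hT'.chart.cover x hx
    have hlift : IsStripLift f.proj (fun e => φ (D g e)) :=
      ⟨φ.continuous.comp_continuousOn (hT'.chart.lift g).continuousOn, fun e he => by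
        rw [hφp, (hT'.chart.lift g).proj_eq e he]⟩
    rw [hT'.apply (hT'.chart.lift g) he, hT'.apply hlift he]

end SquareTiled

/-! ### Heights in the cylinders and the action of a multitwist -/

namespace PathMod

variable {X : Type} [TopologicalSpace X] {E : Type} [AddCommGroup E] [Module ℝ E]

theorem seg_eq_zero_of_const {F : E → X} {A B : E} (x : X)
    (h : ∀ t ∈ Set.Icc (0 : ℝ) 1, F ((1 - t) • A + t • B) = x) : seg F A B = 0 := by
  rw [seg_congr (G := fun _ : ℝ => x) (A' := 0) (B' := 0) h]
  exact seg_self convex_univ continuousOn_const (Set.mem_univ _)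

end PathMod

namespace TorusCover

variable {X : Type} [TopologicalSpace X] {p : X → FlatTorus}

theorem comb_mk (t a b a' b' : ℝ) : (1 - t) • ((a, b) : ℝ × ℝ) + t • ((a', b') : ℝ × ℝ) =
    (a + t * (a' - a), b + t * (b' - b)) := by
  refine Prod.ext ?_ ?_ <;> simp <;> ring

open PathMod

/-- Translation by the period identifies the two transverse sides of a parallelogram in the strip,
so its other two sides have the same class. -/
theorem IsStripLift.seg_shift {D : ℝ × ℝ → X} (hD : IsStripLift p D) {N : ℝ}
    (hN : ∀ e ∈ strip, D (e.1 + N, e.2) = D e) {e e' : ℝ × ℝ} (he : e ∈ strip) (he' : e' ∈ strip) :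
    seg D e (e.1 + N, e.2) = seg D e' (e'.1 + N, e'.2) := by
  have h {x y z : ℝ × ℝ} (hx : x ∈ strip) (hy : y ∈ strip) (hz : z ∈ strip) :
      seg D x y + seg D y z = seg D x z := seg_add_seg convex_strip hD.continuousOn hx hy hz
  have hN1 : (e.1 + N, e.2) ∈ strip := he
  have hN2 : (e'.1 + N, e'.2) ∈ strip := he'
  have h1 : seg D (e.1 + N, e.2) (e'.1 + N, e'.2) = seg D e e' := by
    refine seg_congr fun t ht => ?_
    have hm : (1 - t) • e + t • e' ∈ strip :=
      convex_strip he he' (by linarith [ht.2]) ht.1 (by ring)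
    rw [← hN _ hm]
    congr 1
    refine Prod.ext ?_ ?_ <;> simp
    ring
  have h2 := h he he' hN2
  have h3 := h he hN1 hN2
  rw [h1] at h3
  rw [← h2, add_comm] at h3
  exact add_left_cancel h3

end TorusCover

namespace IsCylinderChart

open TorusCover PathMod

variable {X ι : Type} [TopologicalSpace X] {p : X → FlatTorus} {n : ℤ} {D : ι → ℝ × ℝ → X}

theorem seg_turns (hD : IsCylinderChart p n D) (g : ι) (m : ℤ) {e e' : ℝ × ℝ} (he : e ∈ strip)
    (he' : e' ∈ strip) :
    seg (D g) e (e.1 + m * n, e.2) = (m : ℝ) • seg (D g) e' (e'.1 + n, e'.2) := by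
  have hper : ∀ e ∈ strip, D g (e.1 + n, e.2) = D g e := fun e he => by
    simpa using hD.periodic g e he 1
  have h {x y z : ℝ × ℝ} (hx : x ∈ strip) (hy : y ∈ strip) (hz : z ∈ strip) :
      seg (D g) x y + seg (D g) y z = seg (D g) x z :=
    seg_add_seg convex_strip (hD.lift g).continuousOn hx hy hz
  have hstep : ∀ k : ℤ, seg (D g) e (e.1 + ((k + 1 : ℤ) : ℝ) * n, e.2) =
      seg (D g) e (e.1 + k * n, e.2) + seg (D g) e' (e'.1 + n, e'.2) := by
    intro k
    have hk : (e.1 + k * n, e.2) ∈ strip := he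
    rw [← (hD.lift g).seg_shift hper hk he', h he hk (z := (e.1 + k * n + n, e.2)) he]
    congr 2
    push_cast
    ring
  induction m using Int.induction_on with
  | zero => simpa using seg_self convex_strip (hD.lift g).continuousOn he
  | succ i ih => rw [hstep, ih]; push_cast; rw [add_smul, one_smul]
  | pred i ih =>
    have h1 := hstep (-i - 1)
    rw [sub_add_cancel, ih] at h1
    rw [← sub_eq_iff_eq_add] at h1
    rw [← h1]
    push_cast
    rw [sub_smul, one_smul]

open scoped Classical in
/-- The height in the cylinder `g`, as a map to the circle that collapses the complement of
the cylinder. -/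
def height (hp : IsCoveringMapOn p {0}ᶜ) (hpc : Continuous p) (hD : IsCylinderChart p n D) (g : ι) :
    C(X, UnitAddCircle) where
  toFun x := if x ∈ D g '' strip then (p x).2 else 0
  continuous_toFun := by
    have hp2 : Continuous fun x => (p x).2 := continuous_snd.comp hpc
    rw [continuous_iff_continuousAt]
    intro x
    by_cases hx : (p x).2 = 0
    · have h0 : (if x ∈ D g '' strip then (p x).2 else 0) = 0 := by simp [hx]
      rw [ContinuousAt, h0]
      -- On the boundary of the cylinders the height is continuous because its norm is at most that
      -- of the second coordinate of `p`.
      refine squeeze_zero_norm (a := fun y => ‖(p y).2‖) (fun y => ?_) ?_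
      · split_ifs <;> simp
      · have h1 := hp2.norm.tendsto x
        rw [hx, norm_zero] at h1
        exact h1
    · obtain ⟨g', e, he, rfl⟩ := hD.cover x hx
      have hU : D g' '' strip ∈ 𝓝 (D g' e) :=
        ((hD.lift g').isOpen_image hp).mem_nhds (Set.mem_image_of_mem _ he)
      by_cases hg : g' = g
      · subst hg
        refine hp2.continuousAt.congr ?_
        filter_upwards [hU] with y hy
        rw [if_pos hy]
      · refine continuousAt_const.congr (f := fun _ => 0) ?_
        filter_upwards [hU] with y hy
        obtain ⟨e', he', rfl⟩ := hy
        rw [if_neg]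
        rintro ⟨e'', he'', h⟩
        exact hg (hD.inj _ _ _ he'' _ he' h).1.symm

variable (hp : IsCoveringMapOn p {0}ᶜ) (hpc : Continuous p) (hD : IsCylinderChart p n D)

theorem height_of_snd_eq_zero {x : X} (hx : (p x).2 = 0) (g : ι) :
    hD.height hp hpc g x = 0 := by
  classical
  change (if x ∈ D g '' strip then (p x).2 else 0) = 0
  simp [hx]

theorem height_self (g : ι) {e : ℝ × ℝ} (he : e ∈ strip) :
    hD.height hp hpc g (D g e) = (e.2 : UnitAddCircle) := by
  classical
  change (if D g e ∈ D g '' strip then (p (D g e)).2 else 0) = _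
  rw [if_pos (Set.mem_image_of_mem _ he), (hD.lift g).proj_eq e he]
  rfl

theorem height_of_ne {g g' : ι} (hg : g ≠ g') {e : ℝ × ℝ} (he : e ∈ strip) :
    hD.height hp hpc g (D g' e) = 0 := by
  classical
  change (if D g' e ∈ D g '' strip then (p (D g' e)).2 else 0) = _
  rw [if_neg]
  rintro ⟨e'', he'', h⟩
  exact hg (hD.inj _ _ _ he'' _ he h).1

/-- Along the path the height of the crossed cylinder lifts to the parameter `s`, which grows from
`0` to `1`; the other heights stay at the base point of the circle. -/
theorem deg_height_crossing [DecidableEq ι] (g g' : ι) {q : ℝ → X} (hq : Continuous q)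
    (hq0 : (p (q 0)).2 = 0) (hq1 : (p (q 1)).2 = 0) {φ : ℝ → ℝ}
    (h : ∀ s ∈ Set.Ioo (0 : ℝ) 1, q s = D g' (φ s, s)) :
    deg (hD.height hp hpc g) (seg q 0 1) = if g = g' then 1 else 0 := by
  have hcase : ∀ s ∈ Set.Icc (0 : ℝ) 1, s = 0 ∨ s = 1 ∨ s ∈ Set.Ioo (0 : ℝ) 1 := by
    rintro s ⟨h0, h1⟩
    rcases h0.eq_or_lt with h0 | h0
    · exact Or.inl h0.symm
    · rcases h1.eq_or_lt with h1 | h1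
      · exact Or.inr (Or.inl h1)
      · exact Or.inr (Or.inr ⟨h0, h1⟩)
  have h11 : ((1 : ℝ) : UnitAddCircle) = 0 := AddCircle.coe_period 1
  by_cases hg : g = g'
  · subst hg
    rw [deg_seg _ (convex_Icc (0 : ℝ) 1) hq.continuousOn (by simp) (by simp) (φ := id)
      continuousOn_id, if_pos rfl]
    · simp
    · intro s hs
      rcases hcase s hs with rfl | rfl | hs
      · rw [hD.height_of_snd_eq_zero hp hpc hq0]; rfl
      · rw [hD.height_of_snd_eq_zero hp hpc hq1]; exact h11
      · rw [h s hs, hD.height_self hp hpc g (show (φ s, s) ∈ strip from hs)]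
        rfl
  · rw [deg_seg _ (convex_Icc (0 : ℝ) 1) hq.continuousOn (by simp) (by simp) (φ := fun _ => 0)
      continuousOn_const, if_neg hg, sub_self]
    intro s hs
    rcases hcase s hs with rfl | rfl | hs
    · rw [hD.height_of_snd_eq_zero hp hpc hq0]; rfl
    · rw [hD.height_of_snd_eq_zero hp hpc hq1]; rfl
    · rw [h s hs, hD.height_of_ne hp hpc hg (show (φ s, s) ∈ strip from hs)]
      rfl

end IsCylinderChart

/-! ### The effect of a multitwist on paths and on closed geodesics. -/

namespace SquareTiled

open TorusCover PathMod

variable {S : Type} [Finite S] {h v : Equiv.Perm S} {θ : ℤ × ℤ} {f : Frame θ} {ι : Type}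
  {n m : ℤ} {D : ι → ℝ × ℝ → SquareTiled h v} {T : SquareTiled h v ≃ₜ SquareTiled h v}

/-- A family of shears of the path `q` with parameter `l`, pinned at the boundary height `j`. The
lift exists because, in the band of heights within `1` of `j`, its development can vanish only at
height `j`, where it agrees with `q`, which avoids the vertices. -/
theorem exists_lift_halfStrip {q : ℝ → SquareTiled h v} {x₀ α N : ℝ}
    (hqp : ∀ s, f.proj (q s) = toTorus (x₀ + α * s, s)) (hq0 : ∀ s, f.proj (q s) ≠ 0)
    {g : ι} (hD : IsCylinderChart f.proj n D) (hg : ∀ s ∈ Set.Ioo (0 : ℝ) 1,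
      q s = D g (x₀ + α * s, s)) {j : ℤ} (hj : j = 0 ∨ j = 1) (hq : Continuous q) :
    ∃ G : ℝ × ℝ → SquareTiled h v, ContinuousOn G (Set.univ ×ˢ Set.Ioo (j - 1 : ℝ) (j + 1)) ∧
      (∀ l, ∀ s ∈ Set.Ioo (0 : ℝ) 1, G (l, s) = D g (x₀ + α * s + l * (N * (s - j)), s)) ∧
      (∀ l, G (l, j) = q j) := by
  have hp := f.isCoveringMapOn_proj (h := h) (v := v)
  set K : Set (ℝ × ℝ) := Set.univ ×ˢ Set.Ioo (j - 1 : ℝ) (j + 1) with hK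
  have hKc : Convex ℝ K := convex_univ.prod (convex_Ioo _ _)
  have hKo : IsOpen K := isOpen_univ.prod isOpen_Ioo
  have hsub : ∀ s ∈ Set.Ioo (0 : ℝ) 1, s ∈ Set.Ioo (j - 1 : ℝ) (j + 1) := by
    intro s hs
    rcases hj with rfl | rfl <;> constructor <;> push_cast <;> linarith [hs.1, hs.2]
  set F : ℝ × ℝ → FlatTorus := fun e => toTorus (x₀ + α * e.2 + e.1 * (N * (e.2 - j)), e.2)
    with hF
  have hFc : Continuous F := continuous_toTorus.comp (by fun_prop)
  have hF0 : ∀ e ∈ K, F e ≠ 0 := by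
    rintro ⟨l, s⟩ ⟨-, hs⟩ h0
    obtain ⟨i, hi⟩ := coe_eq_zero_iff_int.1 (congrArg Prod.snd h0)
    simp only at hi hs
    have hij : i = j := by
      rw [hi] at hs
      have h1 : j - 1 < i := by exact_mod_cast hs.1
      have h2 : i < j + 1 := by exact_mod_cast hs.2
      omega
    subst hi hij
    refine hq0 i ?_
    rw [hqp, ← h0, hF]
    simp
  have hjK : ((0, (j : ℝ)) : ℝ × ℝ) ∈ K := ⟨Set.mem_univ _, by simp⟩
  obtain ⟨G, hG, hGa, hGp⟩ := exists_lift hp hKc hKo hFc.continuousOn hF0 hjK (x := q j)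
    (by rw [hqp, hF]; simp)
  have hline : ∀ l, G (l, j) = q j := by
    intro l
    refine eqOn_of_lift hp (isPreconnected_univ (α := ℝ)) (F := fun l => G (l, j))
      (G := fun _ => q j) ?_ continuousOn_const ?_ ?_ (Set.mem_univ 0) hGa (Set.mem_univ l)
    · exact hG.comp (by fun_prop) fun l _ => ⟨Set.mem_univ _, by simp⟩
    · intro l _
      rw [hGp _ ⟨Set.mem_univ _, by simp⟩, hqp, hF]
      simp
    · intro l _
      rw [hGp _ ⟨Set.mem_univ _, by simp⟩]
      exact hF0 _ ⟨Set.mem_univ _, by simp⟩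
  have hvert : ∀ s ∈ Set.Ioo (j - 1 : ℝ) (j + 1), G (0, s) = q s := by
    intro s hs
    refine eqOn_of_lift hp (convex_Ioo _ _).isPreconnected (F := fun s => G (0, s))
      (G := q) ?_ hq.continuousOn ?_ ?_ (a := (j : ℝ)) (by simp) hGa hs
    · exact hG.comp (by fun_prop) fun s hs => ⟨Set.mem_univ _, hs⟩
    · intro s hs
      rw [hGp _ ⟨Set.mem_univ _, hs⟩, hqp, hF]
      simp
    · intro s hs
      rw [hGp _ ⟨Set.mem_univ _, hs⟩]
      exact hF0 _ ⟨Set.mem_univ _, hs⟩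
  refine ⟨G, hG, fun l s hs => ?_, hline⟩
  have hs' : ∀ l : ℝ, (x₀ + α * s + l * (N * (s - j)), s) ∈ strip := fun _ => hs
  refine eqOn_of_lift hp (isPreconnected_univ (α := ℝ)) (F := fun l => G (l, s))
    (G := fun l => D g (x₀ + α * s + l * (N * (s - j)), s)) ?_ ?_ ?_ ?_ (Set.mem_univ 0) ?_
    (Set.mem_univ l)
  · exact hG.comp (by fun_prop) fun l _ => ⟨Set.mem_univ _, hsub s hs⟩
  · exact (hD.lift g).continuousOn.comp (by fun_prop) fun l _ => hs' l
  · intro l _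
    rw [hGp _ ⟨Set.mem_univ _, hsub s hs⟩, (hD.lift g).proj_eq _ (hs' l)]
  · intro l _
    rw [hGp _ ⟨Set.mem_univ _, hsub s hs⟩]
    exact hF0 _ ⟨Set.mem_univ _, hsub s hs⟩
  · simp only [zero_mul, add_zero]
    rw [hvert s (hsub s hs), hg s hs]

/-- The effect of a multitwist on a path that crosses one cylinder. -/
theorem IsTwist.map_crossing (hT : IsTwist f n D m T) {q : ℝ → SquareTiled h v} {x₀ α : ℝ}
    (hq : Continuous q) (hqp : ∀ s, f.proj (q s) = toTorus (x₀ + α * s, s))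
    (hq0 : ∀ s, f.proj (q s) ≠ 0) {g : ι}
    (hg : ∀ s ∈ Set.Ioo (0 : ℝ) 1, q s = D g (x₀ + α * s, s)) {e : ℝ × ℝ} (he : e ∈ strip) :
    map (T : C(SquareTiled h v, SquareTiled h v)) (seg q 0 1) - seg q 0 1 =
      (m : ℝ) • seg (D g) e (e.1 + n, e.2) := by
  have hD := hT.chart
  -- The lower half of `T ∘ q` is deformed to that of `q` with the bottom end fixed, the upper half
  -- with the top end fixed. At height `1/2` the deformations move the point by `m n / 2` in
  -- opposite directions; the gap closes up to `m` turns of the waist curve.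
  obtain ⟨G0, hG0c, hG0, hG0q⟩ := exists_lift_halfStrip (N := m * n) hqp hq0 hD hg (Or.inl rfl) hq
  obtain ⟨G1, hG1c, hG1, hG1q⟩ := exists_lift_halfStrip (N := m * n) hqp hq0 hD hg (Or.inr rfl) hq
  push_cast at hG0c hG0 hG0q hG1c hG1 hG1q
  have hK0 : Convex ℝ (Set.univ ×ˢ Set.Ioo ((0 : ℝ) - 1) (0 + 1) : Set (ℝ × ℝ)) :=
    convex_univ.prod (convex_Ioo _ _)
  have hK1 : Convex ℝ (Set.univ ×ˢ Set.Ioo ((1 : ℝ) - 1) (1 + 1) : Set (ℝ × ℝ)) :=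
    convex_univ.prod (convex_Ioo _ _)
  have hqT : map (T : C(SquareTiled h v, SquareTiled h v)) (seg q 0 1) =
      seg (fun s => T (q s)) 0 1 :=
    map_seg _ convex_univ hq.continuousOn (Set.mem_univ _) (Set.mem_univ _)
  have hcut {F : ℝ → SquareTiled h v} (hF : Continuous F) :
      seg F 0 1 = seg F 0 (1 / 2) + seg F (1 / 2) 1 :=
    (seg_add_seg convex_univ hF.continuousOn (Set.mem_univ _) (Set.mem_univ _)
      (Set.mem_univ _)).symm
  have hTfix : ∀ i : ℤ, T (q i) = q i := fun i => hT.fixed _ (by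
    rw [hqp]; exact coe_eq_zero_iff_int.2 ⟨i, rfl⟩)
  have hTq : ∀ s ∈ Set.Ioo (0 : ℝ) 1, T (q s) = D g (x₀ + α * s + m * n * s, s) := fun s hs => by
    rw [hg s hs, hT.apply (hD.lift g) (show _ ∈ strip from hs)]
  have hlow (l : ℝ) (F : ℝ → SquareTiled h v) (hF0 : F 0 = q 0)
      (hF : ∀ s ∈ Set.Ioo (0 : ℝ) 1, F s = D g (x₀ + α * s + l * (m * n * s), s)) :
      seg F 0 (1 / 2) = seg G0 (l, 0) (l, 1 / 2) := by
    refine seg_congr fun t ht => ?_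
    rw [comb_mk]
    simp only [smul_eq_mul, mul_zero, zero_add, sub_self, add_zero, sub_zero]
    rcases ht.1.eq_or_lt with rfl | h0
    · rw [zero_mul, hG0q, hF0]
    · have hs : t * (1 / 2) ∈ Set.Ioo (0 : ℝ) 1 := ⟨by linarith, by linarith [ht.2]⟩
      rw [hF _ hs, hG0 l _ hs, sub_zero]
  -- For `F = T ∘ q` the hypothesis uses periodicity: the shears `m n s` and `m n (s - 1)` agree on
  -- the cylinder.
  have hupp (l : ℝ) (F : ℝ → SquareTiled h v) (hF0 : F 1 = q 1)
      (hF : ∀ s ∈ Set.Ioo (0 : ℝ) 1, F s = D g (x₀ + α * s + l * (m * n * (s - 1)), s)) :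
      seg F (1 / 2) 1 = seg G1 (l, 1 / 2) (l, 1) := by
    refine seg_congr fun t ht => ?_
    rw [comb_mk]
    have e1 : (1 - t) • (1 / 2 : ℝ) + t • (1 : ℝ) = 1 / 2 + t * (1 - 1 / 2) := by
      simp only [smul_eq_mul]; ring
    rw [e1, sub_self, mul_zero, add_zero]
    rcases ht.2.eq_or_lt with rfl | h0
    · rw [one_mul, add_sub_cancel, hG1q, hF0]
    · have hs : 1 / 2 + t * (1 - 1 / 2) ∈ Set.Ioo (0 : ℝ) 1 := ⟨by linarith [ht.1], by linarith⟩
      rw [hF _ hs, hG1 l _ hs]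
  have hTc : Continuous fun s => T (q s) := T.continuous.comp hq
  rw [hqT, hcut hTc, hcut hq,
    hlow 1 _ (by simpa using hTfix 0) (fun s hs => by rw [hTq s hs, one_mul]),
    hlow 0 q rfl (fun s hs => by rw [hg s hs]; simp),
    hupp 1 _ (by simpa using hTfix 1) (fun s hs => by
      have h1 := hD.periodic g (x₀ + α * s + 1 * (m * n * (s - 1)), s) hs m
      rw [hTq s hs, ← h1]
      congr 2
      ring),
    hupp 0 q rfl (fun s hs => by rw [hg s hs]; simp)]
  have hm0 : ∀ l : ℝ, ∀ s ∈ Set.Ico (0 : ℝ) 1,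
      ((l, s) : ℝ × ℝ) ∈ (Set.univ ×ˢ Set.Ioo ((0 : ℝ) - 1) (0 + 1) : Set (ℝ × ℝ)) :=
    fun l s hs => ⟨Set.mem_univ _, by linarith [hs.1], by linarith [hs.2]⟩
  have hm1 : ∀ l : ℝ, ∀ s ∈ Set.Ioc (0 : ℝ) 1,
      ((l, s) : ℝ × ℝ) ∈ (Set.univ ×ˢ Set.Ioo ((1 : ℝ) - 1) (1 + 1) : Set (ℝ × ℝ)) :=
    fun l s hs => ⟨Set.mem_univ _, by linarith [hs.1], by linarith [hs.2]⟩
  have hz0 : seg G0 (1, 0) (0, 0) = 0 := seg_eq_zero_of_const (q 0) fun t _ => by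
    rw [comb_mk, sub_zero, mul_zero, add_zero, hG0q]
  have hz1 : seg G1 (1, 1) (0, 1) = 0 := seg_eq_zero_of_const (q 1) fun t _ => by
    rw [comb_mk, sub_self, mul_zero, add_zero, hG1q]
  have hhalf : (1 / 2 : ℝ) ∈ Set.Ioo (0 : ℝ) 1 := by constructor <;> norm_num
  have hhor0 : seg G0 (0, 1 / 2) (1, 1 / 2) = seg (D g) (x₀ + α * (1 / 2), 1 / 2)
      (x₀ + α * (1 / 2) + m * n * (1 / 2), 1 / 2) := by
    refine seg_congr fun t _ => ?_
    rw [comb_mk, comb_mk, sub_self, mul_zero, add_zero, hG0 _ _ hhalf]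
    congr 2
    ring
  have hhor1 : seg G1 (0, 1 / 2) (1, 1 / 2) = seg (D g) (x₀ + α * (1 / 2), 1 / 2)
      (x₀ + α * (1 / 2) - m * n * (1 / 2), 1 / 2) := by
    refine seg_congr fun t _ => ?_
    rw [comb_mk, comb_mk, sub_self, mul_zero, add_zero, hG1 _ _ hhalf]
    congr 2
    ring
  have i0 : (0 : ℝ) ∈ Set.Ico (0 : ℝ) 1 := by simp
  have ih0 : (1 / 2 : ℝ) ∈ Set.Ico (0 : ℝ) 1 := ⟨by norm_num, by norm_num⟩
  have i1 : (1 : ℝ) ∈ Set.Ioc (0 : ℝ) 1 := by simp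
  have ih1 : (1 / 2 : ℝ) ∈ Set.Ioc (0 : ℝ) 1 := ⟨by norm_num, by norm_num⟩
  have e0 : seg G0 (1, 0) (1, 1 / 2) = seg G0 (0, 0) (0, 1 / 2) + seg G0 (0, 1 / 2) (1, 1 / 2) := by
    rw [seg_add_seg hK0 hG0c (hm0 0 0 i0) (hm0 0 _ ih0) (hm0 1 _ ih0),
      ← seg_add_seg hK0 hG0c (hm0 1 0 i0) (hm0 0 0 i0) (hm0 1 _ ih0), hz0, zero_add]
  have e1 : seg G1 (1, 1 / 2) (1, 1) = seg G1 (0, 1 / 2) (0, 1) - seg G1 (0, 1 / 2) (1, 1 / 2) := by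
    rw [eq_sub_iff_add_eq, add_comm, seg_add_seg hK1 hG1c (hm1 0 _ ih1) (hm1 1 _ ih1) (hm1 1 _ i1),
      ← seg_add_seg hK1 hG1c (hm1 0 _ ih1) (hm1 1 _ i1) (hm1 0 _ i1), hz1, add_zero]
  have hstr : ∀ y : ℝ, ((y, 1 / 2) : ℝ × ℝ) ∈ strip := fun y => hhalf
  have efin := hD.seg_turns g m (e := (x₀ + α * (1 / 2) - m * n * (1 / 2), 1 / 2)) (hstr _) he
  rw [e0, e1, hhor0, hhor1, ← efin]
  have s1 := seg_symm convex_strip (hD.lift g).continuousOn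
    (hstr (x₀ + α * (1 / 2))) (hstr (x₀ + α * (1 / 2) - m * n * (1 / 2)))
  have s2 := seg_add_seg convex_strip (hD.lift g).continuousOn
    (hstr (x₀ + α * (1 / 2) - m * n * (1 / 2))) (hstr (x₀ + α * (1 / 2)))
    (hstr (x₀ + α * (1 / 2) - m * n * (1 / 2) + m * n))
  have s3 : x₀ + α * (1 / 2) + m * n * (1 / 2) = x₀ + α * (1 / 2) - m * n * (1 / 2) + m * n := by
    ring
  simp only
  rw [← s2, s1, s3]
  abel

theorem IsTwist.map_unit (hpD : IsTwist f n D m T) [Fintype ι] {q : ℝ → SquareTiled h v}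
    {x₀ α : ℝ} (hq : Continuous q) (hqp : ∀ s, f.proj (q s) = toTorus (x₀ + α * s, s))
    (hq0 : ∀ s, f.proj (q s) ≠ 0) {w : ι → ℝ × ℝ} (hw : ∀ g, w g ∈ strip) :
    map (T : C(SquareTiled h v, SquareTiled h v)) (seg q 0 1) - seg q 0 1 =
      (m : ℝ) • ∑ g, deg (hpD.chart.height f.isCoveringMapOn_proj f.continuous_proj g) (seg q 0 1) •
        seg (D g) (w g) ((w g).1 + n, (w g).2) := by
  classical
  have hp := f.isCoveringMapOn_proj (h := h) (v := v)
  have hhalf : (1 / 2 : ℝ) ∈ Set.Ioo (0 : ℝ) 1 := by constructor <;> norm_num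
  -- Between two consecutive boundary heights the path stays in one cylinder, found at half height.
  -- Changing `x₀` by an integer aligns the path with the chart.
  obtain ⟨g, e, he, hge⟩ := hpD.chart.cover (q (1 / 2)) (by
    rw [hqp]; exact coe_ne_zero_of_mem_Ioo hhalf)
  have h1 : toTorus e = toTorus (x₀ + α * (1 / 2), 1 / 2) := by
    rw [← hqp, ← hge, (hpD.chart.lift g).proj_eq e he]
  have h2 : e.2 = 1 / 2 := coe_eq_coe_of_mem_Ioo he hhalf (congrArg Prod.snd h1)
  obtain ⟨k, hk⟩ := coe_eq_coe_iff_int.1 (congrArg Prod.fst h1)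
  simp only at hk
  have hqp' : ∀ s, f.proj (q s) = toTorus (x₀ + k + α * s, s) := fun s => by
    rw [hqp]
    exact Prod.ext (coe_eq_coe_iff_int.2 ⟨-k, by push_cast; ring⟩) rfl
  have hg : ∀ s ∈ Set.Ioo (0 : ℝ) 1, q s = D g (x₀ + k + α * s, s) := by
    intro s hs
    refine eqOn_of_lift hp (convex_Ioo (0 : ℝ) 1).isPreconnected (F := q)
      (G := fun s => D g (x₀ + k + α * s, s)) hq.continuousOn ?_ ?_ (fun s _ => hq0 s) hhalf ?_ hs
    · exact (hpD.chart.lift g).continuousOn.comp (by fun_prop) fun s hs => hs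
    · intro s hs
      rw [hqp', (hpD.chart.lift g).proj_eq _ (show _ ∈ strip from hs)]
    · rw [← hge]
      congr 1
      refine Prod.ext ?_ h2
      simp only
      linarith
  have hend : ∀ i : ℤ, (f.proj (q i)).2 = 0 := fun i => by
    rw [hqp]; exact coe_eq_zero_iff_int.2 ⟨i, rfl⟩
  rw [hpD.map_crossing hq hqp' hq0 hg (hw g)]
  congr 1
  rw [Finset.sum_eq_single g]
  · rw [hpD.chart.deg_height_crossing hp f.continuous_proj g g hq (by simpa using hend 0)
      (by simpa using hend 1) hg, if_pos rfl, one_smul]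
  · intro g' _ hg'
    rw [hpD.chart.deg_height_crossing hp f.continuous_proj g' g hq (by simpa using hend 0)
      (by simpa using hend 1) hg, if_neg hg', zero_smul]
  · simp

/-- Both sides are additive in the path, which is cut at integral heights. -/
theorem IsTwist.map_line (hpD : IsTwist f n D m T) [Fintype ι] {q : ℝ → SquareTiled h v}
    {x₀ α : ℝ} (hq : Continuous q) (hqp : ∀ s, f.proj (q s) = toTorus (x₀ + α * s, s))
    (hq0 : ∀ s, f.proj (q s) ≠ 0) {w : ι → ℝ × ℝ} (hw : ∀ g, w g ∈ strip) (b : ℤ) :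
    map (T : C(SquareTiled h v, SquareTiled h v)) (seg q 0 b) - seg q 0 b =
      (m : ℝ) • ∑ g, deg (hpD.chart.height f.isCoveringMapOn_proj f.continuous_proj g) (seg q 0 b) •
        seg (D g) (w g) ((w g).1 + n, (w g).2) := by
  let N : PathMod (SquareTiled h v) →ₗ[ℝ] PathMod (SquareTiled h v) :=
    PathMod.map (T : C(SquareTiled h v, SquareTiled h v)) - LinearMap.id - (m : ℝ) • ∑ g,
      (deg (hpD.chart.height f.isCoveringMapOn_proj f.continuous_proj g)).smulRight
        (seg (D g) (w g) ((w g).1 + n, (w g).2))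
  have hN : ∀ u, N u = map (T : C(SquareTiled h v, SquareTiled h v)) u - u -
      (m : ℝ) • ∑ g, deg (hpD.chart.height f.isCoveringMapOn_proj f.continuous_proj g) u •
        seg (D g) (w g) ((w g).1 + n, (w g).2) := fun u => by
    simp [N, LinearMap.sum_apply]
  have hunit : ∀ k : ℤ, N (seg q k ((k + 1 : ℤ) : ℝ)) = 0 := by
    intro k
    have h1 : seg q k ((k + 1 : ℤ) : ℝ) = seg (fun s => q (k + s)) 0 1 := by
      refine seg_congr fun t _ => ?_
      congr 1
      simp
      ring
    have h2 := hpD.map_unit (q := fun s => q (k + s)) (x₀ := x₀ + α * k) (α := α)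
      (hq.comp (by fun_prop)) (fun s => by
        rw [hqp]
        refine Prod.ext ?_ (coe_eq_coe_iff_int.2 ⟨k, add_sub_cancel_right _ _⟩)
        exact congrArg (fun x : ℝ => (x : UnitAddCircle)) (by ring))
      (fun s => hq0 _) hw
    rw [h1, hN, h2, sub_self]
  have hadd : ∀ k : ℤ, seg q 0 ((k + 1 : ℤ) : ℝ) = seg q 0 k + seg q k ((k + 1 : ℤ) : ℝ) :=
    fun k => (seg_add_seg convex_univ hq.continuousOn (Set.mem_univ _) (Set.mem_univ _)
      (Set.mem_univ _)).symm
  have hall : ∀ b : ℤ, N (seg q 0 b) = 0 := by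
    intro b
    induction b using Int.induction_on with
    | zero =>
      have h0 : seg q 0 ((0 : ℤ) : ℝ) = 0 := by
        simpa using seg_self convex_univ hq.continuousOn (Set.mem_univ 0)
      rw [h0, map_zero]
    | succ i ih => rw [hadd, map_add, ih, hunit, add_zero]
    | pred i ih =>
      have h1 := congrArg N (hadd (-i - 1))
      rw [map_add, hunit, add_zero, sub_add_cancel, ih] at h1
      exact h1.symm
  exact sub_eq_zero.1 ((hN _).symm.trans (hall b))

/-- The action of a multitwist on the class of a closed geodesic. -/
theorem IsTwist.map_closedGeodesic (hs : ∀ x : SquareTiled h v, proj x = 0 → IsSingular x)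
    (hpD : IsTwist f n D m T) [Fintype ι] {w : ι → ℝ × ℝ} (hw : ∀ g, w g ∈ strip)
    {η : ℤ × ℤ} {L : ℝ} {γ : C(UnitAddCircle, SquareTiled h v)} (hγ : IsClosedGeodesic η L γ) :
    map (T : C(SquareTiled h v, SquareTiled h v)) (ofH1 _ (loopClass γ)) - ofH1 _ (loopClass γ) =
      (m : ℝ) • ∑ g, deg (hpD.chart.height f.isCoveringMapOn_proj f.continuous_proj g)
        (ofH1 _ (loopClass γ)) • seg (D g) (w g) ((w g).1 + n, (w g).2) := by
  have hp := f.isCoveringMapOn_proj (h := h) (v := v)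
  rw [ofH1_loopClass]
  have hc : Continuous fun t : ℝ => γ (t : UnitAddCircle) :=
    γ.continuous.comp (AddCircle.continuous_mk' 1)
  have hγ0 : ∀ t, f.proj (γ t) ≠ 0 := fun t h0 => hγ.proj_ne_zero hs t (f.proj_eq_zero.1 h0)
  obtain ⟨a, b, hab⟩ := hγ.exists_int f
  have hγp := fun t => hγ.proj_frame f t
  simp only [hab] at hγp
  -- A geodesic parallel to the twist is fixed, or turned inside its cylinder, so its class does not
  -- change, and all heights are constant along it.
  by_cases hb : b = 0
  · subst hb
    have hγp2 : ∀ t : ℝ, (f.proj (γ t)).2 = (f.proj (γ 0)).2 := fun t => by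
      rw [hγp]; simp [toTorus]
    rw [map_seg _ convex_univ hc.continuousOn (Set.mem_univ _) (Set.mem_univ _)]
    by_cases h0 : (f.proj (γ 0)).2 = 0
    · have e1 : seg (fun t : ℝ => T (γ (t : UnitAddCircle))) 0 1 =
          seg (fun t : ℝ => γ (t : UnitAddCircle)) 0 1 :=
        seg_congr fun t _ => hpD.fixed _ ((hγp2 _).trans h0)
      have e2 : ∀ g, deg (hpD.chart.height hp f.continuous_proj g)
          (seg (fun t : ℝ => γ (t : UnitAddCircle)) 0 1) = 0 := fun g => by
        rw [deg_seg _ convex_univ hc.continuousOn (Set.mem_univ _) (Set.mem_univ _)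
          (φ := fun _ => 0) continuousOn_const, sub_self]
        intro t _
        rw [hpD.chart.height_of_snd_eq_zero hp f.continuous_proj ((hγp2 _).trans h0)]
        rfl
      simp only [e2, zero_smul, Finset.sum_const_zero, smul_zero]
      exact sub_eq_zero.2 e1
    · obtain ⟨g, e, he, hge⟩ := hpD.chart.cover _ h0
      have hmem : ∀ t : ℝ, (e.1 + a * t, e.2) ∈ strip := fun _ => he
      have hγD : ∀ t : ℝ, γ (t : UnitAddCircle) = D g (e.1 + a * t, e.2) := by
        intro t
        refine eqOn_of_lift hp isPreconnected_univ (F := fun t : ℝ => γ (t : UnitAddCircle))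
          (G := fun t => D g (e.1 + a * t, e.2)) hc.continuousOn ?_ ?_ (fun t _ => hγ0 _)
          (Set.mem_univ 0) ?_ (Set.mem_univ t)
        · exact (hpD.chart.lift g).continuousOn.comp (by fun_prop) fun t _ => hmem t
        · intro t _
          rw [hγp, ← hge, (hpD.chart.lift g).proj_eq e he, (hpD.chart.lift g).proj_eq _ (hmem t),
            ← toTorus_add]
          congr 1
          refine Prod.ext ?_ ?_ <;> simp
          ring
        · simp [hge]
      have hper : ∀ e ∈ strip, D g (e.1 + a, e.2) = D g e := by
        have h1 : D g (e.1 + a * 1, e.2) = D g e := by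
          rw [← hγD, hge]
          congr 1
          exact AddCircle.coe_period 1
        obtain ⟨-, j, hj, hj'⟩ := (hpD.chart.lift g).eq_of_meet hp (hpD.chart.lift g) (hmem 1) he h1
        intro e' he'
        rw [← hj' e' he', ← hj]
        simp
      have e1 : seg (fun t : ℝ => T (γ (t : UnitAddCircle))) 0 1 =
          seg (D g) (e.1 + m * n * e.2, e.2) (e.1 + m * n * e.2 + a, e.2) := by
        refine seg_congr fun t _ => ?_
        rw [hγD, hpD.apply (hpD.chart.lift g) (hmem _), comb_mk]
        congr 1
        refine Prod.ext ?_ ?_ <;> simp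
        ring
      have e1' : seg (fun t : ℝ => γ (t : UnitAddCircle)) 0 1 = seg (D g) e (e.1 + a, e.2) := by
        refine seg_congr fun t _ => ?_
        rw [hγD, show e = (e.1, e.2) from rfl, comb_mk]
        congr 1
        refine Prod.ext ?_ ?_ <;> simp
        ring
      have e2 : ∀ g', deg (hpD.chart.height hp f.continuous_proj g')
          (seg (fun t : ℝ => γ (t : UnitAddCircle)) 0 1) = 0 := fun g' => by
        obtain ⟨x, hx⟩ : ∃ x : ℝ, (x : UnitAddCircle) =
            hpD.chart.height hp f.continuous_proj g' (γ 0) := QuotientAddGroup.mk_surjective _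
        rw [deg_seg _ convex_univ hc.continuousOn (Set.mem_univ _) (Set.mem_univ _)
          (φ := fun _ => x) continuousOn_const, sub_self]
        intro t _
        rw [hx, hγD, ← hge]
        by_cases hgg : g' = g
        · subst hgg
          rw [hpD.chart.height_self hp _ _ he, hpD.chart.height_self hp _ _ (hmem t)]
        · rw [hpD.chart.height_of_ne hp _ hgg he, hpD.chart.height_of_ne hp _ hgg (hmem t)]
      simp only [e2, zero_smul, Finset.sum_const_zero, smul_zero]
      rw [sub_eq_zero, e1']
      refine e1.trans ?_
      exact (hpD.chart.lift g).seg_shift hper (e := (e.1 + m * n * e.2, e.2)) he he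
  -- A transverse geodesic is reparametrized by its height, starting at height `0`; it then crosses
  -- `|b|` cylinders, counted with repetition.
  · have hb' : (b : ℝ) ≠ 0 := by exact_mod_cast hb
    obtain ⟨y, hy⟩ := QuotientAddGroup.mk_surjective (f.proj (γ 0)).1
    obtain ⟨u, hu⟩ := QuotientAddGroup.mk_surjective (f.proj (γ 0)).2
    have hγ00 : f.proj (γ 0) = toTorus (y, u) := Prod.ext hy.symm hu.symm
    let q : ℝ → SquareTiled h v := fun s => γ ((-u / b + s / b : ℝ) : UnitAddCircle)
    have hqc : Continuous q := hc.comp (by fun_prop)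
    have hqp : ∀ s, f.proj (q s) = toTorus (y - u / b * a + a / b * s, s) := by
      intro s
      rw [hγp, hγ00, ← toTorus_add]
      congr 1
      refine Prod.ext ?_ ?_ <;> simp <;> field_simp <;> ring
    have hqγ : seg q 0 b = seg (fun t : ℝ => γ (t : UnitAddCircle)) 0 1 := by
      rw [← seg_add_one hc (fun t => by rw [AddCircle.coe_add_period]) (-u / b)]
      refine seg_congr fun t _ => ?_
      simp only [q]
      congr 2
      simp only [smul_eq_mul]
      field_simp
      ring
    rw [← hqγ]
    exact hpD.map_line hqc hqp (fun s => hγ0 _) hw b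

end SquareTiled

/-! ### Counting the crossings of a closed line with the sides of the squares -/

theorem exists_int_primitive {V : Type} [AddCommGroup V] (a : ℤ → V) :
    ∃ A : ℤ → V, (∀ i, A i - A (i - 1) = a i) ∧
      ∀ (k : ℤ) (m : ℕ), A (k + m) - A k = ∑ i ∈ Finset.Ioc k (k + m), a i := by
  have h1 : ∃ A : ℤ → V, ∀ i, A i - A (i - 1) = a i := by
    refine ⟨fun i => ∑ j ∈ Finset.Ioc 0 i, a j - ∑ j ∈ Finset.Ioc i 0, a j, fun i => ?_⟩
    rcases lt_or_ge 0 i with hi | hi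
    · have e1 : Finset.Ioc i 0 = ∅ := Finset.Ioc_eq_empty (by omega)
      have e2 : Finset.Ioc (i - 1) 0 = ∅ := Finset.Ioc_eq_empty (by omega)
      have e3 : Finset.Ioc 0 i = insert i (Finset.Ioc 0 (i - 1)) := by ext j; simp; omega
      simp only [e1, e2, e3]
      rw [Finset.sum_insert (by simp)]
      simp
    · have e1 : Finset.Ioc 0 i = ∅ := Finset.Ioc_eq_empty (by omega)
      have e2 : Finset.Ioc 0 (i - 1) = ∅ := Finset.Ioc_eq_empty (by omega)
      have e3 : Finset.Ioc (i - 1) 0 = insert i (Finset.Ioc i 0) := by ext j; simp; omega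
      simp only [e1, e2, e3]
      rw [Finset.sum_insert (by simp)]
      simp
  obtain ⟨A, hA⟩ := h1
  refine ⟨A, hA, fun k m => ?_⟩
  induction m with
  | zero => simp
  | succ m ih =>
    have e3 : Finset.Ioc k (k + (m + 1 : ℕ)) = insert (k + m + 1) (Finset.Ioc k (k + m)) := by
      ext j; simp; omega
    rw [e3, Finset.sum_insert (by simp), ← ih, ← hA (k + m + 1)]
    push_cast
    rw [add_sub_cancel_right, ← add_assoc]
    abel

/-- In one period the coordinate `x₀ + M t` takes `|M|` integral values modulo `M`. They correspond
bijectively to the points where the curve meets the sides. -/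
theorem sum_crossings {S V X : Type} [Fintype S] [AddCommGroup V] [Module ℝ V] (R : S → V)
    {γ : ℝ → X} (hγ : ∀ t t', γ t = γ t' ↔ ∃ m : ℤ, t - t' = m) {M : ℤ} (hM : M ≠ 0) (x₀ : ℝ)
    {E : S → ℝ → X} (hE : ∀ s s', ∀ τ ∈ Set.Ioo (0 : ℝ) 1, ∀ τ' ∈ Set.Ioo (0 : ℝ) 1,
      E s τ = E s' τ' → s = s' ∧ τ = τ')
    (hmeet : ∀ t, (∃ s, ∃ τ ∈ Set.Ioo (0 : ℝ) 1, γ t = E s τ) → ∃ i : ℤ, x₀ + M * t = i)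
    {σ : ℤ → S} {τ : ℤ → ℝ} (hτ : ∀ i, τ i ∈ Set.Ioo (0 : ℝ) 1)
    (hσ : ∀ i : ℤ, γ ((i - x₀) / M) = E (σ i) (τ i)) (k : ℤ) :
    ∑ i ∈ Finset.Ioc k (k + M.natAbs), R (σ i) =
      ∑ s, (Set.ncard {y | y ∈ Set.Ioo (0 : ℝ) 1 ∧ ∃ t, γ t = E s y} : ℝ) • R s := by
  classical
  have hMr : (M : ℝ) ≠ 0 := by exact_mod_cast hM
  rw [← Finset.sum_fiberwise_of_maps_to (s := Finset.Ioc k (k + M.natAbs)) (t := Finset.univ)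
    (g := σ) (fun _ _ => Finset.mem_univ _)]
  refine Finset.sum_congr rfl fun s _ => ?_
  rw [Finset.sum_congr rfl (g := fun _ => R s)
    (fun i hi => by rw [(Finset.mem_filter.1 hi).2]), Finset.sum_const, Nat.cast_smul_eq_nsmul]
  congr 1
  rw [← Set.ncard_coe_finset]
  refine Set.ncard_congr (fun i _ => τ i) ?_ ?_ ?_
  · intro i hi
    have hi' := (Finset.mem_filter.1 hi).2
    exact ⟨hτ i, _, hi' ▸ hσ i⟩
  · intro i j hi hj hij
    obtain ⟨hi1, hi2⟩ := Finset.mem_filter.1 hi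
    obtain ⟨hj1, hj2⟩ := Finset.mem_filter.1 hj
    obtain ⟨m, hm⟩ := (hγ _ _).1 (show γ ((i - x₀) / M) = γ ((j - x₀) / M) by
      rw [hσ, hσ, hi2, hj2, hij])
    have h1 : (i : ℝ) - j = M * m := by rw [← hm]; field_simp; ring
    have h2 : i - j = M * m := by exact_mod_cast h1
    rw [Finset.mem_Ioc] at hi1 hj1
    by_contra hne
    have h3 : M ∣ i - j := ⟨m, h2⟩
    have h4 := Int.natAbs_dvd_natAbs.2 h3
    have h5 := Nat.le_of_dvd (by omega) h4
    omega
  · rintro y ⟨hy, t, ht⟩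
    obtain ⟨i, hi⟩ := hmeet t ⟨s, y, hy, ht⟩
    -- The residue that moves the crossing `i` by whole periods to the index `k + 1 + r` of the
    -- window.
    set r := (i - k - 1) % M with hr
    have hr0 : 0 ≤ r := Int.emod_nonneg _ hM
    have hr1 : r < M.natAbs := by
      rw [Int.natCast_natAbs]
      exact Int.emod_lt_abs _ hM
    have hr2 : r + M * ((i - k - 1) / M) = i - k - 1 := Int.emod_add_mul_ediv _ _
    have h1 : γ (((k + 1 + r : ℤ) - x₀) / M) = E s y := by
      rw [← ht]
      refine (hγ _ _).2 ⟨-((i - k - 1) / M), ?_⟩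
      have h2 : ((k + 1 + r : ℤ) : ℝ) = i - M * (((i - k - 1) / M : ℤ) : ℝ) := by
        have : k + 1 + r = i - M * ((i - k - 1) / M) := by linarith
        exact_mod_cast this
      rw [h2, ← hi]
      field_simp
      push_cast
      ring
    rw [hσ] at h1
    obtain ⟨h2, h3⟩ := hE _ _ _ (hτ _) _ hy h1
    refine ⟨k + 1 + r, ?_, h3⟩
    simp only [Finset.coe_filter, Set.mem_ofPred_eq, Finset.mem_Ioc]
    exact ⟨⟨by omega, by omega⟩, h2⟩

/-- `A` accumulates the contributions of the crossings up to a given integral value. Its increment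
over one period is the signed total count. -/
theorem exists_crossing_primitive {S V X : Type} [Fintype S] [AddCommGroup V] [Module ℝ V]
    (R : S → V) {γ : ℝ → X} (hγ : ∀ t t', γ t = γ t' ↔ ∃ m : ℤ, t - t' = m) (M : ℤ) (x₀ : ℝ)
    {E : S → ℝ → X} (hE : ∀ s s', ∀ τ ∈ Set.Ioo (0 : ℝ) 1, ∀ τ' ∈ Set.Ioo (0 : ℝ) 1,
      E s τ = E s' τ' → s = s' ∧ τ = τ')
    (hmeet : ∀ t, (∃ s, ∃ τ ∈ Set.Ioo (0 : ℝ) 1, γ t = E s τ) ↔ ∃ i : ℤ, x₀ + M * t = i) :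
    ∃ A : ℤ → V, (M ≠ 0 → ∀ (i : ℤ) (t : ℝ) (s : S), ∀ τ ∈ Set.Ioo (0 : ℝ) 1, x₀ + M * t = i →
        γ t = E s τ → A i - A (i - 1) = R s) ∧
      ∀ k : ℤ, A (k + M) - A k = (M.sign : ℝ) •
        ∑ s, (Set.ncard {y | y ∈ Set.Ioo (0 : ℝ) 1 ∧ ∃ t, γ t = E s y} : ℝ) • R s := by
  -- The coordinate is then constant. The curve may even run along a side, but the sign `0` removes
  -- the count.
  by_cases hM : M = 0
  · refine ⟨0, fun h => absurd hM h, fun k => ?_⟩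
    subst hM
    simp
  have hMr : (M : ℝ) ≠ 0 := by exact_mod_cast hM
  choose σ τ hτ hσ using fun i : ℤ => (hmeet ((i - x₀) / M)).2 ⟨i, by field_simp; ring⟩
  obtain ⟨A, hA, hAsum⟩ := exists_int_primitive fun i => R (σ i)
  have hsum := fun k => (hAsum k M.natAbs).trans
    (sum_crossings R hγ hM x₀ hE (fun t ht => (hmeet t).1 ht) hτ hσ k)
  refine ⟨A, fun _ i t s y hy hi hs => ?_, fun k => ?_⟩
  · have h1 : t = (i - x₀) / M := by rw [← hi]; field_simp; ring
    rw [h1, hσ] at hs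
    rw [hA, (hE _ _ _ (hτ i) _ hy hs).1]
  · rcases lt_or_gt_of_ne hM with h | h
    · have h1 := hsum (k + M)
      have h2 : k + M + (M.natAbs : ℤ) = k := by omega
      rw [h2] at h1
      rw [Int.sign_eq_neg_one_of_neg h, ← h1]
      push_cast
      rw [neg_one_smul, neg_sub]
    · have h1 := hsum k
      have h2 : k + (M.natAbs : ℤ) = k + M := by omega
      rw [h2] at h1
      rw [Int.sign_eq_one_of_pos h, ← h1]
      push_cast
      rw [one_smul]

/-! ### The class of a closed geodesic in terms of its crossings with the sides of the squares -/

namespace SquareTiled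

open TorusCover PathMod

variable {S : Type} {h v : Equiv.Perm S}

/-- The square `s`, extended constantly along the lines orthogonal to its sides. -/
def sq (s : S) (e : ℝ × ℝ) : SquareTiled h v :=
  pt s (Set.projIcc 0 1 zero_le_one e.1, Set.projIcc 0 1 zero_le_one e.2)

theorem continuous_sq (s : S) : Continuous (sq s : _ → SquareTiled h v) :=
  (continuous_pt s).comp ((continuous_projIcc.comp continuous_fst).prodMk
    (continuous_projIcc.comp continuous_snd))

theorem sq_of_mem (s : S) {x y : ℝ} (hx : x ∈ Set.Icc (0 : ℝ) 1) (hy : y ∈ Set.Icc (0 : ℝ) 1) :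
    (sq s (x, y) : SquareTiled h v) = pt s (⟨x, hx⟩, ⟨y, hy⟩) := by
  rw [sq, Set.projIcc_of_mem _ hx, Set.projIcc_of_mem _ hy]

theorem proj_sq (s : S) {e : ℝ × ℝ} (hx : e.1 ∈ Set.Icc (0 : ℝ) 1) (hy : e.2 ∈ Set.Icc (0 : ℝ) 1) :
    proj (sq s e : SquareTiled h v) = toTorus e := by
  rw [show e = (e.1, e.2) from rfl, sq_of_mem s hx hy, proj_pt]
  rfl

theorem sq_right (s : S) (y : ℝ) : (sq s (1, y) : SquareTiled h v) = sq (h s) (0, y) := by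
  rw [sq, sq]
  simp only [Set.projIcc_right, Set.projIcc_left]
  exact pt_right s _

theorem sq_top (s : S) (x : ℝ) : (sq s (x, 1) : SquareTiled h v) = sq (v s) (x, 0) := by
  rw [sq, sq]
  simp only [Set.projIcc_right, Set.projIcc_left]
  exact pt_top s _

theorem sq_injective {s s' : S} {e : ℝ × ℝ} (hx : e.1 ∈ Set.Ico (0 : ℝ) 1)
    (hy : e.2 ∈ Set.Ico (0 : ℝ) 1) (h0 : e ≠ 0)
    (hs : (sq s e : SquareTiled h v) = sq s' e) : s = s' := by
  obtain ⟨x, y⟩ := e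
  have hx' := Set.Ico_subset_Icc_self hx
  have hy' := Set.Ico_subset_Icc_self hy
  rw [sq_of_mem s hx' hy', sq_of_mem s' hx' hy'] at hs
  simp only at hx hy
  have hx1 : (⟨x, hx'⟩ : unitInterval) ≠ 1 := fun h1 => hx.2.ne (congrArg Subtype.val h1)
  have hy1 : (⟨y, hy'⟩ : unitInterval) ≠ 1 := fun h1 => hy.2.ne (congrArg Subtype.val h1)
  by_cases hx0 : (⟨x, hx'⟩ : unitInterval) = 0
  · have hy0 : (⟨y, hy'⟩ : unitInterval) ≠ 0 := fun hy0 =>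
      h0 (Prod.ext (congrArg Subtype.val hx0) (congrArg Subtype.val hy0))
    rw [hx0] at hs
    have h1 : (pt s (0, ⟨y, hy'⟩) : SquareTiled h v) ∈ sheetH h v s :=
      pt_mem_sheetH.2 ⟨⟨hy0, hy1⟩, Or.inl ⟨half_pos, rfl⟩⟩
    rw [hs, pt_mem_sheetH] at h1
    rcases h1.2 with h2 | h2
    · exact h2.2.symm
    · exact absurd h2.1 (not_lt_of_gt half_pos)
  · by_cases hy0 : (⟨y, hy'⟩ : unitInterval) = 0
    · rw [hy0] at hs
      have h1 : (pt s (⟨x, hx'⟩, 0) : SquareTiled h v) ∈ sheetV h v s :=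
        pt_mem_sheetV.2 ⟨⟨hx0, hx1⟩, Or.inl ⟨half_pos, rfl⟩⟩
      rw [hs, pt_mem_sheetV] at h1
      rcases h1.2 with h2 | h2
      · exact h2.2.symm
      · exact absurd h2.1 (not_lt_of_gt half_pos)
    · have h1 : (pt s (⟨x, hx'⟩, ⟨y, hy'⟩) : SquareTiled h v) ∈ sheet h v s :=
        pt_mem_sheet.2 ⟨⟨hx0, hx1⟩, ⟨hy0, hy1⟩, rfl⟩
      rw [hs, pt_mem_sheet] at h1
      exact h1.2.2.symm

theorem exists_sq (z : SquareTiled h v) {x y : ℝ} (hz : proj z = toTorus (x, y)) :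
    ∃ s, z = sq s (Int.fract x, Int.fract y) := by
  obtain ⟨s, ⟨a, b⟩, rfl⟩ := exists_pt z
  rw [proj_pt] at hz
  have hfx : Int.fract x ∈ Set.Icc (0 : ℝ) 1 := ⟨Int.fract_nonneg x, (Int.fract_lt_one x).le⟩
  have hfy : Int.fract y ∈ Set.Icc (0 : ℝ) 1 := ⟨Int.fract_nonneg y, (Int.fract_lt_one y).le⟩
  have hcoe : ∀ x : ℝ, (x : UnitAddCircle) = (Int.fract x : ℝ) := fun x =>
    coe_eq_coe_iff_int.2 ⟨⌊x⌋, by rw [Int.fract]; ring⟩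
  have h1 : ((a : ℝ) : UnitAddCircle) = (Int.fract x : ℝ) := (congrArg Prod.fst hz).trans (hcoe x)
  have h2 : ((b : ℝ) : UnitAddCircle) = (Int.fract y : ℝ) := (congrArg Prod.snd hz).trans (hcoe y)
  have h1' := coe_eq_coe (y := ⟨_, hfx⟩).1 h1
  have h2' := coe_eq_coe (y := ⟨_, hfy⟩).1 h2
  have hx1 : (⟨_, hfx⟩ : unitInterval) ≠ 1 := fun h => (Int.fract_lt_one x).ne (congrArg Subtype.val h)
  have hy1 : (⟨_, hfy⟩ : unitInterval) ≠ 1 := fun h => (Int.fract_lt_one y).ne (congrArg Subtype.val h)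
  have h1'' : a = ⟨_, hfx⟩ ∨ (a = 1 ∧ (⟨_, hfx⟩ : unitInterval) = 0) := by tauto
  have h2'' : b = ⟨_, hfy⟩ ∨ (b = 1 ∧ (⟨_, hfy⟩ : unitInterval) = 0) := by tauto
  simp only [sq_of_mem _ hfx hfy]
  clear h1 h2 h1' h2' hz
  rcases h1'' with rfl | ⟨rfl, h1⟩ <;> rcases h2'' with rfl | ⟨rfl, h2⟩
  · exact ⟨s, rfl⟩
  · exact ⟨v s, by rw [pt_top, h2]⟩
  · exact ⟨h s, by rw [pt_right, h1]⟩
  · exact ⟨v (h s), by rw [pt_right, pt_top, h1, h2]⟩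

/-- The middle of a square. -/
def mid : ℝ × ℝ := (1 / 2, 1 / 2)

/-- The path between the middles of `s` and of `h s`. -/
def dualRight (s : S) : PathMod (SquareTiled h v) :=
  seg (sq s) mid (1, 1 / 2) - seg (sq (h s)) mid (0, 1 / 2)

/-- The path between the middles of `s` and of `v s`. -/
def dualTop (s : S) : PathMod (SquareTiled h v) :=
  seg (sq s) mid (1 / 2, 1) - seg (sq (v s)) mid (1 / 2, 0)

theorem sq_seg_add (s : S) (A B C : ℝ × ℝ) :
    seg (sq s : _ → SquareTiled h v) A B + seg (sq s) B C = seg (sq s) A C :=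
  seg_add_seg convex_univ (continuous_sq s).continuousOn (Set.mem_univ _) (Set.mem_univ _)
    (Set.mem_univ _)

/-- Sliding the crossing point along the common side changes both halves of the path by the same
segment. -/
theorem dualRight_eq (s : S) (y : ℝ) : (dualRight s : PathMod (SquareTiled h v)) =
    seg (sq s) mid (1, y) - seg (sq (h s)) mid (0, y) := by
  have h1 := sq_seg_add (h := h) (v := v) s mid (1, 1 / 2) (1, y)
  have h2 := sq_seg_add (h := h) (v := v) (h s) mid (0, 1 / 2) (0, y)
  have h3 : seg (sq s : _ → SquareTiled h v) (1, 1 / 2) (1, y) =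
      seg (sq (h s)) (0, 1 / 2) (0, y) := by
    refine seg_congr fun t _ => ?_
    rw [comb_mk, comb_mk, sub_self, sub_self, mul_zero, add_zero, add_zero, sq_right]
  rw [dualRight, ← h1, ← h2, h3]
  abel

theorem dualTop_eq (s : S) (x : ℝ) : (dualTop s : PathMod (SquareTiled h v)) =
    seg (sq s) mid (x, 1) - seg (sq (v s)) mid (x, 0) := by
  have h1 := sq_seg_add (h := h) (v := v) s mid (1 / 2, 1) (x, 1)
  have h2 := sq_seg_add (h := h) (v := v) (v s) mid (1 / 2, 0) (x, 0)
  have h3 : seg (sq s : _ → SquareTiled h v) (1 / 2, 1) (x, 1) =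
      seg (sq (v s)) (1 / 2, 0) (x, 0) := by
    refine seg_congr fun t _ => ?_
    rw [comb_mk, comb_mk, sub_self, sub_self, mul_zero, add_zero, add_zero, sq_top]
  rw [dualTop, ← h1, ← h2, h3]
  abel

open scoped Classical in
/-- The square `s` and its left neighbour. -/
def sqH (s : S) (e : ℝ × ℝ) : SquareTiled h v :=
  if 0 ≤ e.1 then sq s e else sq (h.symm s) (e.1 + 1, e.2)

open scoped Classical in
/-- The square `s` and its lower neighbour. -/
def sqV (s : S) (e : ℝ × ℝ) : SquareTiled h v :=
  if 0 ≤ e.2 then sq s e else sq (v.symm s) (e.1, e.2 + 1)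

theorem continuous_sqH (s : S) : Continuous (sqH s : _ → SquareTiled h v) := by
  classical
  refine Continuous.if_le (continuous_sq s) ((continuous_sq _).comp (by fun_prop))
    continuous_const continuous_fst fun e he => ?_
  rw [← he, zero_add, sq_right, Equiv.apply_symm_apply, he]

theorem continuous_sqV (s : S) : Continuous (sqV s : _ → SquareTiled h v) := by
  classical
  refine Continuous.if_le (continuous_sq s) ((continuous_sq _).comp (by fun_prop))
    continuous_const continuous_snd fun e he => ?_
  rw [← he, zero_add, sq_top, Equiv.apply_symm_apply, he]

theorem sqH_of_nonneg (s : S) {e : ℝ × ℝ} (he : 0 ≤ e.1) :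
    (sqH s e : SquareTiled h v) = sq s e := if_pos he

theorem sqV_of_nonneg (s : S) {e : ℝ × ℝ} (he : 0 ≤ e.2) :
    (sqV s e : SquareTiled h v) = sq s e := if_pos he

theorem sqH_of_nonpos (s : S) {e : ℝ × ℝ} (he : e.1 ≤ 0) :
    (sqH s e : SquareTiled h v) = sq (h.symm s) (e.1 + 1, e.2) := by
  rcases he.eq_or_lt with h0 | h0
  · rw [sqH_of_nonneg s h0.ge, h0, zero_add, sq_right, Equiv.apply_symm_apply, ← h0]
  · exact if_neg (not_le.2 h0)

theorem sqV_of_nonpos (s : S) {e : ℝ × ℝ} (he : e.2 ≤ 0) :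
    (sqV s e : SquareTiled h v) = sq (v.symm s) (e.1, e.2 + 1) := by
  rcases he.eq_or_lt with h0 | h0
  · rw [sqV_of_nonneg s h0.ge, h0, zero_add, sq_top, Equiv.apply_symm_apply, ← h0]
  · exact if_neg (not_le.2 h0)

theorem proj_sqH (s : S) {e : ℝ × ℝ} (hx : e.1 ∈ Set.Icc (-1 : ℝ) 1)
    (hy : e.2 ∈ Set.Icc (0 : ℝ) 1) : proj (sqH s e : SquareTiled h v) = toTorus e := by
  rcases le_total 0 e.1 with h0 | h0
  · rw [sqH_of_nonneg s h0, proj_sq s ⟨h0, hx.2⟩ hy]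
  · rw [sqH_of_nonpos s h0, proj_sq (e := (e.1 + 1, e.2)) _
      ⟨by simp only; linarith [hx.1], by simp only; linarith⟩ hy]
    exact Prod.ext (coe_eq_coe_iff_int.2 ⟨1, by simp⟩) rfl

theorem proj_sqV (s : S) {e : ℝ × ℝ} (hx : e.1 ∈ Set.Icc (0 : ℝ) 1)
    (hy : e.2 ∈ Set.Icc (-1 : ℝ) 1) : proj (sqV s e : SquareTiled h v) = toTorus e := by
  rcases le_total 0 e.2 with h0 | h0
  · rw [sqV_of_nonneg s h0, proj_sq s hx ⟨h0, hy.2⟩]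
  · rw [sqV_of_nonpos s h0, proj_sq (e := (e.1, e.2 + 1)) _ hx
      ⟨by simp only; linarith [hy.1], by simp only; linarith⟩]
    exact Prod.ext rfl (coe_eq_coe_iff_int.2 ⟨1, by simp⟩)

theorem seg_sqH_of_nonneg (s : S) {x y : ℝ} (hx : 0 ≤ x) :
    seg (sqH s : _ → SquareTiled h v) mid (x, y) = seg (sq s) mid (x, y) := by
  refine seg_congr fun t ht => sqH_of_nonneg s ?_
  rw [mid, comb_mk]
  simp only
  nlinarith [ht.1, ht.2]

theorem seg_sqV_of_nonneg (s : S) {x y : ℝ} (hy : 0 ≤ y) :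
    seg (sqV s : _ → SquareTiled h v) mid (x, y) = seg (sq s) mid (x, y) := by
  refine seg_congr fun t ht => sqV_of_nonneg s ?_
  rw [mid, comb_mk]
  simp only
  nlinarith [ht.1, ht.2]

theorem seg_sqH_of_neg (s : S) {x y : ℝ} (hx : x ≤ 0) :
    seg (sqH s : _ → SquareTiled h v) mid (x, y) =
      seg (sq (h.symm s)) mid (x + 1, y) - dualRight (h.symm s) := by
  have h1 : seg (sqH s : _ → SquareTiled h v) mid (0, y) + seg (sqH s) (0, y) (x, y) =
      seg (sqH s) mid (x, y) := seg_add_seg convex_univ (continuous_sqH s).continuousOn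
        (Set.mem_univ _) (Set.mem_univ _) (Set.mem_univ _)
  have h2 : seg (sqH s : _ → SquareTiled h v) (0, y) (x, y) =
      seg (sq (h.symm s)) (1, y) (x + 1, y) := by
    refine seg_congr fun t ht => ?_
    rw [comb_mk, comb_mk, sqH_of_nonpos]
    · congr 2
      simp only
      ring
    · simp only
      nlinarith [ht.1]
  rw [← h1, h2, seg_sqH_of_nonneg s le_rfl, dualRight_eq _ y, Equiv.apply_symm_apply,
    ← sq_seg_add (h.symm s) mid (1, y) (x + 1, y)]
  abel

theorem seg_sqV_of_neg (s : S) {x y : ℝ} (hy : y ≤ 0) :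
    seg (sqV s : _ → SquareTiled h v) mid (x, y) =
      seg (sq (v.symm s)) mid (x, y + 1) - dualTop (v.symm s) := by
  have h1 : seg (sqV s : _ → SquareTiled h v) mid (x, 0) + seg (sqV s) (x, 0) (x, y) =
      seg (sqV s) mid (x, y) := seg_add_seg convex_univ (continuous_sqV s).continuousOn
        (Set.mem_univ _) (Set.mem_univ _) (Set.mem_univ _)
  have h2 : seg (sqV s : _ → SquareTiled h v) (x, 0) (x, y) =
      seg (sq (v.symm s)) (x, 1) (x, y + 1) := by
    refine seg_congr fun t ht => ?_
    rw [comb_mk, comb_mk, sqV_of_nonpos]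
    · congr 2
      simp only
      ring
    · simp only
      nlinarith [ht.1]
  rw [← h1, h2, seg_sqV_of_nonneg s le_rfl, dualTop_eq _ x, Equiv.apply_symm_apply,
    ← sq_seg_add (v.symm s) mid (x, 1) (x, y + 1)]
  abel

end SquareTiled

/-! ### A straight line compared with the paths between middles of squares, near one of its points.
-/

namespace SquareTiled

open TorusCover PathMod

variable {S : Type} {h v : Equiv.Perm S}

theorem floor_eq_of_sub_mem {x : ℝ} {i : ℤ} (hx : x - i ∈ Set.Ico (0 : ℝ) 1) : ⌊x⌋ = i :=
  Int.floor_eq_iff.2 ⟨by linarith [hx.1], by linarith [hx.2]⟩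

theorem fract_mem_Ioo {x : ℝ} (hx : ∀ j : ℤ, x ≠ j) : Int.fract x ∈ Set.Ioo (0 : ℝ) 1 :=
  ⟨lt_of_le_of_ne (Int.fract_nonneg x) fun h0 => hx ⌊x⌋ (by
    have := Int.self_sub_floor x
    linarith), Int.fract_lt_one x⟩

/-- Away from horizontal sides, the line near `t₀` stays in a square and its left neighbour. When it
crosses the side between them, the middle that serves as base point changes by `dualRight`, and the
increment of `A` compensates for this. -/
theorem eventually_seg_eq_right [Finite S] {c : ℝ → SquareTiled h v} (hc : Continuous c)
    {x₀ y₀ : ℝ} {M N : ℝ}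
    (hcp : ∀ t, proj (c t) = toTorus (x₀ + M * t, y₀ + N * t)) (hc0 : ∀ t, proj (c t) ≠ 0)
    {σ : ℝ → S} (hσ : ∀ t, c t = sq (σ t) (Int.fract (x₀ + M * t), Int.fract (y₀ + N * t)))
    {A : ℤ → PathMod (SquareTiled h v)} (hA : M ≠ 0 → ∀ (i : ℤ) (t : ℝ) (s : S),
      ∀ τ ∈ Set.Ioo (0 : ℝ) 1, x₀ + M * t = i → c t = sq s (1, τ) → A i - A (i - 1) = dualRight s)
    {t₀ : ℝ} (hy : ∀ j : ℤ, y₀ + N * t₀ ≠ j) :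
    ∀ᶠ t in 𝓝 t₀, ⌊y₀ + N * t⌋ = ⌊y₀ + N * t₀⌋ ∧ seg c t₀ t =
      seg (sq (σ t)) mid (Int.fract (x₀ + M * t), Int.fract (y₀ + N * t)) + A ⌊x₀ + M * t⌋ -
      (seg (sq (σ t₀)) mid (Int.fract (x₀ + M * t₀), Int.fract (y₀ + N * t₀)) +
        A ⌊x₀ + M * t₀⌋) := by
  set i := ⌊x₀ + M * t₀⌋ with hi
  set j := ⌊y₀ + N * t₀⌋ with hj
  set s := σ t₀ with hs
  let e : ℝ → ℝ × ℝ := fun t => (x₀ + M * t - i, y₀ + N * t - j)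
  have hec : Continuous e := by fun_prop
  have hecomb : ∀ t t' l : ℝ, e ((1 - l) • t + l • t') = (1 - l) • e t + l • e t' := by
    intro t t' l
    rw [comb_mk]
    refine Prod.ext ?_ ?_ <;> simp [e] <;> ring
  set B : Set (ℝ × ℝ) := Set.Ioo (-1 : ℝ) 1 ×ˢ Set.Ioo (0 : ℝ) 1 with hB
  have hBc : Convex ℝ B := (convex_Ioo _ _).prod (convex_Ioo _ _)
  have hKc : Convex ℝ (e ⁻¹' B) := by
    intro t ht t' ht' a b ha hb hab
    obtain rfl : a = 1 - b := by linarith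
    change e _ ∈ B
    rw [hecomb]
    exact hBc ht ht' ha hb (by ring)
  have hKo : IsOpen (e ⁻¹' B) := (isOpen_Ioo.prod isOpen_Ioo).preimage hec
  have hft : Int.fract (x₀ + M * t₀) = x₀ + M * t₀ - i := (Int.self_sub_floor _).symm
  have hft' : Int.fract (y₀ + N * t₀) = y₀ + N * t₀ - j := (Int.self_sub_floor _).symm
  have hx0 : 0 ≤ x₀ + M * t₀ - i := hft ▸ Int.fract_nonneg _
  have ht₀ : t₀ ∈ e ⁻¹' B := by
    refine ⟨⟨by simp only [e]; linarith, ?_⟩, ?_⟩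
    · simp only [e]; rw [← hft]; exact Int.fract_lt_one _
    · simp only [e]; rw [← hft']; exact fract_mem_Ioo hy
  have hce : ∀ t ∈ e ⁻¹' B, c t = sqH s (e t) := by
    intro t ht
    refine eqOn_of_lift isCoveringMapOn_proj hKc.isPreconnected (F := c)
      (G := fun t => sqH s (e t)) hc.continuousOn ((continuous_sqH s).comp hec).continuousOn
      ?_ (fun t _ => hc0 t) ht₀ ?_ ht
    · intro t ht
      rw [proj_sqH s (Set.Ioo_subset_Icc_self ht.1) (Set.Ioo_subset_Icc_self ht.2), hcp]
      exact Prod.ext (coe_eq_coe_iff_int.2 ⟨i, by simp [e]⟩) (coe_eq_coe_iff_int.2 ⟨j, by simp [e]⟩)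
    · rw [sqH_of_nonneg s (by simpa [e] using hx0), hσ, hft, hft']
  have hfloory : ∀ t ∈ e ⁻¹' B, ⌊y₀ + N * t⌋ = j := fun t ht =>
    floor_eq_of_sub_mem ⟨ht.2.1.le, ht.2.2⟩
  have hne0 : ∀ t, (Int.fract (x₀ + M * t), Int.fract (y₀ + N * t)) ≠ ((0 : ℝ × ℝ)) := by
    intro t h0
    have h1 := hσ t
    rw [h0] at h1
    refine hc0 t ?_
    rw [h1, proj_sq] <;> simp [toTorus]
  have huniq : ∀ t s', c t = sq s' (Int.fract (x₀ + M * t), Int.fract (y₀ + N * t)) →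
      σ t = s' := fun t s' h1 =>
    sq_injective ⟨Int.fract_nonneg _, Int.fract_lt_one _⟩ ⟨Int.fract_nonneg _, Int.fract_lt_one _⟩
      (hne0 t) ((hσ t).symm.trans h1)
  have hkey : ∀ t ∈ e ⁻¹' B,
      seg (sq (σ t)) mid (Int.fract (x₀ + M * t), Int.fract (y₀ + N * t)) + A ⌊x₀ + M * t⌋ =
        seg (sqH s) mid (e t) + A i := by
    intro t ht
    have hfy : Int.fract (y₀ + N * t) = y₀ + N * t - j := by
      rw [← Int.self_sub_floor, hfloory t ht]
    rcases le_or_gt 0 (x₀ + M * t - i) with h0 | h0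
    · have hfl : ⌊x₀ + M * t⌋ = i := floor_eq_of_sub_mem ⟨h0, ht.1.2⟩
      have hfx : Int.fract (x₀ + M * t) = x₀ + M * t - i := by rw [← Int.self_sub_floor, hfl]
      have hst : σ t = s := huniq t s (by
        rw [hce t ht, sqH_of_nonneg s h0, hfx, hfy])
      rw [hst, hfl, hfx, hfy, seg_sqH_of_nonneg s h0]
    · have hlo : -1 < x₀ + M * t - i := ht.1.1
      have hfl : ⌊x₀ + M * t⌋ = i - 1 := by
        refine floor_eq_of_sub_mem ⟨?_, ?_⟩ <;> push_cast <;> linarith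
      have hfx : Int.fract (x₀ + M * t) = x₀ + M * t - i + 1 := by
        rw [← Int.self_sub_floor, hfl]; push_cast; ring
      have hst : σ t = h.symm s := huniq t _ (by
        rw [hce t ht, sqH_of_nonpos s h0.le, hfx, hfy])
      have hd : M * (t₀ - t) ≠ 0 := by
        intro h1
        nlinarith
      have hM : M ≠ 0 := left_ne_zero_of_mul hd
      have htt : t₀ - t ≠ 0 := right_ne_zero_of_mul hd
      -- The parameter, between `t` and `t₀`, at which the line crosses the vertical side.
      set l := (i - (x₀ + M * t)) / (M * (t₀ - t)) with hl
      have hpos : 0 < M * (t₀ - t) := by nlinarith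
      have hl0 : 0 ≤ l := div_nonneg (by linarith) hpos.le
      have hl1 : l ≤ 1 := (div_le_one hpos).2 (by nlinarith)
      have hmem := hKc ht ht₀ (sub_nonneg.2 hl1) hl0 (sub_add_cancel 1 l)
      have hx : x₀ + M * ((1 - l) • t + l • t₀) = i := by
        have h1 : l * (M * (t₀ - t)) = i - (x₀ + M * t) := div_mul_cancel₀ _ hd
        simp only [smul_eq_mul]
        linear_combination h1
      have hz : (e ((1 - l) • t + l • t₀)).1 = 0 := by
        change x₀ + M * ((1 - l) • t + l • t₀) - i = 0
        rw [hx, sub_self]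
      have hAi := hA hM i _ (h.symm s) _ hmem.2 hx (by
        rw [hce _ hmem, sqH_of_nonpos s hz.le, hz, zero_add])
      rw [hst, hfl, hfx, hfy, seg_sqH_of_neg s h0.le, ← hAi]
      abel
  filter_upwards [hKo.mem_nhds ht₀] with t ht
  refine ⟨hfloory t ht, ?_⟩
  rw [hkey t ht, hkey t₀ ht₀]
  have h1 : seg c t₀ t = seg (sqH s) (e t₀) (e t) := by
    refine seg_congr fun l hl => ?_
    rw [← hecomb]
    exact hce _ (hKc ht₀ ht (by linarith [hl.2]) hl.1 (by ring))
  have h2 := seg_add_seg convex_univ (continuous_sqH (h := h) (v := v) s).continuousOn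
    (Set.mem_univ mid) (Set.mem_univ (e t₀)) (Set.mem_univ (e t))
  rw [h1, ← h2]
  abel

theorem eventually_seg_eq_top [Finite S] {c : ℝ → SquareTiled h v} (hc : Continuous c)
    {x₀ y₀ : ℝ} {M N : ℝ}
    (hcp : ∀ t, proj (c t) = toTorus (x₀ + M * t, y₀ + N * t)) (hc0 : ∀ t, proj (c t) ≠ 0)
    {σ : ℝ → S} (hσ : ∀ t, c t = sq (σ t) (Int.fract (x₀ + M * t), Int.fract (y₀ + N * t)))
    {A : ℤ → PathMod (SquareTiled h v)} (hA : N ≠ 0 → ∀ (i : ℤ) (t : ℝ) (s : S),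
      ∀ τ ∈ Set.Ioo (0 : ℝ) 1, y₀ + N * t = i → c t = sq s (τ, 1) → A i - A (i - 1) = dualTop s)
    {t₀ : ℝ} (hx : ∀ j : ℤ, x₀ + M * t₀ ≠ j) :
    ∀ᶠ t in 𝓝 t₀, ⌊x₀ + M * t⌋ = ⌊x₀ + M * t₀⌋ ∧ seg c t₀ t =
      seg (sq (σ t)) mid (Int.fract (x₀ + M * t), Int.fract (y₀ + N * t)) + A ⌊y₀ + N * t⌋ -
      (seg (sq (σ t₀)) mid (Int.fract (x₀ + M * t₀), Int.fract (y₀ + N * t₀)) +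
        A ⌊y₀ + N * t₀⌋) := by
  set j := ⌊x₀ + M * t₀⌋ with hj
  set i := ⌊y₀ + N * t₀⌋ with hi
  set s := σ t₀ with hs
  let e : ℝ → ℝ × ℝ := fun t => (x₀ + M * t - j, y₀ + N * t - i)
  have hec : Continuous e := by fun_prop
  have hecomb : ∀ t t' l : ℝ, e ((1 - l) • t + l • t') = (1 - l) • e t + l • e t' := by
    intro t t' l
    rw [comb_mk]
    refine Prod.ext ?_ ?_ <;> simp [e] <;> ring
  set B : Set (ℝ × ℝ) := Set.Ioo (0 : ℝ) 1 ×ˢ Set.Ioo (-1 : ℝ) 1 with hB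
  have hBc : Convex ℝ B := (convex_Ioo _ _).prod (convex_Ioo _ _)
  have hKc : Convex ℝ (e ⁻¹' B) := by
    intro t ht t' ht' a b ha hb hab
    obtain rfl : a = 1 - b := by linarith
    change e _ ∈ B
    rw [hecomb]
    exact hBc ht ht' ha hb (by ring)
  have hKo : IsOpen (e ⁻¹' B) := (isOpen_Ioo.prod isOpen_Ioo).preimage hec
  have hft : Int.fract (y₀ + N * t₀) = y₀ + N * t₀ - i := (Int.self_sub_floor _).symm
  have hft' : Int.fract (x₀ + M * t₀) = x₀ + M * t₀ - j := (Int.self_sub_floor _).symm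
  have hy0 : 0 ≤ y₀ + N * t₀ - i := hft ▸ Int.fract_nonneg _
  have ht₀ : t₀ ∈ e ⁻¹' B := by
    refine ⟨?_, by simp only [e]; linarith, ?_⟩
    · simp only [e]; rw [← hft']; exact fract_mem_Ioo hx
    · simp only [e]; rw [← hft]; exact Int.fract_lt_one _
  have hce : ∀ t ∈ e ⁻¹' B, c t = sqV s (e t) := by
    intro t ht
    refine eqOn_of_lift isCoveringMapOn_proj hKc.isPreconnected (F := c)
      (G := fun t => sqV s (e t)) hc.continuousOn ((continuous_sqV s).comp hec).continuousOn
      ?_ (fun t _ => hc0 t) ht₀ ?_ ht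
    · intro t ht
      rw [proj_sqV s (Set.Ioo_subset_Icc_self ht.1) (Set.Ioo_subset_Icc_self ht.2), hcp]
      exact Prod.ext (coe_eq_coe_iff_int.2 ⟨j, by simp [e]⟩) (coe_eq_coe_iff_int.2 ⟨i, by simp [e]⟩)
    · rw [sqV_of_nonneg s (by simpa [e] using hy0), hσ, hft, hft']
  have hfloorx : ∀ t ∈ e ⁻¹' B, ⌊x₀ + M * t⌋ = j := fun t ht =>
    floor_eq_of_sub_mem ⟨ht.1.1.le, ht.1.2⟩
  have hne0 : ∀ t, (Int.fract (x₀ + M * t), Int.fract (y₀ + N * t)) ≠ ((0 : ℝ × ℝ)) := by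
    intro t h0
    have h1 := hσ t
    rw [h0] at h1
    refine hc0 t ?_
    rw [h1, proj_sq] <;> simp [toTorus]
  have huniq : ∀ t s', c t = sq s' (Int.fract (x₀ + M * t), Int.fract (y₀ + N * t)) →
      σ t = s' := fun t s' h1 =>
    sq_injective ⟨Int.fract_nonneg _, Int.fract_lt_one _⟩ ⟨Int.fract_nonneg _, Int.fract_lt_one _⟩
      (hne0 t) ((hσ t).symm.trans h1)
  have hkey : ∀ t ∈ e ⁻¹' B,
      seg (sq (σ t)) mid (Int.fract (x₀ + M * t), Int.fract (y₀ + N * t)) + A ⌊y₀ + N * t⌋ =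
        seg (sqV s) mid (e t) + A i := by
    intro t ht
    have hfx : Int.fract (x₀ + M * t) = x₀ + M * t - j := by
      rw [← Int.self_sub_floor, hfloorx t ht]
    rcases le_or_gt 0 (y₀ + N * t - i) with h0 | h0
    · have hfl : ⌊y₀ + N * t⌋ = i := floor_eq_of_sub_mem ⟨h0, ht.2.2⟩
      have hfy : Int.fract (y₀ + N * t) = y₀ + N * t - i := by rw [← Int.self_sub_floor, hfl]
      have hst : σ t = s := huniq t s (by
        rw [hce t ht, sqV_of_nonneg s h0, hfy, hfx])
      rw [hst, hfl, hfy, hfx, seg_sqV_of_nonneg s h0]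
    · have hlo : -1 < y₀ + N * t - i := ht.2.1
      have hfl : ⌊y₀ + N * t⌋ = i - 1 := by
        refine floor_eq_of_sub_mem ⟨?_, ?_⟩ <;> push_cast <;> linarith
      have hfy : Int.fract (y₀ + N * t) = y₀ + N * t - i + 1 := by
        rw [← Int.self_sub_floor, hfl]; push_cast; ring
      have hst : σ t = v.symm s := huniq t _ (by
        rw [hce t ht, sqV_of_nonpos s h0.le, hfy, hfx])
      have hd : N * (t₀ - t) ≠ 0 := by
        intro h1
        nlinarith
      have hN : N ≠ 0 := left_ne_zero_of_mul hd
      have htt : t₀ - t ≠ 0 := right_ne_zero_of_mul hd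
      set l := (i - (y₀ + N * t)) / (N * (t₀ - t)) with hl
      have hpos : 0 < N * (t₀ - t) := by nlinarith
      have hl0 : 0 ≤ l := div_nonneg (by linarith) hpos.le
      have hl1 : l ≤ 1 := (div_le_one hpos).2 (by nlinarith)
      have hmem := hKc ht ht₀ (sub_nonneg.2 hl1) hl0 (sub_add_cancel 1 l)
      have hy : y₀ + N * ((1 - l) • t + l • t₀) = i := by
        have h1 : l * (N * (t₀ - t)) = i - (y₀ + N * t) := div_mul_cancel₀ _ hd
        simp only [smul_eq_mul]
        linear_combination h1
      have hz : (e ((1 - l) • t + l • t₀)).2 = 0 := by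
        change y₀ + N * ((1 - l) • t + l • t₀) - i = 0
        rw [hy, sub_self]
      have hAi := hA hN i _ (v.symm s) _ hmem.1 hy (by
        rw [hce _ hmem, sqV_of_nonpos s hz.le, hz, zero_add])
      rw [hst, hfl, hfy, hfx, seg_sqV_of_neg s h0.le, ← hAi]
      abel
  filter_upwards [hKo.mem_nhds ht₀] with t ht
  refine ⟨hfloorx t ht, ?_⟩
  rw [hkey t ht, hkey t₀ ht₀]
  have h1 : seg c t₀ t = seg (sqV s) (e t₀) (e t) := by
    refine seg_congr fun l hl => ?_
    rw [← hecomb]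
    exact hce _ (hKc ht₀ ht (by linarith [hl.2]) hl.1 (by ring))
  have h2 := seg_add_seg convex_univ (continuous_sqV (h := h) (v := v) s).continuousOn
    (Set.mem_univ mid) (Set.mem_univ (e t₀)) (Set.mem_univ (e t))
  rw [h1, ← h2]
  abel

end SquareTiled

namespace SquareTiled

open TorusCover PathMod

variable {S : Type} {h v : Equiv.Perm S} {θ : ℤ × ℤ}

theorem sq_right_injective {s s' : S} {τ τ' : ℝ} (hτ : τ ∈ Set.Ioo (0 : ℝ) 1)
    (hτ' : τ' ∈ Set.Ioo (0 : ℝ) 1) (he : (sq s (1, τ) : SquareTiled h v) = sq s' (1, τ')) :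
    s = s' ∧ τ = τ' := by
  have h1 := congrArg (fun x => (proj x).2) he
  simp only [proj_sq s (e := (1, τ)) (by simp) (Set.Ioo_subset_Icc_self hτ),
    proj_sq s' (e := (1, τ')) (by simp) (Set.Ioo_subset_Icc_self hτ')] at h1
  obtain rfl := coe_eq_coe_of_mem_Ioo hτ hτ' h1
  rw [sq_right, sq_right] at he
  refine ⟨h.injective (sq_injective (e := (0, τ)) (by simp) (Set.Ioo_subset_Ico_self hτ) ?_ he), rfl⟩
  exact fun h0 => hτ.1.ne' (congrArg Prod.snd h0)

theorem sq_top_injective {s s' : S} {τ τ' : ℝ} (hτ : τ ∈ Set.Ioo (0 : ℝ) 1)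
    (hτ' : τ' ∈ Set.Ioo (0 : ℝ) 1) (he : (sq s (τ, 1) : SquareTiled h v) = sq s' (τ', 1)) :
    s = s' ∧ τ = τ' := by
  have h1 := congrArg (fun x => (proj x).1) he
  simp only [proj_sq s (e := (τ, 1)) (Set.Ioo_subset_Icc_self hτ) (by simp),
    proj_sq s' (e := (τ', 1)) (Set.Ioo_subset_Icc_self hτ') (by simp)] at h1
  obtain rfl := coe_eq_coe_of_mem_Ioo hτ hτ' h1
  rw [sq_top, sq_top] at he
  refine ⟨v.injective (sq_injective (e := (τ, 0)) (Set.Ioo_subset_Ico_self hτ) (by simp) ?_ he), rfl⟩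
  exact fun h0 => hτ.1.ne' (congrArg Prod.fst h0)

/-- The class of a closed geodesic, expressed by its crossings with the sides of the squares. -/
theorem IsClosedGeodesic.seg_eq_sum_crossings [Fintype S]
    (hs : ∀ x : SquareTiled h v, proj x = 0 → IsSingular x) {L : ℝ}
    {γ : C(UnitAddCircle, SquareTiled h v)} (hγ : IsClosedGeodesic θ L γ) {M N : ℤ}
    (hM : L * θ.1 = M) (hN : L * θ.2 = N) :
    seg (fun t : ℝ => γ (t : UnitAddCircle)) 0 1 =
      (M.sign : ℝ) • ∑ s, (Set.ncard {y | y ∈ Set.Ioo (0 : ℝ) 1 ∧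
        ∃ t : ℝ, γ (t : UnitAddCircle) = sq s (1, y)} : ℝ) • dualRight s +
      (N.sign : ℝ) • ∑ s, (Set.ncard {y | y ∈ Set.Ioo (0 : ℝ) 1 ∧
        ∃ t : ℝ, γ (t : UnitAddCircle) = sq s (y, 1)} : ℝ) • dualTop s := by
  set c : ℝ → SquareTiled h v := fun t => γ (t : UnitAddCircle) with hcdef
  have hc : Continuous c := γ.continuous.comp (AddCircle.continuous_mk' 1)
  have hc0 : ∀ t, proj (c t) ≠ 0 := fun t => hγ.proj_ne_zero hs _
  have hcc : ∀ t t', c t = c t' ↔ ∃ m : ℤ, t - t' = m := fun t t' => by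
    rw [hcdef]; simp only
    rw [hγ.injective.eq_iff, coe_eq_coe_iff_int]
  obtain ⟨⟨x₀, y₀⟩, hxy⟩ := toTorus_surjective (proj (γ 0))
  have hcp : ∀ t, proj (c t) = toTorus (x₀ + M * t, y₀ + N * t) := by
    intro t
    rw [hcdef]
    simp only
    rw [hγ.straight, ← hxy, ← toTorus_add]
    congr 1
    refine Prod.ext ?_ ?_ <;> simp [along, ← hM, ← hN] <;> ring
  choose σ hσ using fun t => exists_sq (c t) (hcp t)
  have hnot : ∀ t (i j : ℤ), ¬ (x₀ + M * t = i ∧ y₀ + N * t = j) := by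
    rintro t i j ⟨h1, h2⟩
    refine hc0 t ?_
    rw [hcp, h1, h2]
    exact Prod.ext (coe_eq_zero_iff_int.2 ⟨i, rfl⟩) (coe_eq_zero_iff_int.2 ⟨j, rfl⟩)
  have h11 : ((1 : ℝ) : UnitAddCircle) = 0 := AddCircle.coe_period 1
  obtain ⟨A, hA, hAM⟩ := exists_crossing_primitive
    (dualRight : S → PathMod (SquareTiled h v)) hcc M x₀
    (E := fun s τ => sq s (1, τ)) (fun s s' τ hτ τ' hτ' he => sq_right_injective hτ hτ' he)
    (by
      intro t
      constructor
      · rintro ⟨s, τ, hτ, he⟩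
        refine coe_eq_zero_iff_int.1 ?_
        have h1 := congrArg (fun x => (proj x).1) he
        simp only [proj_sq s (e := (1, τ)) (by simp) (Set.Ioo_subset_Icc_self hτ), hcp] at h1
        exact h1.trans h11
      · rintro ⟨i, hi⟩
        refine ⟨h.symm (σ t), Int.fract (y₀ + N * t), fract_mem_Ioo fun j hj => hnot t i j ⟨hi, hj⟩,
          ?_⟩
        rw [sq_right, Equiv.apply_symm_apply, hσ t, hi, Int.fract_intCast])
  obtain ⟨B, hB, hBN⟩ := exists_crossing_primitive
    (dualTop : S → PathMod (SquareTiled h v)) hcc N y₀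
    (E := fun s τ => sq s (τ, 1)) (fun s s' τ hτ τ' hτ' he => sq_top_injective hτ hτ' he)
    (by
      intro t
      constructor
      · rintro ⟨s, τ, hτ, he⟩
        refine coe_eq_zero_iff_int.1 ?_
        have h1 := congrArg (fun x => (proj x).2) he
        simp only [proj_sq s (e := (τ, 1)) (Set.Ioo_subset_Icc_self hτ) (by simp), hcp] at h1
        exact h1.trans h11
      · rintro ⟨i, hi⟩
        refine ⟨v.symm (σ t), Int.fract (x₀ + M * t), fract_mem_Ioo fun j hj => hnot t j i ⟨hj, hi⟩,
          ?_⟩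
        rw [sq_top, Equiv.apply_symm_apply, hσ t, hi, Int.fract_intCast])
  -- The part of the line up to time `t`, minus the crossings so far and minus the path from the
  -- middle of the current square. It is locally constant, hence takes the same value at `0` and
  -- `1`.
  let G : ℝ → PathMod (SquareTiled h v) := fun t => seg c 0 t -
    seg (sq (σ t)) mid (Int.fract (x₀ + M * t), Int.fract (y₀ + N * t)) -
    A ⌊x₀ + M * t⌋ - B ⌊y₀ + N * t⌋
  have hG : IsLocallyConstant G := by
    rw [IsLocallyConstant.iff_eventually_eq]
    intro t₀
    have hadd : ∀ t, seg c 0 t = seg c 0 t₀ + seg c t₀ t := fun t =>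
      (seg_add_seg convex_univ hc.continuousOn (Set.mem_univ _) (Set.mem_univ _)
        (Set.mem_univ _)).symm
    by_cases hy : ∀ j : ℤ, y₀ + N * t₀ ≠ j
    · filter_upwards [eventually_seg_eq_right hc hcp hc0 hσ
        (fun hM0 => hA (by exact_mod_cast hM0)) hy] with t ⟨h1, h2⟩
      simp only [G]
      rw [hadd t, h1, h2]
      abel
    · push Not at hy
      obtain ⟨j, hj⟩ := hy
      filter_upwards [eventually_seg_eq_top hc hcp hc0 hσ
        (fun hN0 => hB (by exact_mod_cast hN0)) (fun i hi => hnot t₀ i j ⟨hi, hj⟩)]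
        with t ⟨h1, h2⟩
      simp only [G]
      rw [hadd t, h1, h2]
      abel
  have h01 := hG.apply_eq_of_isPreconnected isPreconnected_univ (Set.mem_univ (1 : ℝ))
    (Set.mem_univ (0 : ℝ))
  -- The curve closes up in the same square, so the paths from the middle cancel and only the
  -- increments of `A` by `M` steps and of `B` by `N` steps remain.
  have hσ01 : σ 1 = σ 0 := by
    have h1 : c 1 = c 0 := (hcc _ _).2 ⟨1, by simp⟩
    rw [hσ 1, hσ 0] at h1
    simp only [mul_one, mul_zero, add_zero, Int.fract_add_intCast] at h1
    refine sq_injective ⟨Int.fract_nonneg _, Int.fract_lt_one _⟩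
      ⟨Int.fract_nonneg _, Int.fract_lt_one _⟩ ?_ h1
    intro h0
    refine hc0 0 ?_
    rw [hσ 0]
    simp only [mul_zero, add_zero]
    rw [h0, proj_sq] <;> simp [toTorus]
  have hz : seg c 0 0 = 0 := seg_self convex_univ hc.continuousOn (Set.mem_univ _)
  simp only [G, hσ01, mul_one, mul_zero, add_zero, Int.fract_add_intCast, Int.floor_add_intCast,
    hz, zero_sub] at h01
  rw [← hAM ⌊x₀⌋, ← hBN ⌊y₀⌋]
  rw [← sub_eq_zero] at h01 ⊢
  rw [← h01]
  abel

end SquareTiled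

/-! ### Variation of a height along a segment as a count of crossings with the waist curve. -/

namespace IsCylinderChart

open TorusCover PathMod

variable {X ι : Type} [TopologicalSpace X] {p : X → FlatTorus} {n : ℤ} {D : ι → ℝ × ℝ → X}

/-- The index of the cylinder that contains `q s` is locally constant, since cylinders are open. -/
theorem exists_crossing (hp : IsCoveringMapOn p {0}ᶜ) (hD : IsCylinderChart p n D) {q : ℝ → X} (hq : Continuous q)
    (hqp : ∀ s ∈ Set.Ioo (0 : ℝ) 1, (p (q s)).2 = (s : UnitAddCircle)) :
    ∃ g, ∃ φ : ℝ → ℝ, ∀ s ∈ Set.Ioo (0 : ℝ) 1, q s = D g (φ s, s) := by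
  have h1 : ∀ s ∈ Set.Ioo (0 : ℝ) 1, ∃ g x, q s = D g (x, s) := by
    intro s hs
    obtain ⟨g, e, he, hge⟩ := hD.cover (q s) (by rw [hqp s hs]; exact coe_ne_zero_of_mem_Ioo hs)
    refine ⟨g, e.1, ?_⟩
    have h2 : e.2 = s := by
      refine coe_eq_coe_of_mem_Ioo he hs ?_
      rw [← hqp s hs, ← hge, (hD.lift g).proj_eq e he]
      rfl
    rw [← hge, ← h2]
  have hhalf : (1 / 2 : ℝ) ∈ Set.Ioo (0 : ℝ) 1 := by constructor <;> norm_num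
  have : Nonempty ι := ⟨(h1 _ hhalf).choose⟩
  choose! ind φ hφ using h1
  have hlc : IsLocallyConstant fun s : Set.Ioo (0 : ℝ) 1 => ind s := by
    rw [IsLocallyConstant.iff_eventually_eq]
    intro s
    have hU := ((hD.lift (ind s)).isOpen_image hp).mem_nhds
      (Set.mem_image_of_mem _ (show (φ s, (s : ℝ)) ∈ strip from s.2))
    rw [← hφ s s.2] at hU
    filter_upwards [(hq.comp continuous_subtype_val).continuousAt.eventually_mem hU] with s' hs'
    obtain ⟨e, he, hge⟩ := hs'
    change _ = q s' at hge
    rw [hφ s' s'.2] at hge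
    exact (hD.inj _ _ _ he _ (show (φ s', (s' : ℝ)) ∈ strip from s'.2) hge).1.symm
  have hpre := isPreconnected_iff_preconnectedSpace.1 (isPreconnected_Ioo (a := (0 : ℝ)) (b := 1))
  refine ⟨ind (1 / 2), φ, fun s hs => ?_⟩
  have h2 := hlc.apply_eq_of_isPreconnected isPreconnected_univ
    (Set.mem_univ (⟨s, hs⟩ : Set.Ioo (0 : ℝ) 1)) (Set.mem_univ ⟨1 / 2, hhalf⟩)
  simp only at h2
  rw [hφ s hs, h2]

variable (hp : IsCoveringMapOn p {0}ᶜ) (hpc : Continuous p) (hD : IsCylinderChart p n D)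

/-- The path rises through `m` cylinders. A piece contributes `1` exactly when its cylinder is `g`,
and then it meets the waist curve once, at the height of this curve. -/
theorem deg_height_eq_ncard_of_pos {w : ι → ℝ × ℝ} (hw : ∀ g, w g ∈ strip)
    {c : ι → ℝ → X} (hc : ∀ g t, c g t = D g ((w g).1 + n * t, (w g).2)) (g : ι)
    {ε : ℝ → X} (hε : Continuous ε) {m : ℕ} (hm : 0 < m)
    (hεp : ∀ y ∈ Set.Icc (0 : ℝ) 1, (p (ε y)).2 = ((m * y : ℝ) : UnitAddCircle)) :
    deg (hD.height hp hpc g) (seg ε 0 1) =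
      (Set.ncard {y | y ∈ Set.Ioo (0 : ℝ) 1 ∧ ∃ t, c g t = ε y} : ℝ) := by
  classical
  have hmr : (0 : ℝ) < m := by exact_mod_cast hm
  have hn : (n : ℝ) ≠ 0 := by exact_mod_cast hD.pos.ne'
  let q : ℕ → ℝ → X := fun j s => ε ((j + s) / m)
  have hq : ∀ j, Continuous (q j) := fun j => hε.comp (by fun_prop)
  have hqm : ∀ j < m, ∀ s ∈ Set.Icc (0 : ℝ) 1, (j + s) / m ∈ Set.Icc (0 : ℝ) 1 := by
    intro j hj s hs
    have h1 : (j : ℝ) + 1 ≤ m := by exact_mod_cast hj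
    have h2 : (0 : ℝ) ≤ j := by positivity
    exact ⟨div_nonneg (by linarith [hs.1]) hmr.le, (div_le_one hmr).2 (by linarith [hs.2])⟩
  have hqp : ∀ j < m, ∀ s ∈ Set.Icc (0 : ℝ) 1, (p (q j s)).2 = (s : UnitAddCircle) := by
    intro j hj s hs
    rw [hεp _ (hqm j hj s hs), mul_div_cancel₀ _ hmr.ne']
    exact coe_eq_coe_iff_int.2 ⟨j, by simp⟩
  have hex : ∀ j < m, ∃ g, ∃ φ : ℝ → ℝ, ∀ s ∈ Set.Ioo (0 : ℝ) 1, q j s = D g (φ s, s) :=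
    fun j hj => exists_crossing hp hD (hq j) fun s hs => hqp j hj s (Set.Ioo_subset_Icc_self hs)
  have : Nonempty ι := ⟨g⟩
  choose! ind φ hφ using hex
  have hdeg : ∀ j < m, deg (hD.height hp hpc g) (seg (q j) 0 1) = if g = ind j then 1 else 0 := by
    intro j hj
    refine hD.deg_height_crossing hp hpc g (ind j) (hq j) ?_ ?_ (hφ j hj)
    · rw [hqp j hj 0 (by simp)]; rfl
    · rw [hqp j hj 1 (by simp)]; exact AddCircle.coe_period 1
  have hcut : ∀ k : ℕ, seg ε 0 ((k : ℝ) / m) = ∑ j ∈ Finset.range k, seg (q j) 0 1 := by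
    intro k
    induction k with
    | zero => simpa using seg_self convex_univ hε.continuousOn (Set.mem_univ 0)
    | succ k ih =>
      rw [Finset.sum_range_succ, ← ih, ← seg_add_seg convex_univ hε.continuousOn (Set.mem_univ 0)
        (Set.mem_univ ((k : ℝ) / m)) (Set.mem_univ (((k + 1 : ℕ) : ℝ) / m))]
      congr 1
      refine seg_congr fun t _ => ?_
      simp only [q]
      congr 1
      push_cast
      simp only [smul_eq_mul]
      field_simp
      ring
  have hm1 := hcut m
  rw [div_self hmr.ne'] at hm1
  rw [hm1, map_sum, Finset.sum_congr rfl fun j hj => hdeg j (Finset.mem_range.1 hj),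
    Finset.sum_boole]
  congr 1
  rw [← Set.ncard_coe_finset]
  have hh := hw g
  refine Set.ncard_congr (fun j _ => ((j : ℝ) + (w g).2) / m) ?_ ?_ ?_
  · intro j hj
    obtain ⟨hj, hgj⟩ := Finset.mem_filter.1 hj
    rw [Finset.mem_range] at hj
    have h1 : (j : ℝ) + 1 ≤ m := by exact_mod_cast hj
    have h2 : (0 : ℝ) ≤ j := by positivity
    refine ⟨⟨div_pos (by linarith [hh.1]) hmr, (div_lt_one hmr).2 (by linarith [hh.2])⟩, ?_⟩
    have h3 := hφ j hj _ hh
    rw [← hgj] at h3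
    refine ⟨(φ j (w g).2 - (w g).1) / n, ?_⟩
    rw [hc, mul_div_cancel₀ _ hn, add_sub_cancel]
    exact h3.symm
  · intro j k _ _ hjk
    rw [div_left_inj' hmr.ne', add_left_inj] at hjk
    exact_mod_cast hjk
  · rintro y ⟨hy, t, ht⟩
    have h1 : ((m * y : ℝ) : UnitAddCircle) = ((w g).2 : UnitAddCircle) := by
      rw [← hεp y (Set.Ioo_subset_Icc_self hy), ← ht, hc,
        (hD.lift g).proj_eq ((w g).1 + n * t, (w g).2) hh]
      rfl
    obtain ⟨i, hi⟩ := coe_eq_coe_iff_int.1 h1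
    have hmy : m * y < m := by nlinarith [hy.2]
    have hmy0 : 0 < m * y := mul_pos hmr hy.1
    have hi0 : -1 < i := by
      have : (-1 : ℝ) < i := by rw [← hi]; linarith [hh.2]
      exact_mod_cast this
    obtain ⟨j, rfl⟩ := Int.eq_ofNat_of_zero_le (show 0 ≤ i by omega)
    push_cast at hi
    have hjm : j < m := by
      have : (j : ℝ) < m := by rw [← hi]; linarith [hh.1]
      exact_mod_cast this
    have hyj : ((j : ℝ) + (w g).2) / m = y := by
      rw [div_eq_iff hmr.ne']; linarith
    refine ⟨j, ?_, hyj⟩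
    simp only [Finset.coe_filter, Finset.mem_range, Set.mem_ofPred_eq]
    refine ⟨hjm, ?_⟩
    have h3 := hφ j hjm _ hh
    simp only [q, hyj] at h3
    rw [← ht, hc] at h3
    exact (hD.inj _ _ ((w g).1 + n * t, (w g).2) hh (φ j (w g).2, (w g).2) hh h3).1

/-- A negative slope is reduced to a positive one by reversing the path, which preserves the set of
crossings up to reflection. -/
theorem deg_height_eq_ncard {w : ι → ℝ × ℝ} (hw : ∀ g, w g ∈ strip)
    {c : ι → ℝ → X} (hc : ∀ g t, c g t = D g ((w g).1 + n * t, (w g).2)) (g : ι)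
    {ε : ℝ → X} (hε : Continuous ε) (m : ℤ)
    (hεp : ∀ y ∈ Set.Icc (0 : ℝ) 1, (p (ε y)).2 = ((m * y : ℝ) : UnitAddCircle)) :
    deg (hD.height hp hpc g) (seg ε 0 1) =
      m.sign * (Set.ncard {y | y ∈ Set.Ioo (0 : ℝ) 1 ∧ ∃ t, c g t = ε y} : ℝ) := by
  rcases lt_trichotomy m 0 with hm | rfl | hm
  · obtain ⟨k, rfl⟩ : ∃ k : ℕ, m = -k := ⟨m.natAbs, by omega⟩
    have h1 := hD.deg_height_eq_ncard_of_pos hp hpc hw hc g (ε := fun y => ε (1 - y))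
      (hε.comp (by fun_prop)) (m := k) (by omega) (fun y hy => by
        rw [hεp _ ⟨by linarith [hy.2], by linarith [hy.1]⟩]
        refine coe_eq_coe_iff_int.2 ⟨-k, ?_⟩
        push_cast
        ring)
    have h2 : seg (fun y => ε (1 - y)) 0 1 = - seg ε 0 1 := by
      rw [← seg_symm convex_univ hε.continuousOn (Set.mem_univ _) (Set.mem_univ _)]
      refine seg_congr fun t _ => ?_
      congr 1
      simp
    have h3 : Set.ncard {y | y ∈ Set.Ioo (0 : ℝ) 1 ∧ ∃ t, c g t = ε (1 - y)} =
        Set.ncard {y | y ∈ Set.Ioo (0 : ℝ) 1 ∧ ∃ t, c g t = ε y} := by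
      refine Set.ncard_congr (fun y _ => 1 - y) ?_ ?_ ?_
      · rintro y ⟨hy, ht⟩
        exact ⟨⟨by linarith [hy.2], by linarith [hy.1]⟩, ht⟩
      · intro y z _ _ hyz
        linarith
      · rintro y ⟨hy, ht⟩
        exact ⟨1 - y, ⟨⟨by linarith [hy.2], by linarith [hy.1]⟩, by simpa using ht⟩, by ring⟩
    rw [h2, map_neg, h3] at h1
    rw [Int.sign_eq_neg_one_of_neg hm]
    push_cast
    linarith
  · rw [deg_seg _ (convex_Icc (0 : ℝ) 1) hε.continuousOn (by simp) (by simp) (φ := fun _ => 0)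
      continuousOn_const]
    · simp
    · intro y hy
      rw [hD.height_of_snd_eq_zero hp hpc]
      · rfl
      · rw [hεp y hy]
        simp
  · obtain ⟨k, rfl⟩ := Int.eq_ofNat_of_zero_le hm.le
    rw [hD.deg_height_eq_ncard_of_pos hp hpc hw hc g hε (by omega) hεp, Int.sign_eq_one_of_pos hm]
    simp

end IsCylinderChart

/-! ### Duality between waist curves and heights. -/

namespace SquareTiled

open TorusCover PathMod

variable {S : Type} [Fintype S] {h v : Equiv.Perm S} {θ : ℤ × ℤ}

/-- Duality between the class of a waist curve and the height in its cylinder. -/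
theorem IsCylinderDecomposition.seg_eq_sum_deg
    (hs : ∀ x : SquareTiled h v, proj x = 0 → IsSingular x) (f : Frame θ) {ι : Type} {L : ℝ}
    {c : ι → C(UnitAddCircle, SquareTiled h v)} (hc : IsCylinderDecomposition θ L c)
    {n : ℤ} {D : ι → ℝ × ℝ → SquareTiled h v} {w : ι → ℝ × ℝ} (hD : IsCylinderChart f.proj n D)
    (hw : ∀ g, w g ∈ strip)
    (hcD : ∀ g (t : ℝ), c g (t : UnitAddCircle) = D g ((w g).1 + n * t, (w g).2))
    (g : ι) :
    ofH1 _ (loopClass (c g)) =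
      ∑ s, (deg (hD.height f.isCoveringMapOn_proj f.continuous_proj g)
        (seg (sq s) (1, 0) (1, 1)) • dualRight s -
      deg (hD.height f.isCoveringMapOn_proj f.continuous_proj g)
        (seg (sq s) (0, 1) (1, 1)) • dualTop s) := by
  have hp := f.isCoveringMapOn_proj (h := h) (v := v)
  have hcg := hc.geodesic g
  have hk : (0 : ℝ) < f.k * L := mul_pos (by exact_mod_cast f.k_pos) hcg.pos
  have hint : ∃ M N : ℤ, L * θ.1 = M ∧ L * θ.2 = N := by
    have h1 := hcg.straight 1
    have h2 : ((1 : ℝ) : UnitAddCircle) = 0 := AddCircle.coe_period 1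
    rw [h2, mul_one, left_eq_add] at h1
    obtain ⟨m, hm⟩ := coe_eq_zero_iff_int.1 (congrArg Prod.fst h1)
    obtain ⟨n, hn⟩ := coe_eq_zero_iff_int.1 (congrArg Prod.snd h1)
    exact ⟨m, n, hm, hn⟩
  obtain ⟨M, N, hM, hN⟩ := hint
  have hsign : ∀ {a M : ℤ}, (M : ℝ) = f.k * L * a → M.sign = a.sign := by
    intro a M h1
    rcases lt_trichotomy a 0 with ha | rfl | ha
    · have : (M : ℝ) < 0 := by
        rw [h1]; exact mul_neg_of_pos_of_neg hk (by exact_mod_cast ha)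
      rw [Int.sign_eq_neg_one_of_neg ha, Int.sign_eq_neg_one_of_neg (by exact_mod_cast this)]
    · have : M = 0 := by simpa using h1
      rw [this]
    · have : (0 : ℝ) < M := by
        rw [h1]; exact mul_pos hk (by exact_mod_cast ha)
      rw [Int.sign_eq_one_of_pos ha, Int.sign_eq_one_of_pos (by exact_mod_cast this)]
  have h1 : (θ.1 : ℝ) = f.k * f.a := by exact_mod_cast f.fst_eq
  have h2 : (θ.2 : ℝ) = f.k * f.b := by exact_mod_cast f.snd_eq
  have hMs : M.sign = f.a.sign := hsign (by rw [← hM, h1]; ring)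
  have hNs : N.sign = f.b.sign := hsign (by rw [← hN, h2]; ring)
  have hright : ∀ s, deg (hD.height hp f.continuous_proj g) (seg (sq s) (1, 0) (1, 1)) =
      f.a.sign * (Set.ncard {y | y ∈ Set.Ioo (0 : ℝ) 1 ∧
        ∃ t : ℝ, c g (t : UnitAddCircle) = sq s (1, y)} : ℝ) := by
    intro s
    have e1 : seg (sq s : _ → SquareTiled h v) (1, 0) (1, 1) = seg (fun y : ℝ => sq s (1, y)) 0 1 :=
      seg_congr fun t _ => by rw [comb_mk]; simp
    rw [e1]
    refine hD.deg_height_eq_ncard hp f.continuous_proj hw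
      (c := fun g (t : ℝ) => c g (t : UnitAddCircle)) hcD g
      ((continuous_sq s).comp (by fun_prop)) f.a fun y hy => ?_
    change (f.proj (sq s (1, y))).2 = _
    rw [Frame.proj, proj_sq s (e := (1, y)) (by simp) hy, f.torusMap_toTorus]
    -- On the right side of a square the height is `a y - b`, of slope `a`; on the top side it is `a
    -- - b y`, of slope `-b`. This is the origin of the opposite signs in the formula.
    exact coe_eq_coe_iff_int.2 ⟨-f.b, by simp [Frame.lin]⟩
  have htop : ∀ s, deg (hD.height hp f.continuous_proj g) (seg (sq s) (0, 1) (1, 1)) =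
      (-f.b).sign * (Set.ncard {y | y ∈ Set.Ioo (0 : ℝ) 1 ∧
        ∃ t : ℝ, c g (t : UnitAddCircle) = sq s (y, 1)} : ℝ) := by
    intro s
    have e1 : seg (sq s : _ → SquareTiled h v) (0, 1) (1, 1) = seg (fun y : ℝ => sq s (y, 1)) 0 1 :=
      seg_congr fun t _ => by rw [comb_mk]; simp
    rw [e1]
    refine hD.deg_height_eq_ncard hp f.continuous_proj hw
      (c := fun g (t : ℝ) => c g (t : UnitAddCircle)) hcD g
      ((continuous_sq s).comp (by fun_prop)) (-f.b) fun y hy => ?_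
    change (f.proj (sq s (y, 1))).2 = _
    rw [Frame.proj, proj_sq s (e := (y, 1)) hy (by simp), f.torusMap_toTorus]
    refine coe_eq_coe_iff_int.2 ⟨f.a, ?_⟩
    simp [Frame.lin]
  rw [ofH1_loopClass, hcg.seg_eq_sum_crossings hs hM hN, hMs, hNs, Finset.sum_sub_distrib,
    sub_eq_add_neg, ← Finset.sum_neg_distrib, Finset.smul_sum, Finset.smul_sum]
  congr 1
  · refine Finset.sum_congr rfl fun s _ => ?_
    rw [hright, mul_smul]
  · refine Finset.sum_congr rfl fun s _ => ?_
    rw [htop, Int.sign_neg, ← neg_smul, smul_smul]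
    push_cast
    congr 1
    ring

end SquareTiled

/-! ### Linear algebra -/

/-- There are as many independent functionals as the dimension, so they span the dual space and
cannot all vanish at `u ≠ 0`. -/
theorem exists_functional_ne_zero {V κ : Type} [AddCommGroup V] [Module ℝ V] [Fintype κ]
    {b : κ → V} (hb : LinearIndependent ℝ b) (hspan : Submodule.span ℝ (Set.range b) = ⊤)
    {φ : κ → V →ₗ[ℝ] ℝ} (hφ : ∀ x : κ → ℝ, (∀ u, ∑ i, x i * φ i u = 0) → x = 0) {u : V}
    (hu : u ≠ 0) : ∃ i, φ i u ≠ 0 := by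
  let B : Module.Basis κ ℝ V := Module.Basis.mk hb hspan.ge
  have := Module.Finite.of_basis B
  have hli : LinearIndependent ℝ φ := by
    rw [Fintype.linearIndependent_iff]
    intro x hx
    refine congrFun (hφ x fun u => ?_)
    simpa [LinearMap.sum_apply] using congrArg (fun f : V →ₗ[ℝ] ℝ => f u) hx
  have htop := hli.span_eq_top_of_card_eq_finrank' (by
    rw [← Module.finrank_eq_card_basis B]
    exact (Subspace.dual_finrank_eq).symm)
  by_contra! h0
  refine hu ((Module.forall_dual_apply_eq_zero_iff ℝ u).1 fun f => ?_)
  have hf : f ∈ Submodule.span ℝ (Set.range φ) := htop ▸ Submodule.mem_top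
  refine Submodule.span_induction (p := fun f _ => f u = 0) ?_ ?_ ?_ ?_ hf
  · rintro _ ⟨i, rfl⟩
    exact h0 i
  · simp
  · intro f g _ _ hf hg
    rw [LinearMap.add_apply, hf, hg, add_zero]
  · intro a f _ hf
    rw [LinearMap.smul_apply, hf, smul_zero]

/-- Non-degeneracy moves a non-zero vector of `W` into some `C_r`, and injectivity of `N r₀` on
`C_r` moves it into `C_{r₀}`. The hypothesis `h5` fills `C_{r₀}`, and equality of dimensions makes
each `N s` map it onto `C_s`. -/
theorem eq_top_of_transvections {V : Type} [AddCommGroup V] [Module ℝ V] {ι : Type} [Fintype ι]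
    {b : ι → Fin 4 → V} (hb : LinearIndependent ℝ fun x : ι × Fin 4 => b x.1 x.2)
    (hspan : Submodule.span ℝ (Set.range fun x : ι × Fin 4 => b x.1 x.2) = ⊤)
    {N : ι → V →ₗ[ℝ] V} {φ : ι → Fin 4 → V →ₗ[ℝ] ℝ}
    (hN : ∀ r u, N r u = ∑ a, φ r a u • b r a)
    (hφ : ∀ x : ι × Fin 4 → ℝ, (∀ u, ∑ i, x i * φ i.1 i.2 u = 0) → x = 0)
    (h4 : ∀ r s, r ≠ s → ∀ u ∈ Submodule.span ℝ (Set.range (b r)), u ≠ 0 → N s u ≠ 0)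
    {r₀ r₁ : ι} {I : Set ι}
    (h5 : ∀ u ∈ Submodule.span ℝ (Set.range (b r₀)), u ≠ 0 →
      Submodule.span ℝ (Set.range (b r₀)) ≤
        Submodule.span ℝ ({u} ∪ {w | ∃ r ∈ I, w = N r₀ (N r (N r₁ u))}))
    {W : Submodule ℝ V} (hW : W ≠ ⊥) (hNW : ∀ r, ∀ u ∈ W, N r u ∈ W) : W = ⊤ := by
  classical
  have hNmem : ∀ r u, N r u ∈ Submodule.span ℝ (Set.range (b r)) := fun r u => by
    rw [hN]
    exact Submodule.sum_mem _ fun a _ =>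
      Submodule.smul_mem _ _ (Submodule.subset_span (Set.mem_range_self a))
  have hbr : ∀ r, LinearIndependent ℝ (b r) := fun r =>
    hb.comp (fun a => (r, a)) fun a a' h => congrArg Prod.snd h
  obtain ⟨u, huW, hu⟩ := Submodule.exists_mem_ne_zero_of_ne_bot hW
  obtain ⟨⟨r, a⟩, hra⟩ := exists_functional_ne_zero hb hspan hφ hu
  have hNr : N r u ≠ 0 := fun h0 => by
    rw [hN] at h0
    exact hra (Fintype.linearIndependent_iff.1 (hbr r) (fun a => φ r a u) h0 a)
  obtain ⟨w, hwW, hwC, hw⟩ : ∃ w ∈ W, w ∈ Submodule.span ℝ (Set.range (b r₀)) ∧ w ≠ 0 := by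
    by_cases hr : r = r₀
    · subst hr
      exact ⟨_, hNW r u huW, hNmem r u, hNr⟩
    · exact ⟨_, hNW r₀ _ (hNW r u huW), hNmem _ _, h4 r r₀ hr _ (hNmem r u) hNr⟩
  have hC0 : Submodule.span ℝ (Set.range (b r₀)) ≤ W := by
    refine (h5 w hwC hw).trans (Submodule.span_le.2 ?_)
    rintro x (hx | ⟨r, -, rfl⟩)
    · rw [Set.mem_singleton_iff.1 hx]
      exact hwW
    · exact hNW _ _ (hNW _ _ (hNW _ _ hwW))
  have hC : ∀ s, Submodule.span ℝ (Set.range (b s)) ≤ W := by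
    intro s
    by_cases hs : r₀ = s
    · exact hs ▸ hC0
    let f : Submodule.span ℝ (Set.range (b r₀)) →ₗ[ℝ] Submodule.span ℝ (Set.range (b s)) :=
      (N s).restrict fun u _ => hNmem s u
    have hinj : Function.Injective f := by
      rw [← LinearMap.ker_eq_bot, LinearMap.ker_eq_bot']
      intro x hx
      by_contra hx0
      exact h4 r₀ s hs x x.2 (fun h => hx0 (Subtype.ext h)) (congrArg Subtype.val hx)
    have := FiniteDimensional.span_of_finite ℝ (Set.finite_range (b r₀))
    have := FiniteDimensional.span_of_finite ℝ (Set.finite_range (b s))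
    have hsurj : Function.Surjective f :=
      (LinearMap.injective_iff_surjective_of_finrank_eq_finrank (by
        rw [finrank_span_eq_card (hbr r₀), finrank_span_eq_card (hbr s)])).1 hinj
    intro y hy
    obtain ⟨x, hx⟩ := hsurj ⟨y, hy⟩
    have hxy : N s x = y := congrArg Subtype.val hx
    rw [← hxy]
    exact hNW s _ (hC0 x.2)
  rw [eq_top_iff, ← hspan, Submodule.span_le]
  rintro _ ⟨⟨r, a⟩, rfl⟩
  exact hC r (Submodule.subset_span (Set.mem_range_self a))

/-! ### The symmetry of the cylinders -/

namespace Q8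

theorem neg_mul_neg_mul (g : Q8) : neg * (neg * g) = g := by
  revert g
  decide

theorem sum_eq_sum_plus {V : Type} [AddCommMonoid V] (G : Q8 → V) :
    ∑ g, G g = ∑ a, (G (plus a) + G (neg * plus a)) := by
  have h1 : Function.Bijective fun x : Fin 4 × Bool =>
      if x.2 then plus x.1 else neg * plus x.1 := by decide
  rw [← h1.sum_comp, Fintype.sum_prod_type]
  simp

theorem exists_plus (g : Q8) : ∃ a, g = plus a ∨ g = neg * plus a := by
  revert g
  decide

/-- A module with elements that are permuted by `Q8` like the elements of the group. -/
theorem injective_of_linearIndependent {V : Type} [AddCommGroup V] [Module ℝ V] {C : Q8 → V}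
    {ρ : Q8 → V →ₗ[ℝ] V} (hρ : ∀ g h, ρ h (C g) = C (h * g))
    (hC : LinearIndependent ℝ fun a => C (plus a) - C (neg * plus a)) :
    Function.Injective C := by
  have hplus : C 1 - C neg ≠ 0 := by
    have := hC.ne_zero 0
    simpa [plus] using this
  -- Acting by `-1` on `C 1 = C x` shows that the difference attached to `1` is plus or minus the
  -- one attached to some `plus a`. By independence only `x = 1` is possible.
  have key : ∀ x, C 1 = C x → x = 1 := by
    intro x hx
    obtain ⟨a, rfl | rfl⟩ := exists_plus x
    · have h1 : C neg = C (neg * plus a) := by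
        rw [← hρ, ← hx, hρ, mul_one]
      by_cases ha : a = 0
      · subst ha; rfl
      exfalso
      apply ha
      apply hC.injective
      simp only
      rw [← hx, ← h1]
      simp [plus]
    · have h1 : C neg = C (plus a) := by
        have : C (neg * 1) = C (neg * (neg * plus a)) := by rw [← hρ, hx, hρ]
        rwa [mul_one, neg_mul_neg_mul] at this
      exfalso
      by_cases ha : a = 0
      · subst ha
        exact hplus (sub_eq_zero.2 (by simpa [plus] using hx))
      have h2 := Fintype.linearIndependent_iff.1 hC
        (fun b => if b = 0 then 1 else if b = a then 1 else 0) (by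
          have h3 : ∀ b : Fin 4, (if b = 0 then (1 : ℝ) else if b = a then 1 else 0) =
              (if b = 0 then 1 else 0) + (if b = a then 1 else 0) := by
            intro b
            by_cases h0 : b = 0
            · subst h0
              simp [Ne.symm ha]
            · simp [h0]
          simp only [h3, add_smul, Finset.sum_add_distrib, ite_smul, one_smul, zero_smul,
            Finset.sum_ite_eq', Finset.mem_univ, if_true]
          rw [← h1, ← hx]
          simp [plus]) 0
      simp at h2
  intro g g' h
  have h1 : C 1 = C (g⁻¹ * g') := by
    rw [← hρ, ← h, hρ, inv_mul_cancel]
  have h2 := key _ h1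
  exact (inv_mul_eq_one.1 h2)

end Q8

namespace IsCylinderChart

open TorusCover PathMod

variable {X ι : Type} [TopologicalSpace X] {p : X → FlatTorus} {n : ℤ} {D : ι → ℝ × ℝ → X}
  (hp : IsCoveringMapOn p {0}ᶜ) (hpc : Continuous p) (hD : IsCylinderChart p n D)

theorem deg_height_waist (g g' : ι) {e : ℝ × ℝ} (he : e ∈ strip) (x : ℝ) :
    deg (hD.height hp hpc g) (seg (D g') e (x, e.2)) = 0 := by
  obtain ⟨y, hy⟩ : ∃ y : ℝ, (y : UnitAddCircle) = hD.height hp hpc g (D g' e) :=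
    QuotientAddGroup.mk_surjective _
  have hK : Convex ℝ {w : ℝ × ℝ | w.2 = e.2} :=
    (convex_singleton e.2).linear_preimage (LinearMap.snd ℝ ℝ ℝ)
  have hsub : ∀ w ∈ {w : ℝ × ℝ | w.2 = e.2}, w ∈ strip := fun w hw => by
    have h0 : w.2 = e.2 := hw
    change w.2 ∈ Set.Ioo (0 : ℝ) 1
    rw [h0]
    exact he
  rw [deg_seg _ hK ((hD.lift g').continuousOn.mono hsub) (A := e) (B := (x, e.2)) rfl rfl
    (φ := fun _ => y) continuousOn_const, sub_self]
  intro w hw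
  rw [hy]
  by_cases hg : g = g'
  · subst hg
    rw [hD.height_self hp hpc g he, hD.height_self hp hpc g (hsub w hw), hw]
  · rw [hD.height_of_ne hp hpc hg he, hD.height_of_ne hp hpc hg (hsub w hw)]

/-- A homeomorphism over the torus permutes the cylinders. -/
theorem exists_shift (hp : IsCoveringMapOn p {0}ᶜ) (hD : IsCylinderChart p n D) (φ : X ≃ₜ X) (hφ : ∀ x, p (φ x) = p x) (g : ι) :
    ∃ (g' : ι) (k : ℤ), ∀ e ∈ strip, φ (D g e) = D g' (e.1 + k, e.2) := by
  have hlift : IsStripLift p (fun e => φ (D g e)) :=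
    ⟨φ.continuous.comp_continuousOn (hD.lift g).continuousOn, fun e he => by
      rw [hφ, (hD.lift g).proj_eq e he]⟩
  have he : ((1 / 2, 1 / 2) : ℝ × ℝ) ∈ strip := by constructor <;> norm_num
  obtain ⟨g', e', he', hge⟩ := hD.cover _ (hlift.snd_ne_zero he)
  obtain ⟨-, k, -, hk⟩ := (hD.lift g').eq_of_meet hp hlift he' he hge
  exact ⟨g', k, fun e he => (hk e he).symm⟩

end IsCylinderChart

namespace QCover

open SquareTiled TorusCover PathMod Q8

variable {d : ℕ}

/-- A multitwist acts on the classes of closed geodesics by transvections along the waist curves. -/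
structure IsTransvection (c : Q8 → C(UnitAddCircle, QCover d)) (T : QCover d ≃ₜ QCover d)
    (m : ℝ) (F : Q8 → PathMod (QCover d) →ₗ[ℝ] ℝ) : Prop where
  ne_zero : m ≠ 0
  mem_affStar : T ∈ AffStar d
  twist_sub : ∀ {η : ℤ × ℤ} {L : ℝ} {γ : C(UnitAddCircle, QCover d)}, IsClosedGeodesic η L γ →
    PathMod.map (T : C(QCover d, QCover d)) (ofH1 _ (loopClass γ)) - ofH1 _ (loopClass γ) =
      m • ∑ g, F g (ofH1 _ (loopClass γ)) • ofH1 _ (loopClass (c g))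
  dual : ∀ g, ofH1 _ (loopClass (c g)) = ∑ s, (F g (seg (sq s) (1, 0) (1, 1)) • dualRight s -
    F g (seg (sq s) (0, 1) (1, 1)) • dualTop s)
  deck_neg : ∀ g u, F g (PathMod.map (deck d neg : C(QCover d, QCover d)) u) = F (neg * g) u
  waist : ∀ g g', F g (ofH1 _ (loopClass (c g'))) = 0

/-- The functionals are the degrees of the heights in the cylinders. Their equivariance under
`φ_{-1}` requires that `φ_{-1}` permute the cylinders themselves, whereas the hypothesis `h2`
concerns homology classes only. -/
theorem exists_isTransvection (hd : d % 8 = 3) (hd5 : 5 ≤ d) {θ : ℤ × ℤ} (hθ : θ ≠ 0) {L : ℝ}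
    {c : Q8 → C(UnitAddCircle, QCover d)} {T : QCover d ≃ₜ QCover d}
    (hT : IsDehnMultitwist θ T) (hc : IsCylinderDecomposition θ L c)
    (h2 : ∀ g h, homologyRep (QCover d) (deck d h) (loopClass (c g)) = loopClass (c (h * g)))
    (hli : LinearIndependent ℝ (cTilde c)) :
    ∃ m F, IsTransvection c T m F := by
  have hs := isSingular_vertex hd hd5
  obtain ⟨f⟩ := Frame.exists_frame hθ
  have hp := f.isCoveringMapOn_proj (h := coverH d) (v := coverV d)
  obtain ⟨n, D, w, hD, -, hw, hcD⟩ := hc.exists_chart hs f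
  obtain ⟨m, hTm⟩ := hT.isTwist hs f hD
  have hinj : Function.Injective fun g => loopClass (c g) :=
    injective_of_linearIndependent (fun g h => h2 g h) hli
  have hcseg : ∀ g, ofH1 _ (loopClass (c g)) = seg (D g) (w g) ((w g).1 + n, (w g).2) := by
    intro g
    rw [ofH1_loopClass]
    refine seg_congr fun t _ => ?_
    rw [hcD, show w g = ((w g).1, (w g).2) from rfl, comb_mk]
    congr 1
    refine Prod.ext ?_ ?_ <;> simp
    ring
  have hdeck : ∀ h x, f.proj (deck d h x) = f.proj x := fun h x =>
    congrArg f.torusMap (proj_relabelHomeo _ _ _ x)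
  have hshift : ∀ h g, ∃ k : ℤ, ∀ e ∈ strip, deck d h (D g e) = D (h * g) (e.1 + k, e.2) := by
    intro h g
    obtain ⟨g', k, hk⟩ := IsCylinderChart.exists_shift hp hD (deck d h) (hdeck h) g
    -- The automorphism maps the cylinder `g` to some cylinder `g'`; as the classes of the waist
    -- curves are pairwise distinct, the class identifies `g'`.
    have hg' : g' = h * g := by
      apply hinj
      apply ofH1_injective
      simp only
      rw [← h2 g h]
      change _ = ofH1 _ (H1.map _ (loopClass (c g)))
      rw [ofH1_map, hcseg, hcseg, map_seg _ convex_strip (hD.lift g).continuousOn (hw g)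
        (show ((w g).1 + n, (w g).2) ∈ strip from hw g)]
      have h3 : seg (fun e => (deck d h : C(QCover d, QCover d)) (D g e)) (w g)
          ((w g).1 + n, (w g).2) = seg (D g') ((w g).1 + k, (w g).2)
            ((w g).1 + k + n, (w g).2) := by
        refine seg_congr fun t ht => ?_
        have hm : (1 - t) • w g + t • ((w g).1 + n, (w g).2) ∈ strip :=
          convex_strip (hw g) (hw g) (by linarith [ht.2]) ht.1 (by ring)
        change deck d h (D g _) = _
        rw [hk _ hm, comb_mk, show w g = ((w g).1, (w g).2) from rfl, comb_mk]
        congr 1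
        refine Prod.ext ?_ ?_ <;> simp
        ring
      rw [h3]
      exact (hD.lift g').seg_shift (fun e he => by simpa using hD.periodic g' e he 1) (hw g')
        (e' := ((w g).1 + k, (w g).2)) (hw g)
    exact ⟨k, hg' ▸ hk⟩
  refine ⟨m, fun g => deg (hD.height hp f.continuous_proj g), by exact_mod_cast hTm.ne_zero,
    hT.mem_affStar hs hTm, fun hγ => ?_, hc.seg_eq_sum_deg hs f hD hw hcD, fun g u => ?_,
    fun g g' => ?_⟩
  · simp only [hcseg]
    exact hTm.map_closedGeodesic hs hw hγ
  · rw [deg_map]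
    congr 2
    ext x
    change hD.height hp f.continuous_proj g (deck d neg x) = _
    by_cases hx : (f.proj x).2 = 0
    · rw [hD.height_of_snd_eq_zero hp f.continuous_proj hx, hD.height_of_snd_eq_zero hp
        f.continuous_proj (by rw [hdeck, hx])]
    · obtain ⟨g', e, he, rfl⟩ := hD.cover x hx
      obtain ⟨k, hk⟩ := hshift neg g'
      rw [hk e he]
      by_cases hg : g = neg * g'
      · subst hg
        rw [neg_mul_neg_mul, hD.height_self hp f.continuous_proj g' he,
          hD.height_self hp f.continuous_proj (neg * g') (e := (e.1 + k, e.2)) he]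
      · rw [hD.height_of_ne hp f.continuous_proj hg (e := (e.1 + k, e.2)) he,
          hD.height_of_ne hp f.continuous_proj ?_ he]
        rintro rfl
        exact hg (neg_mul_neg_mul g).symm
  · rw [hcseg]
    exact hD.deg_height_waist hp f.continuous_proj g g' (hw g') _

end QCover

/-! ### Irreducibility -/

namespace QCover

open SquareTiled TorusCover PathMod Q8

variable {d : ℕ}

theorem ofH1_deck_neg {u : H1 (QCover d)} (hu : u ∈ H1minus d) :
    PathMod.map (deck d neg : C(QCover d, QCover d)) (ofH1 _ u) = - ofH1 _ u := by
  rw [← ofH1_map]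
  have h1 : H1.map (deck d neg : C(QCover d, QCover d)) u = (-1 : ℝ) • u :=
    Module.End.mem_eigenspace_iff.1 hu
  rw [h1, map_smul, neg_one_smul]

theorem deck_neg_deck_neg (x : QCover d) : deck d neg (deck d neg x) = x := by
  obtain ⟨s, q, rfl⟩ := exists_pt x
  rw [deck_pt, deck_pt, neg_mul_neg_mul]

/-- The difference of a side of a square and of its image under `φ_{-1}` is a class of `H₁⁻`. -/
theorem exists_mem_H1minus (hd : d % 8 = 3) (hd5 : 5 ≤ d) (s : Q8 × Fin d) {A B : ℝ × ℝ}
    (hA : proj (sq s A : QCover d) = 0) (hB : proj (sq s B : QCover d) = 0) :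
    ∃ u ∈ H1minus d, ofH1 _ u = seg (sq s) A B -
      PathMod.map (deck d neg : C(QCover d, QCover d)) (seg (sq s) A B) := by
  have hc := (continuous_sq (h := coverH d) (v := coverV d) s).continuousOn (s := Set.univ)
  have hc' : ContinuousOn (fun e => (deck d neg : C(QCover d, QCover d)) (sq s e)) Set.univ :=
    (deck d neg : C(QCover d, QCover d)).continuous.comp_continuousOn hc
  have hm := map_seg (deck d neg : C(QCover d, QCover d)) convex_univ hc (Set.mem_univ A)
    (Set.mem_univ B)
  have hmm : PathMod.map (deck d neg : C(QCover d, QCover d))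
      (PathMod.map (deck d neg : C(QCover d, QCover d)) (seg (sq s) A B)) = seg (sq s) A B := by
    rw [hm, map_seg _ convex_univ hc' (Set.mem_univ A) (Set.mem_univ B)]
    exact seg_congr fun t _ => deck_neg_deck_neg _
  -- The ends are vertices, which `φ_{-1}` fixes, so the path and its image have the same ends.
  obtain ⟨u, hu⟩ := exists_ofH1_eq_seg_sub convex_univ hc (Set.mem_univ A) (Set.mem_univ B)
    convex_univ hc' (Set.mem_univ A) (Set.mem_univ B) (deck_neg_vertex hd hd5 hA).symm
    (deck_neg_vertex hd hd5 hB).symm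
  rw [← hm] at hu
  refine ⟨u, Module.End.mem_eigenspace_iff.2 ?_, hu⟩
  change H1.map (deck d neg : C(QCover d, QCover d)) u = (-1 : ℝ) • u
  apply ofH1_injective
  rw [ofH1_map, hu, map_smul, hu, map_sub, hmm, neg_one_smul, neg_sub]

namespace IsTransvection

variable {c : Q8 → C(UnitAddCircle, QCover d)} {T : QCover d ≃ₜ QCover d} {m : ℝ}
  {F : Q8 → PathMod (QCover d) →ₗ[ℝ] ℝ} (hF : IsTransvection c T m F)

theorem neg_apply (hF : IsTransvection c T m F) (g : Q8) {u : H1 (QCover d)} (hu : u ∈ H1minus d) :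
    F (neg * g) (ofH1 _ u) = - F g (ofH1 _ u) := by
  rw [← hF.deck_neg, ofH1_deck_neg hu, map_neg]

/-- The coefficients are values of the functional on classes of `H₁⁻`, namely sides minus their
images under `φ_{-1}`; on these classes a relation between functionals can be evaluated. -/
theorem ofH1_cTilde (hF : IsTransvection c T m F) (a : Fin 4) : ofH1 _ (cTilde c a) =
    ∑ s, ((F (plus a) (seg (sq s) (1, 0) (1, 1) -
        PathMod.map (deck d neg : C(QCover d, QCover d)) (seg (sq s) (1, 0) (1, 1)))) • dualRight s -
      (F (plus a) (seg (sq s) (0, 1) (1, 1) -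
        PathMod.map (deck d neg : C(QCover d, QCover d)) (seg (sq s) (0, 1) (1, 1)))) •
          dualTop s) := by
  rw [cTilde, map_sub, hF.dual, hF.dual, ← Finset.sum_sub_distrib]
  refine Finset.sum_congr rfl fun s _ => ?_
  rw [map_sub, map_sub, hF.deck_neg, hF.deck_neg, sub_smul, sub_smul]
  abel

theorem sum_apply (hF : IsTransvection c T m F) {u : H1 (QCover d)} (hu : u ∈ H1minus d) :
    ∑ g, F g (ofH1 _ u) • loopClass (c g) = ∑ a, F (plus a) (ofH1 _ u) • cTilde c a := by
  rw [sum_eq_sum_plus]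
  refine Finset.sum_congr rfl fun a _ => ?_
  rw [hF.neg_apply _ hu, cTilde, smul_sub, neg_smul, sub_eq_add_neg]

/-- The action of a multitwist on the span of the classes of closed geodesics. -/
theorem homologyRep_sub (hF : IsTransvection c T m F) {u : H1 (QCover d)} (hu : u ∈ H1minus d)
    (hspan : u ∈ Submodule.span ℝ {x | ∃ (η : ℤ × ℤ) (L : ℝ) (γ : C(UnitAddCircle, QCover d)),
      IsClosedGeodesic η L γ ∧ x = loopClass γ}) :
    homologyRep (QCover d) T u - u = ∑ a, (m * F (plus a) (ofH1 _ u)) • cTilde c a := by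
  have h1 : homologyRep (QCover d) T u - u = m • ∑ g, F g (ofH1 _ u) • loopClass (c g) := by
    let N : H1 (QCover d) →ₗ[ℝ] H1 (QCover d) := homologyRep (QCover d) T - 1 - m • ∑ g,
      (F g ∘ₗ ofH1 (QCover d)).smulRight (loopClass (c g))
    have hN : ∀ x, N x = homologyRep (QCover d) T x - x -
        m • ∑ g, F g (ofH1 _ x) • loopClass (c g) := fun x => by
      simp [N, LinearMap.sum_apply]
    suffices hle : N u = 0 by
      rw [hN] at hle
      exact sub_eq_zero.1 hle
    -- The defect of the formula is linear in the class and vanishes on closed geodesics, hence on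
    -- their span.
    refine LinearMap.mem_ker.1 ((Submodule.span_le.2 ?_ : _ ≤ LinearMap.ker N) hspan)
    rintro _ ⟨η, L, γ, hγ, rfl⟩
    refine LinearMap.mem_ker.2 ?_
    rw [hN, sub_eq_zero]
    apply ofH1_injective
    have h2 := hF.twist_sub hγ
    rw [← ofH1_map] at h2
    rw [map_sub, map_smul, map_sum]
    simp only [map_smul]
    exact h2
  rw [h1, hF.sum_apply hu, Finset.smul_sum]
  simp only [smul_smul]

end IsTransvection

/-- Non-degeneracy by duality: a relation between the functionals on `H₁⁻`, applied to every side
minus its image, kills all coefficients of the same combination of the `c̃`, up to the factors `m`.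
Independence of the `c̃` and `m ≠ 0` finish the argument. -/
theorem eq_zero_of_sum_apply_eq_zero (hd : d % 8 = 3) (hd5 : 5 ≤ d) {ι : Type} [Fintype ι]
    {c : ι → Q8 → C(UnitAddCircle, QCover d)} {T : ι → (QCover d ≃ₜ QCover d)} {m : ι → ℝ}
    {F : ι → Q8 → PathMod (QCover d) →ₗ[ℝ] ℝ} (hF : ∀ r, IsTransvection (c r) (T r) (m r) (F r))
    (hb : LinearIndependent ℝ (fun x : ι × Fin 4 => cTilde (c x.1) x.2)) {x : ι × Fin 4 → ℝ}
    (hx : ∀ u ∈ H1minus d, ∑ i, x i * (m i.1 * F i.1 (plus i.2) (ofH1 _ u)) = 0) : x = 0 := by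
  have hedge : ∀ s : Q8 × Fin d, ∀ A B : ℝ × ℝ, proj (sq s A : QCover d) = 0 →
      proj (sq s B : QCover d) = 0 → ∑ i : ι × Fin 4, (x i * m i.1) * F i.1 (plus i.2)
        (seg (sq s) A B - PathMod.map (deck d neg : C(QCover d, QCover d))
          (seg (sq s) A B)) = 0 := by
    intro s A B hA hB
    obtain ⟨u, hu, hu'⟩ := exists_mem_H1minus hd hd5 s hA hB
    rw [← hu', ← hx u hu]
    refine Finset.sum_congr rfl fun i _ => ?_
    rw [mul_assoc]
  have hv : ∀ (s : Q8 × Fin d) (e : ℝ × ℝ), (e.1 = 0 ∨ e.1 = 1) → (e.2 = 0 ∨ e.2 = 1) →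
      proj (sq s e : QCover d) = 0 := by
    intro s e he1 he2
    have h11 : ((1 : ℝ) : UnitAddCircle) = 0 := AddCircle.coe_period 1
    rw [proj_sq]
    · refine Prod.ext ?_ ?_
      · rcases he1 with h | h <;> simp [toTorus, h, h11]
      · rcases he2 with h | h <;> simp [toTorus, h, h11]
    · rcases he1 with h | h <;> simp [h]
    · rcases he2 with h | h <;> simp [h]
  have hsum : ∑ i : ι × Fin 4, (x i * m i.1) • cTilde (c i.1) i.2 = 0 := by
    apply ofH1_injective
    rw [map_sum, map_zero]
    simp only [map_smul, (hF _).ofH1_cTilde, Finset.smul_sum, smul_sub, smul_smul]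
    rw [Finset.sum_comm]
    refine Finset.sum_eq_zero fun s _ => ?_
    rw [Finset.sum_sub_distrib, ← Finset.sum_smul, ← Finset.sum_smul,
      hedge s (1, 0) (1, 1) (hv s _ (by simp) (by simp)) (hv s _ (by simp) (by simp)),
      hedge s (0, 1) (1, 1) (hv s _ (by simp) (by simp)) (hv s _ (by simp) (by simp))]
    simp
  funext i
  have h0 := Fintype.linearIndependent_iff.1 hb _ hsum i
  exact (mul_eq_zero.1 h0).resolve_right (hF i.1).ne_zero

end QCover

theorem isIrreducible_of_submodule {G V : Type*} [Group G] [AddCommGroup V] [Module ℝ V]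
    [Nontrivial V] (ρ : Representation ℝ G V)
    (h : ∀ W : Submodule ℝ V, W ≠ ⊥ → (∀ g, ∀ u ∈ W, ρ g u ∈ W) → W = ⊤) :
    ρ.IsIrreducible := by
  have hnt : Nontrivial (Subrepresentation ρ) := by
    refine ⟨⟨⊥, ⊤, fun h => bot_ne_top (α := Submodule ℝ V) ?_⟩⟩
    exact congrArg Subrepresentation.toSubmodule h
  refine ⟨fun W => ?_⟩
  by_cases hW : W.toSubmodule = ⊥
  · exact Or.inl (Subrepresentation.toSubmodule_injective hW)
  exact Or.inr (Subrepresentation.toSubmodule_injective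
    (h _ hW fun g u hu => W.apply_mem_toSubmodule g hu))

end

/-! ### Unipotence of the multitwists and passage to finite-index subgroups. -/

theorem lemma4p4 (d : ℕ) (hd : d % 8 = 3) (hd5 : 5 ≤ d)
    (θ : Fin d → ℤ × ℤ) (hθ : ∀ r, θ r ≠ 0)
    (L : Fin d → ℝ) (c : Fin d → Q8 → C(UnitAddCircle, QCover d))
    (T : Fin d → (QCover d ≃ₜ QCover d))
    (hT : ∀ r, SquareTiled.IsDehnMultitwist (θ r) (T r))
    (h1 : ∀ r, SquareTiled.IsCylinderDecomposition (θ r) (L r) (c r))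
    (h2 : ∀ r g h, homologyRep (QCover d) (deck d h) (loopClass (c r g)) =
      loopClass (c r (h * g)))
    (h3 : LinearIndependent ℝ (fun x : Fin d × Fin 4 => cTilde (c x.1) x.2) ∧
      Submodule.span ℝ (Set.range fun x : Fin d × Fin 4 => cTilde (c x.1) x.2) = H1minus d)
    (h4 : ∀ r s, r ≠ s → ∀ u ∈ cSpan (c r), u ≠ 0 → homologyRep (QCover d) (T s) u ≠ u)
    (h5 : ∀ u ∈ cSpan (c ⟨0, by omega⟩), u ≠ 0 →
      cSpan (c ⟨0, by omega⟩) = Submodule.span ℝ ({u} ∪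
        {w | ∃ r : Fin d, 2 ≤ r.1 ∧ r.1 ≤ 4 ∧
          w = (homologyRep (QCover d) (T ⟨0, by omega⟩) - 1)
            ((homologyRep (QCover d) (T r) - 1)
              ((homologyRep (QCover d) (T ⟨1, by omega⟩) - 1) u))}))
    (Γ : Subgroup (AffStar d)) (hΓ : Γ.FiniteIndex) :
    Representation.IsIrreducible ((minusRep d).comp Γ.subtype) := by
  have hd0 : 0 < d := by omega
  have hd1 : 1 < d := by omega
  choose m F hF using fun r => QCover.exists_isTransvection hd hd5 (hθ r) (hT r) (h1 r) (h2 r)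
    (h3.1.comp (fun a => (r, a)) fun a a' h => congrArg Prod.snd h)
  have hmem : ∀ r a, cTilde (c r) a ∈ H1minus d := fun r a =>
    h3.2 ▸ Submodule.subset_span (Set.mem_range_self (r, a))
  let b : Fin d → Fin 4 → H1minus d := fun r a => ⟨cTilde (c r) a, hmem r a⟩
  have hb : LinearIndependent ℝ fun x : Fin d × Fin 4 => b x.1 x.2 :=
    LinearIndependent.of_comp (H1minus d).subtype h3.1
  have hmap : ∀ s : Set (H1minus d), (Submodule.span ℝ s).map (H1minus d).subtype =
      Submodule.span ℝ (Subtype.val '' s) := fun s => Submodule.map_span _ _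
  have hspan : Submodule.span ℝ (Set.range fun x : Fin d × Fin 4 => b x.1 x.2) = ⊤ := by
    apply Submodule.map_injective_of_injective (H1minus d).subtype_injective
    rw [hmap, ← Set.range_comp, Submodule.map_top, Submodule.range_subtype]
    exact h3.2
  -- By condition 3 the waist curves already span `H₁⁻`, so the action of a multitwist is needed
  -- only on closed geodesics.
  have hgeo : ∀ u ∈ H1minus d, u ∈ Submodule.span ℝ {x | ∃ (η : ℤ × ℤ) (L : ℝ)
      (γ : C(UnitAddCircle, QCover d)), SquareTiled.IsClosedGeodesic η L γ ∧ x = loopClass γ} := by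
    rw [← SetLike.le_def, ← h3.2, Submodule.span_le]
    rintro _ ⟨⟨r, a⟩, rfl⟩
    exact Submodule.sub_mem _
      (Submodule.subset_span ⟨θ r, L r, _, (h1 r).geodesic _, rfl⟩)
      (Submodule.subset_span ⟨θ r, L r, _, (h1 r).geodesic _, rfl⟩)
  let τ : Fin d → AffStar d := fun r => ⟨T r, (hF r).mem_affStar⟩
  let N : Fin d → H1minus d →ₗ[ℝ] H1minus d := fun r => minusRep d (τ r) - 1
  have hNcoe : ∀ r (u : H1minus d),
      ((N r u : H1minus d) : H1 (QCover d)) = (homologyRep (QCover d) (T r) - 1) u :=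
    fun r u => rfl
  let φ : Fin d → Fin 4 → H1minus d →ₗ[ℝ] ℝ := fun r a =>
    m r • (F r (Q8.plus a) ∘ₗ PathMod.ofH1 (QCover d) ∘ₗ (H1minus d).subtype)
  have hφ : ∀ r a (u : H1minus d), φ r a u = m r * F r (Q8.plus a) (PathMod.ofH1 _ u) := fun r a u => rfl
  have hN : ∀ r u, N r u = ∑ a, φ r a u • b r a := by
    intro r u
    apply Subtype.ext
    rw [hNcoe]
    refine ((hF r).homologyRep_sub u.2 (hgeo u u.2)).trans ?_
    rw [Submodule.coe_sum]
    rfl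
  have hcSpan : ∀ r, (Submodule.span ℝ (Set.range (b r))).map (H1minus d).subtype =
      cSpan (c r) := fun r => by
    rw [hmap, ← Set.range_comp]
    rfl
  have hNb : ∀ r a, N r (b r a) = 0 := by
    intro r a
    rw [hN]
    refine Finset.sum_eq_zero fun a' _ => ?_
    have h0 : φ r a' (b r a) = 0 := by
      rw [hφ]
      change m r * F r (Q8.plus a') (PathMod.ofH1 _ (cTilde (c r) a)) = 0
      rw [cTilde, map_sub, map_sub, (hF r).waist, (hF r).waist, sub_zero, mul_zero]
    rw [h0, zero_smul]
  have hNN : ∀ r u, N r (N r u) = 0 := by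
    intro r u
    rw [hN r u, map_sum]
    exact Finset.sum_eq_zero fun a _ => by rw [map_smul, hNb, smul_zero]
  -- `N r` has square zero, so powers of `T r` are affine in the exponent.
  have hpow : ∀ r (k : ℕ) u, minusRep d (τ r ^ k) u = u + (k : ℝ) • N r u := by
    intro r k u
    induction k with
    | zero => simp
    | succ k ih =>
      have hτ : ∀ x, minusRep d (τ r) x = x + N r x := fun x => by simp [N]
      rw [pow_succ', map_mul, Module.End.mul_apply, ih, hτ, map_add, map_smul, hNN]
      push_cast
      module
  have hnd : ∀ x : Fin d × Fin 4 → ℝ, (∀ u, ∑ i, x i * φ i.1 i.2 u = 0) → x = 0 := by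
    intro x hx
    exact QCover.eq_zero_of_sum_apply_eq_zero hd hd5 hF h3.1 fun u hu => hx ⟨u, hu⟩
  have h4' : ∀ r s, r ≠ s → ∀ u ∈ Submodule.span ℝ (Set.range (b r)), u ≠ 0 → N s u ≠ 0 := by
    intro r s hrs u hu hu0 h0
    refine h4 r s hrs u (hcSpan r ▸ Submodule.mem_map_of_mem hu) (fun h => hu0 (Subtype.ext h)) ?_
    have := congrArg Subtype.val h0
    rw [hNcoe] at this
    exact sub_eq_zero.1 this
  have h5' : ∀ u ∈ Submodule.span ℝ (Set.range (b ⟨0, hd0⟩)), u ≠ 0 →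
      Submodule.span ℝ (Set.range (b ⟨0, hd0⟩)) ≤ Submodule.span ℝ ({u} ∪
        {w | ∃ r ∈ {r : Fin d | 2 ≤ r.1 ∧ r.1 ≤ 4},
          w = N ⟨0, hd0⟩ (N r (N ⟨1, hd1⟩ u))}) := by
    intro u hu hu0
    have h6 := h5 u (hcSpan _ ▸ Submodule.mem_map_of_mem hu) fun h => hu0 (Subtype.ext h)
    rw [← hcSpan] at h6
    rw [← Submodule.map_le_map_iff_of_injective (H1minus d).subtype_injective, h6, hmap]
    refine Submodule.span_mono ?_
    rintro w (hw | ⟨r, hr2, hr4, rfl⟩)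
    · exact ⟨u, Or.inl rfl, (Set.mem_singleton_iff.1 hw).symm⟩
    · exact ⟨_, Or.inr ⟨r, ⟨hr2, hr4⟩, rfl⟩, rfl⟩
  have : Nontrivial (H1minus d) := nontrivial_of_ne _ _ (hb.ne_zero (⟨0, hd0⟩, 0))
  clear_value τ
  have hNW : ∀ (W : Submodule ℝ (H1minus d)),
      (∀ (g : Γ), ∀ u ∈ W, minusRep d g u ∈ W) → ∀ r, ∀ u ∈ W, N r u ∈ W := by
    intro W hW r u hu
    -- Some positive power of the multitwist lies in `Γ`; as it acts by `1 + k N` with `k ≠ 0`,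
    -- invariance under it gives invariance under `N`.
    obtain ⟨k, hk, -, hkΓ⟩ := Subgroup.exists_pow_mem_of_index_ne_zero hΓ.index_ne_zero (τ r)
    have h6 := hW ⟨_, hkΓ⟩ u hu
    rw [hpow] at h6
    have hk' : (k : ℝ) ≠ 0 := by exact_mod_cast hk.ne'
    exact (Submodule.smul_mem_iff _ hk').1 ((Submodule.add_mem_iff_right _ hu).1 h6)
  clear_value N φ b
  exact isIrreducible_of_submodule _ fun W hW hinv =>
    eq_top_of_transvections hb hspan hN hnd h4' h5' hW (hNW W hinv)
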